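/- Let $n\ge 0$, $G=GL(n,\mathbb R)$, let $N$, $N_-$ be the groups of unipotent upper, respectively lower, triangular matrices, $B_-$ the group of invertible lower triangular matrices, and $\mathfrak n$, $\mathfrak n_-$, $\mathfrak a$ the Lie algebras of $N$, $N_-$ and of the diagonal subgroup. Let $X=G/B_-$, let $o\in X$ be the identity coset, and for $(\lambda,\delta)\in\mathbb C^n\times(\mathbb Z/2\mathbb Z)^n$ let $\mathcal L_{\lambda,\delta}\to X$ be the $G$-equivariant line bundle on whose fibre at $o$ the group $B_-$ acts by the character $b\mapsto\prod_{j=1}^n |b_{jj}|^{\lambda_j+j-\frac{n+1}2}\operatorname{sgn}(b_{jj})^{\delta_j}$. Let $w$ be an element of the normalizer of the diagonal subgroup, $C_w=N\cdot wo$ the Schubert cell through $wo$, and $U_w=wN\cdot o$, an open subset of $X$ which contains $C_w$ as a closed submanifold. Write $\ell(Z)$ for the action of $Z\in\mathfrak{gl}(n,\mathbb R)$ on functions and on (distribution) sections of $\mathcal L_{\lambda,\delta}$ by infinitesimal left translation. Every point of $U_w$ can be written uniquely as $n_1n_2wo$ with $n_1\in wNw^{-1}\cap N$ and $n_2\in wNw^{-1}\cap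 N_-$. For $Z\in\mathfrak{gl}(n,\mathbb R)$ let $m(Z)$ be the vector field on $U_w$ defined by $(m(Z)f)(n_1n_2wo)=\frac{d}{dt}f(n_1\exp(-tZ)n_2wo)\big|_{t=0}$. Write $m(Z)=\sum_j a_j\,\ell(Z_j)$ with $Z_j$ running over a basis of $w\mathfrak n w^{-1}$ and $a_j\in C^\infty(U_w)$, and put $m(Z)\sigma=\sum_j a_j\,\ell(Z_j)\sigma$ for a distribution section $\sigma$ of $\mathcal L_{\lambda,\delta}$ over $U_w$. A distribution section over $U_w$ has normal degree zero if its value on a test section (a compactly supported smooth measure with values in the dual line bundle) depends only on the restriction of the test section to $C_w$, i.e. if it comes from a distribution on $C_w$. For a distribution section $\sigma$ over $U_w$ with support in $C_w$, and $x\in\operatorname{supp}\sigma$, the normal degree of $\sigma$ at $x$ is the least $d$ such that $\sigma$ is, near $x$, a finite sum of terms $\ell(Y_1)\cdots\ell(Y_k)\sigma_0$ with $k\le d$, $Y_i\in\mathfrak n_-\cap w\mathfrak n w^{-1}$ and $\sigma_0$ of normal degree zero ($+\infty$ if there is no such $d$); at points outside the support it is $-\infty$. Proposition. Let $\sigma\in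 C^{-\infty}(U_w,\mathcal L_{\lambda,\delta})$ be a distribution section with support in $C_w$, and let $Z\in w\mathfrak n_-w^{-1}\cap\mathfrak n$. Suppose that (i) $[Z,\,w\mathfrak n w^{-1}\cap\mathfrak n_-]\subset\mathfrak a+\mathfrak n+w\mathfrak n_-w^{-1}$, and (ii) $\ell(Z)-m(Z)$ annihilates $\sigma$. Then $\ell(Z)$ strictly lowers the normal degree of $\sigma$: at every point of the support of $\sigma$, the normal degree of $\ell(Z)\sigma$ is strictly less than the normal degree of $\sigma$. -/

import Mathlib

open scoped Distributions ContDiff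

namespace FlagDistribution

noncomputable section

/-- Real `n × n` matrices, as a normed algebra. `GL(n, ℝ)`, the group of units, is an open subset
of this vector space; the norm (the operator norm for the sup norm on `ℝⁿ`) only serves to provide
the usual topology and the usual smooth structure. -/
def Mat (n : ℕ) : Type := Matrix (Fin n) (Fin n) ℝ

section

attribute [local instance] Matrix.linftyOpNormedRing Matrix.linftyOpNormedAlgebra

instance instNormedRingMat (n : ℕ) : NormedRing (Mat n) :=
  inferInstanceAs (NormedRing (Matrix (Fin n) (Fin n) ℝ))

instance instNormedAlgebraMat (n : ℕ) : NormedAlgebra ℝ (Mat n) :=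
  inferInstanceAs (NormedAlgebra ℝ (Matrix (Fin n) (Fin n) ℝ))

end

instance instFiniteDimensionalMat (n : ℕ) : FiniteDimensional ℝ (Mat n) :=
  (Matrix.ofLinearEquiv ℝ : (Fin n → Fin n → ℝ) ≃ₗ[ℝ] Matrix (Fin n) (Fin n) ℝ).finiteDimensional

instance instCompleteSpaceMat (n : ℕ) : CompleteSpace (Mat n) :=
  FiniteDimensional.complete ℝ (Mat n)

section Entries

variable {n : ℕ}

theorem add_entry (A B : Mat n) (i j : Fin n) : (A + B) i j = A i j + B i j := rfl
theorem smul_entry (c : ℝ) (A : Mat n) (i j : Fin n) : (c • A) i j = c * A i j := rfl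
theorem zero_entry (i j : Fin n) : (0 : Mat n) i j = 0 := rfl
theorem mul_entry (A B : Mat n) (i j : Fin n) : (A * B) i j = ∑ k, A i k * B k j := rfl
theorem one_entry (i j : Fin n) : (1 : Mat n) i j = if i = j then 1 else 0 := Matrix.one_apply

theorem mat_ext {A B : Mat n} (h : ∀ i j, A i j = B i j) : A = B := Matrix.ext h

end Entries

/-- The group `GL(n, ℝ)`. -/
abbrev GLn (n : ℕ) : Type := (Mat n)ˣ

/-! ### Subgroups of `GL(n, ℝ)` (as sets of matrices) and Lie algebras -/

/-- The group `N` of unipotent upper triangular matrices. -/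
def upperUnipotent (n : ℕ) : Set (Mat n) :=
  {u | (∀ i j, j < i → u i j = 0) ∧ ∀ i, u i i = 1}

/-- The group `N₋` of unipotent lower triangular matrices. -/
def lowerUnipotent (n : ℕ) : Set (Mat n) :=
  {u | (∀ i j, i < j → u i j = 0) ∧ ∀ i, u i i = 1}

/-- The group `B₋` of invertible lower triangular matrices. -/
def lowerBorel (n : ℕ) : Set (Mat n) :=
  {b | (∀ i j, i < j → b i j = 0) ∧ ∀ i, b i i ≠ 0}

/-- The embedding of the diagonal matrices. -/
def diagonalHom (n : ℕ) : (Fin n → ℝ) →* Mat n where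
  toFun d := (Matrix.diagonal d : Matrix (Fin n) (Fin n) ℝ)
  map_one' := Matrix.diagonal_one
  map_mul' d e := (Matrix.diagonal_mul_diagonal d e).symm

/-- The diagonal subgroup of `GL(n, ℝ)`. -/
def diagonalSubgroup (n : ℕ) : Subgroup (GLn n) :=
  (Units.map (diagonalHom n)).range

/-- `w S w⁻¹` for a set `S` of matrices. -/
def conjSet {n : ℕ} (w : GLn n) (S : Set (Mat n)) : Set (Mat n) :=
  (fun u : Mat n ↦ (w : Mat n) * u * ((w⁻¹ : GLn n) : Mat n)) '' S

/-- The Lie algebra `𝔫` of `N`: strictly upper triangular matrices. -/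
def nPlus (n : ℕ) : Submodule ℝ (Mat n) where
  carrier := {Z | ∀ i j, j ≤ i → Z i j = 0}
  add_mem' hY hZ i j h := by rw [add_entry, hY i j h, hZ i j h, add_zero]
  zero_mem' _ _ _ := rfl
  smul_mem' c Z hZ i j h := by rw [smul_entry, hZ i j h, mul_zero]

/-- The Lie algebra `𝔫₋` of `N₋`: strictly lower triangular matrices. -/
def nMinus (n : ℕ) : Submodule ℝ (Mat n) where
  carrier := {Z | ∀ i j, i ≤ j → Z i j = 0}
  add_mem' hY hZ i j h := by rw [add_entry, hY i j h, hZ i j h, add_zero]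
  zero_mem' _ _ _ := rfl
  smul_mem' c Z hZ i j h := by rw [smul_entry, hZ i j h, mul_zero]

/-- The Lie algebra `𝔞` of the diagonal subgroup: diagonal matrices. -/
def aDiag (n : ℕ) : Submodule ℝ (Mat n) where
  carrier := {Z | ∀ i j, i ≠ j → Z i j = 0}
  add_mem' hY hZ i j h := by rw [add_entry, hY i j h, hZ i j h, add_zero]
  zero_mem' _ _ _ := rfl
  smul_mem' c Z hZ i j h := by rw [smul_entry, hZ i j h, mul_zero]

/-- `w 𝔰 w⁻¹` for a linear subspace `𝔰` of the Lie algebra of `GL(n, ℝ)`. -/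
def conjLie {n : ℕ} (w : GLn n) (S : Submodule ℝ (Mat n)) : Submodule ℝ (Mat n) :=
  S.map (LinearMap.mulLeft ℝ (w : Mat n) ∘ₗ
    LinearMap.mulRight ℝ ((w⁻¹ : GLn n) : Mat n))

/-! ### The open set `U_w = w N · o` and the Schubert cell `C_w = N · w o`

Subsets of the flag variety `X = GL(n, ℝ) / B₋` are described by their preimages in `GL(n, ℝ)`;
`o` is the identity coset. -/

/-- The preimage `N w B₋` in `GL(n, ℝ)` of the Schubert cell `C_w = N · w o`. -/
def schubertCell {n : ℕ} (w : GLn n) : Set (Mat n) :=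
  {g | ∃ u ∈ upperUnipotent n, ∃ b ∈ lowerBorel n, g = u * (w : Mat n) * b}

/-- The preimage `w N B₋` in `GL(n, ℝ)` of `U_w = w N · o`, as a set. -/
def bigCellSet {n : ℕ} (w : GLn n) : Set (Mat n) :=
  {g | ∃ u ∈ upperUnipotent n, ∃ b ∈ lowerBorel n, g = (w : Mat n) * u * b}

theorem upperUnipotent_mul {n : ℕ} {u v : Mat n} (hu : u ∈ upperUnipotent n)
    (hv : v ∈ upperUnipotent n) : u * v ∈ upperUnipotent n := by
  refine ⟨fun i j hij ↦ ?_, fun i ↦ ?_⟩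
  · rw [mul_entry]
    refine Finset.sum_eq_zero fun k _ ↦ ?_
    rcases lt_or_ge k i with h | h
    · rw [hu.1 i k h, zero_mul]
    · rw [hv.1 k j (hij.trans_le h), mul_zero]
  · rw [mul_entry, Finset.sum_eq_single i, hu.2, hv.2, one_mul]
    · intro k _ hk
      rcases lt_or_gt_of_ne hk with h | h
      · rw [hu.1 i k h, zero_mul]
      · rw [hv.1 k i h, mul_zero]
    · simp

theorem lowerBorel_mul {n : ℕ} {b c : Mat n} (hb : b ∈ lowerBorel n)
    (hc : c ∈ lowerBorel n) : b * c ∈ lowerBorel n := by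
  refine ⟨fun i j hij ↦ ?_, fun i ↦ ?_⟩
  · rw [mul_entry]
    refine Finset.sum_eq_zero fun k _ ↦ ?_
    rcases lt_or_ge i k with h | h
    · rw [hb.1 i k h, zero_mul]
    · rw [hc.1 k j (h.trans_lt hij), mul_zero]
  · rw [mul_entry, Finset.sum_eq_single i]
    · exact mul_ne_zero (hb.2 i) (hc.2 i)
    · intro k _ hk
      rcases lt_or_gt_of_ne hk with h | h
      · rw [hc.1 k i h, mul_zero]
      · rw [hb.1 i k h, zero_mul]
    · simp

theorem isUnit_of_upperUnipotent {n : ℕ} {u : Mat n} (hu : u ∈ upperUnipotent n) : IsUnit u := by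
  have h : IsUnit (show Matrix (Fin n) (Fin n) ℝ from u) := by
    rw [Matrix.isUnit_iff_isUnit_det, Matrix.det_of_isUpperTriangular (fun i j h ↦ hu.1 i j h)]
    simp [hu.2]
  exact h

theorem isUnit_of_lowerBorel {n : ℕ} {b : Mat n} (hb : b ∈ lowerBorel n) : IsUnit b := by
  have h : IsUnit (show Matrix (Fin n) (Fin n) ℝ from b) := by
    rw [Matrix.isUnit_iff_isUnit_det, Matrix.det_of_isLowerTriangular _ (fun i j h ↦ hb.1 i j h)]
    exact (Finset.prod_ne_zero_iff.mpr fun i _ ↦ hb.2 i).isUnit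
  exact h

/-- The strictly upper triangular part of a matrix. -/
def strictUpperPart (n : ℕ) : Mat n →ₗ[ℝ] Mat n where
  toFun X := fun i j ↦ if i < j then X i j else 0
  map_add' X Y := mat_ext fun i j ↦ by
    change (if i < j then (X + Y) i j else 0 : ℝ) = (if i < j then X i j else 0) + (if i < j then Y i j else 0)
    split_ifs <;> simp [add_entry]
  map_smul' c X := mat_ext fun i j ↦ by
    change (if i < j then (c • X) i j else 0 : ℝ) = c * (if i < j then X i j else 0)
    split_ifs <;> simp [smul_entry]

/-- The lower triangular part of a matrix, diagonal included. -/
def lowerPart (n : ℕ) : Mat n →ₗ[ℝ] Mat n where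
  toFun X := fun i j ↦ if i < j then 0 else X i j
  map_add' X Y := mat_ext fun i j ↦ by
    change (if i < j then 0 else (X + Y) i j : ℝ) = (if i < j then 0 else X i j) + (if i < j then 0 else Y i j)
    split_ifs <;> simp [add_entry]
  map_smul' c X := mat_ext fun i j ↦ by
    change (if i < j then 0 else (c • X) i j : ℝ) = c * (if i < j then 0 else X i j)
    split_ifs <;> simp [smul_entry]

theorem upper_mul_lower_mem_nhds_one (n : ℕ) :
    {g : Mat n | ∃ u ∈ upperUnipotent n, ∃ b ∈ lowerBorel n, g = u * b} ∈ nhds (1 : Mat n) := by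
  set U : Mat n →L[ℝ] Mat n := (strictUpperPart n).toContinuousLinearMap
  set L : Mat n →L[ℝ] Mat n := (lowerPart n).toContinuousLinearMap
  have hUL : ∀ X, U X + L X = X := by
    intro X
    refine mat_ext fun i j ↦ ?_
    change (if i < j then X i j else 0) + (if i < j then 0 else X i j) = X i j
    split_ifs <;> simp
  have hU1 : U 1 = 0 := by
    refine mat_ext fun i j ↦ ?_
    change (if i < j then (1 : Mat n) i j else 0) = (0 : ℝ)
    split_ifs with h
    · simp [one_entry, h.ne]
    · rfl
  have hL1 : L 1 = 1 := by simpa [hU1] using hUL 1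
  have hd : HasStrictFDerivAt (fun X : Mat n ↦ (1 + U X) * L X)
      ((ContinuousLinearEquiv.refl ℝ (Mat n) : Mat n ≃L[ℝ] Mat n) : Mat n →L[ℝ] Mat n) 1 := by
    have h := ((U.hasStrictFDerivAt (x := 1)).const_add (1 : Mat n)).mul'
      (L.hasStrictFDerivAt (x := 1))
    refine h.congr_fderiv ?_
    ext1 X
    change (1 + U 1) * L X + U X * L 1 = X
    rw [hU1, hL1, add_zero, one_mul, mul_one]
    exact (add_comm (L X) (U X)).trans (hUL X)
  have hmap := hd.map_nhds_eq_of_equiv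
  have h1 : (1 + U 1) * L 1 = (1 : Mat n) := by simp [hU1, hL1]
  rw [h1] at hmap
  refine hmap.ge ?_
  rw [Filter.mem_map]
  have hcont : ∀ i, ContinuousAt (fun X : Mat n ↦ X i i) 1 := fun i ↦
    (LinearMap.continuous_of_finiteDimensional
      ({ toFun := fun X ↦ X i i, map_add' := fun _ _ ↦ rfl, map_smul' := fun _ _ ↦ rfl } :
        Mat n →ₗ[ℝ] ℝ)).continuousAt
  have hev : ∀ᶠ X : Mat n in nhds 1, ∀ i, X i i ≠ 0 :=
    Filter.eventually_all.mpr fun i ↦ (hcont i).eventually_ne (by simp [one_entry])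
  filter_upwards [hev] with X hX
  refine ⟨1 + U X, ⟨fun i j h ↦ ?_, fun i ↦ ?_⟩, L X, ⟨fun i j h ↦ ?_, fun i ↦ ?_⟩, rfl⟩
  · change (1 : Mat n) i j + (if i < j then X i j else 0) = 0
    simp [one_entry, h.ne', h.not_gt]
  · change (1 : Mat n) i i + (if i < i then X i i else 0) = 1
    simp [one_entry]
  · change (if i < j then 0 else X i j) = 0
    simp [h]
  · change (if i < i then 0 else X i i) ≠ 0
    simpa using hX i

theorem isOpen_bigCellSet {n : ℕ} (w : GLn n) : IsOpen (bigCellSet w) := by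
  rw [isOpen_iff_mem_nhds]
  rintro g ⟨u, hu, b, hb, rfl⟩
  obtain ⟨u', rfl⟩ := isUnit_of_upperUnipotent hu
  obtain ⟨b', rfl⟩ := isUnit_of_lowerBorel hb
  have hc : Continuous fun h : Mat n ↦
      ((u'⁻¹ : (Mat n)ˣ) : Mat n) * ((w⁻¹ : (Mat n)ˣ) : Mat n) * h * ((b'⁻¹ : (Mat n)ˣ) : Mat n) := by
    fun_prop
  have h1 := hc.continuousAt (x := (w : Mat n) * u' * b')
  have hval : ((u'⁻¹ : (Mat n)ˣ) : Mat n) * ((w⁻¹ : (Mat n)ˣ) : Mat n) * ((w : Mat n) * u' * b') *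
      ((b'⁻¹ : (Mat n)ˣ) : Mat n) = 1 := by
    simp [mul_assoc]
  rw [ContinuousAt, hval] at h1
  filter_upwards [h1 (upper_mul_lower_mem_nhds_one n)] with h hh
  obtain ⟨v, hv, c, hc, e⟩ := hh
  refine ⟨u' * v, upperUnipotent_mul hu hv, c * b', lowerBorel_mul hc hb, ?_⟩
  calc h = (w : Mat n) * u' * (((u'⁻¹ : (Mat n)ˣ) : Mat n) * ((w⁻¹ : (Mat n)ˣ) : Mat n) * h *
        ((b'⁻¹ : (Mat n)ˣ) : Mat n)) * b' := by simp [mul_assoc]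
    _ = (w : Mat n) * u' * (v * c) * b' := congrArg (fun m : Mat n ↦ (w : Mat n) * u' * m * b') e
    _ = _ := by simp only [mul_assoc]

/-- The preimage `w N B₋` in `GL(n, ℝ)` of the open subset `U_w = w N · o` of `X`. -/
def bigCell {n : ℕ} (w : GLn n) : TopologicalSpace.Opens (Mat n) :=
  ⟨bigCellSet w, isOpen_bigCellSet w⟩

/-! ### Operations on test functions and distributions -/

section TestFunctionOperations

variable {E F F' : Type*} [NormedAddCommGroup E] [NormedSpace ℝ E] [NormedAddCommGroup F]
  [NormedSpace ℝ F] [NormedAddCommGroup F'] [NormedSpace ℝ F'] {Ω : TopologicalSpace.Opens E}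

theorem contDiff_clmApply {A : E → F →L[ℝ] F'} (hA : ContDiffOn ℝ ∞ A Ω) {f : E → F}
    (hf : ContDiff ℝ ∞ f) (hs : tsupport f ⊆ Ω) : ContDiff ℝ ∞ fun x ↦ A x (f x) := by
  refine contDiff_iff_contDiffAt.mpr fun x ↦ ?_
  by_cases hx : x ∈ tsupport (fun x ↦ A x (f x))
  · have hsub : tsupport (fun x ↦ A x (f x)) ⊆ tsupport f :=
      closure_mono fun y hy h0 ↦ hy (by simp [h0])
    exact ((hA.contDiffAt (Ω.isOpen.mem_nhds (hs (hsub hx)))).clm_apply hf.contDiffAt)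
  · exact contDiffAt_const.congr_of_eventuallyEq (notMem_tsupport_iff_eventuallyEq.mp hx)

/-- For a smooth operator-valued function `A` on `Ω`, the map `φ ↦ (x ↦ A x (φ x))` on test
functions supported in a fixed compact subset of `Ω`. -/
def clmApplySupportedIn (A : E → F →L[ℝ] F') (hA : ContDiffOn ℝ ∞ A Ω)
    (K : TopologicalSpace.Compacts E) (hK : (K : Set E) ⊆ Ω) :
    ContDiffMapSupportedIn E F ⊤ K →L[ℝ] ContDiffMapSupportedIn E F' ⊤ K :=
  ContDiffMapSupportedIn.mkCLM ℝ (fun f x ↦ A x (f x))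
    (fun f g x ↦ by simp) (fun c f x ↦ by simp)
    (fun f ↦ contDiff_clmApply hA f.contDiff (f.tsupport_subset.trans hK))
    (fun f x hx ↦ by simp [f.zero_on_compl hx])
    (fun i _ ↦ by
      have hbd : ∀ j : ℕ, ∃ M : ℝ, ∀ x ∈ K, ‖iteratedFDerivWithin ℝ j A Ω x‖ ≤ M := fun j ↦
        K.isCompact.exists_bound_of_continuousOn
          ((hA.continuousOn_iteratedFDerivWithin (m := j) (mod_cast le_top)
            Ω.isOpen.uniqueDiffOn).mono hK)
      choose M hM using hbd
      refine ⟨Finset.range (i + 1), ∑ j ∈ Finset.range (i + 1), (i.choose j : ℝ) * |M j|,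
        by positivity, fun f x hx ↦ ?_⟩
      have hxΩ := hK hx
      rw [← iteratedFDerivWithin_of_isOpen i Ω.isOpen hxΩ]
      refine (norm_iteratedFDerivWithin_clm_apply (N := ∞) hA f.contDiff.contDiffOn
        Ω.isOpen.uniqueDiffOn hxΩ (mod_cast le_top)).trans ?_
      rw [Finset.sum_mul]
      refine Finset.sum_le_sum fun j hj ↦ ?_
      refine mul_le_mul (mul_le_mul_of_nonneg_left ((hM j x hx).trans (le_abs_self _))
        (by positivity)) ?_ (norm_nonneg _) (by positivity)
      rw [iteratedFDerivWithin_of_isOpen _ Ω.isOpen hxΩ]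
      refine (ContDiffMapSupportedIn.norm_iteratedFDeriv_apply_le_seminorm_top ℝ).trans ?_
      exact Seminorm.le_def.mp (Finset.le_sup (f := fun j ↦ ContDiffMapSupportedIn.seminorm ℝ E F ⊤ K j)
        (Finset.mem_range.mpr (by omega))) f)

/-- For a smooth operator-valued function `A` on `Ω`, the continuous linear map
`φ ↦ (x ↦ A x (φ x))` on test functions on `Ω`. -/
def clmApplyTest (A : E → F →L[ℝ] F') (hA : ContDiffOn ℝ ∞ A Ω) : 𝓓(Ω, F) →L[ℝ] 𝓓(Ω, F') :=
  TestFunction.limitCLM ℝ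
    (fun f ↦ ⟨fun x ↦ A x (f x), contDiff_clmApply hA f.contDiff f.tsupport_subset,
      f.hasCompactSupport.mono fun y hy (h0 : f y = 0) ↦ hy (by simp [h0]),
      (closure_mono (show Function.support (fun x ↦ A x (f x)) ⊆ Function.support f from
        fun y hy h0 ↦ hy (by simp [h0]))).trans f.tsupport_subset⟩)
    (fun K hK ↦ TestFunction.ofSupportedInCLM ℝ hK ∘L clmApplySupportedIn A hA K hK)
    (fun _ _ _ ↦ rfl)

@[simp]
theorem clmApplyTest_apply (A : E → F →L[ℝ] F') (hA : ContDiffOn ℝ ∞ A Ω) (φ : 𝓓(Ω, F)) (x : E) :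
    clmApplyTest A hA φ x = A x (φ x) := rfl

theorem contDiff_evalField {v : E → E} (hv : ContDiff ℝ ∞ v) : ContDiff ℝ ∞ fun x : E ↦
    (ContinuousLinearMap.apply ℝ ℝ (v x) : (E →L[ℝ] ℝ) →L[ℝ] ℝ) := by
  fun_prop

/-- The action `φ ↦ (x ↦ (Dφ)(x)(v x))` of a smooth vector field `v` on test functions. -/
def vectorFieldTest (v : E → E) (hv : ContDiff ℝ ∞ v) : 𝓓(Ω, ℝ) →L[ℝ] 𝓓(Ω, ℝ) :=
  clmApplyTest (fun x ↦ ContinuousLinearMap.apply ℝ ℝ (v x)) (contDiff_evalField hv).contDiffOn ∘L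
    TestFunction.fderivCLM ℝ ⊤ ⊤

@[simp]
theorem vectorFieldTest_apply (v : E → E) (hv : ContDiff ℝ ∞ v) (φ : 𝓓(Ω, ℝ)) (x : E) :
    vectorFieldTest v hv φ x = fderiv ℝ φ x (v x) := by
  simp [vectorFieldTest]

end TestFunctionOperations

variable {n : ℕ}

/-! ### Smooth functions and distributions on `U_w`, infinitesimal left translation -/

/-- A smooth real-valued function on `U_w`, as a smooth function on `w N B₋` which is invariant
under right translation by `B₋`. (Values outside `w N B₋` are irrelevant.) -/
structure SmoothFunction (w : GLn n) where
  /-- The underlying function. -/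
  toFun : Mat n → ℝ
  smooth : ContDiffOn ℝ ∞ toFun (bigCell w)
  invariant : ∀ g ∈ bigCell w, ∀ b ∈ lowerBorel n, toFun (g * b) = toFun g

/-- Infinitesimal left translation on test functions:
`(ℓ(Z) φ)(g) = d/dt φ(exp(-tZ) g) |_{t=0} = -(Dφ)(g)(Z g)`. -/
def leftTest (w : GLn n) (Z : Mat n) : 𝓓(bigCell w, ℝ) →L[ℝ] 𝓓(bigCell w, ℝ) :=
  vectorFieldTest (fun g ↦ -(Z * g)) (contDiff_const.mul contDiff_id).neg

theorem leftTest_apply (w : GLn n) (Z : Mat n) (φ : 𝓓(bigCell w, ℝ)) (g : Mat n) :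
    leftTest w Z φ g = deriv (fun t : ℝ ↦ φ (NormedSpace.exp (-(t • Z)) * g)) 0 := by
  have h1 : leftTest w Z φ g = fderiv ℝ φ g (-(Z * g)) := by
    simp [leftTest]
  have h2 : HasDerivAt (fun t : ℝ ↦ NormedSpace.exp (-(t • Z)) * g) (-(Z * g)) 0 := by
    have h := (hasDerivAt_exp_smul_const (𝕂 := ℝ) (-Z) (0 : ℝ)).mul_const g
    simpa using h
  have h3 : HasFDerivAt φ (fderiv ℝ φ g) (NormedSpace.exp (-((0 : ℝ) • Z)) * g) := by
    simpa using (φ.contDiff.differentiable (by simp) g).hasFDerivAt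
  rw [h1]
  exact (h3.comp_hasDerivAt 0 h2).deriv.symm

/-- Infinitesimal left translation `ℓ(Z)` on distributions. Distributions on the open subset
`w N B₋` of `GL(n, ℝ)` transform like functions: a function `F` is identified with the functional
`φ ↦ ∫ F φ dg`, where `dg` is the (bi-invariant) Haar measure of `GL(n, ℝ)`. For this pairing the
transpose of `ℓ(Z)` is `-ℓ(Z)`, and the transpose of a multiplication operator is that same
operator. -/
def ell (w : GLn n) (Z : Mat n) : 𝓓'(bigCell w, ℂ) →L[ℝ] 𝓓'(bigCell w, ℂ) :=
  -(leftTest w Z).precompCompactConvergenceCLM ℂ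

theorem ell_apply (w : GLn n) (Z : Mat n) (σ : 𝓓'(bigCell w, ℂ)) (φ : 𝓓(bigCell w, ℝ)) :
    ell w Z σ φ = -σ (leftTest w Z φ) := rfl

/-- Multiplication of distributions by a smooth function on `U_w`. -/
def mulDist {w : GLn n} (a : SmoothFunction w) :
    𝓓'(bigCell w, ℂ) →L[ℝ] 𝓓'(bigCell w, ℂ) :=
  (clmApplyTest (fun g ↦ a.toFun g • ContinuousLinearMap.id ℝ ℝ)
    (a.smooth.smul contDiffOn_const)).precompCompactConvergenceCLM ℂ

/-! ### Distribution sections of the line bundle `L_{λ,δ}` over `U_w` -/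

/-- The character `b ↦ ∏ⱼ |bⱼⱼ|^(λⱼ + j - (n+1)/2) sgn(bⱼⱼ)^δⱼ` (`1 ≤ j ≤ n`) of `B₋` by which
`B₋` acts on the fibre of `L_{λ,δ}` at `o`. -/
def fibreChar (lam : Fin n → ℂ) (δ : Fin n → ZMod 2) (b : Mat n) : ℂ :=
  ∏ j : Fin n, ((|b j j| : ℝ) : ℂ) ^ (lam j + ((j : ℕ) + 1 : ℂ) - ((n : ℂ) + 1) / 2) *
    (Real.sign (b j j) : ℂ) ^ (δ j).val

/-- `σ ∈ C^{-∞}(U_w, L_{λ,δ})`: a distribution `σ` on `w N B₋` with `σ(g b) = χ(b)⁻¹ σ(g)` for all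
`b ∈ B₋`, where `χ` is the character of `B₋` which defines `L_{λ,δ}`. If `σ` is a function `F`,
`∫ F(g) φ(g b⁻¹) dg = ∫ F(g b) φ(g) dg`. -/
def IsSection (lam : Fin n → ℂ) (δ : Fin n → ZMod 2) (w : GLn n)
    (σ : 𝓓'(bigCell w, ℂ)) : Prop :=
  ∀ b ∈ lowerBorel n, ∀ φ ψ : 𝓓(bigCell w, ℝ), (∀ g, ψ (g * b) = φ g) →
    σ ψ = (fibreChar lam δ b)⁻¹ * σ φ

/-! ### Normal degree -/

/-- Distribution sections of `L_{λ,δ}` over `U_w` of normal degree zero: those which come from the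
submanifold `C_w`, i.e. whose value on a test function depends only on the restriction of that test
function to `C_w`. (Test functions stand for smooth measures on `U_w` with values in the dual line
bundle; distributions on `C_w` with values in `L_{λ,δ}` twisted by the top exterior power of the
normal bundle are the continuous functionals on the restrictions of these to `C_w`.) -/
def normalDegreeZero (lam : Fin n → ℂ) (δ : Fin n → ZMod 2) (w : GLn n) :
    Submodule ℝ 𝓓'(bigCell w, ℂ) where
  carrier := {σ | IsSection lam δ w σ ∧
    ∀ φ ψ : 𝓓(bigCell w, ℝ), (∀ g ∈ schubertCell w, φ g = ψ g) → σ φ = σ ψ}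
  add_mem' {σ τ} hσ hτ := by
    refine ⟨fun b hb φ ψ h ↦ ?_, fun φ ψ h ↦ ?_⟩
    · change σ ψ + τ ψ = _ * (σ φ + τ φ)
      rw [hσ.1 b hb φ ψ h, hτ.1 b hb φ ψ h, mul_add]
    · change σ φ + τ φ = σ ψ + τ ψ
      rw [hσ.2 φ ψ h, hτ.2 φ ψ h]
  zero_mem' := ⟨fun b hb φ ψ h ↦ (mul_zero _).symm, fun φ ψ h ↦ rfl⟩
  smul_mem' c σ hσ := by
    refine ⟨fun b hb φ ψ h ↦ ?_, fun φ ψ h ↦ ?_⟩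
    · change c • σ ψ = _ * (c • σ φ)
      rw [hσ.1 b hb φ ψ h, mul_smul_comm]
    · change c • σ φ = c • σ ψ
      rw [hσ.2 φ ψ h]

/-- The sums of expressions `ℓ(Y₁) ⋯ ℓ(Yₖ) σ₀` with at most `d` normal derivatives `ℓ(Yᵢ)`,
`Yᵢ ∈ 𝔫₋ ∩ w 𝔫 w⁻¹`, and `σ₀` of normal degree zero. (Since `𝔫₋ ∩ w 𝔫 w⁻¹` is a Lie algebra, the
products may be taken to be ordered products of elements of a fixed basis.) -/
def normalFiltration (lam : Fin n → ℂ) (δ : Fin n → ZMod 2) (w : GLn n) :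
    ℕ → Submodule ℝ 𝓓'(bigCell w, ℂ)
  | 0 => normalDegreeZero lam δ w
  | d + 1 => normalFiltration lam δ w d ⊔
      ⨆ Y ∈ nMinus n ⊓ conjLie w (nPlus n),
        (normalFiltration lam δ w d).map (ell w Y : 𝓓'(bigCell w, ℂ) →ₗ[ℝ] 𝓓'(bigCell w, ℂ))

/-- Near the point `g`, the distribution section `σ` can be expressed with at most `d` normal
derivatives, applied to distribution sections of normal degree zero. (Multiplying by a cutoff
function on `U_w` which equals `1` near `g`, one sees that it makes no difference whether the
sections of normal degree zero are given only near `g` or on all of `U_w`.) -/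
def HasNormalDegreeLE (lam : Fin n → ℂ) (δ : Fin n → ZMod 2) (w : GLn n)
    (σ : 𝓓'(bigCell w, ℂ)) (g : Mat n) (d : ℕ) : Prop :=
  ∃ V : Set (Mat n), IsOpen V ∧ g ∈ V ∧ ∃ τ ∈ normalFiltration lam δ w d,
    ∀ φ : 𝓓(bigCell w, ℝ), tsupport φ ⊆ V → σ φ = τ φ

open scoped Classical in
/-- The normal degree of `σ` at (i.e. near) the point `g`: the least number of normal derivatives
required in an expression for `σ` near `g`, `⊥` if `σ` vanishes near `g`, and `⊤` if there is no
such expression. -/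
def normalDegree (lam : Fin n → ℂ) (δ : Fin n → ZMod 2) (w : GLn n)
    (σ : 𝓓'(bigCell w, ℂ)) (g : Mat n) : WithBot ℕ∞ :=
  if g ∈ Distribution.dsupport σ then
    ((⨅ (d : ℕ) (_ : HasNormalDegreeLE lam δ w σ g d), (d : ℕ∞) : ℕ∞) : WithBot ℕ∞)
  else ⊥

/-! ### The vector fields `m(Z)` -/

/-- The identity `m(Z) = ∑ⱼ aⱼ ℓ(Zⱼ)` of vector fields on `U_w`, where
`(m(Z) f)(n₁ n₂ w o) = d/dt f(n₁ exp(-tZ) n₂ w o) |_{t=0}` for all smooth functions `f` on `U_w`,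
`n₁ ∈ w N w⁻¹ ∩ N` and `n₂ ∈ w N w⁻¹ ∩ N₋`. -/
def IsExpansion (w : GLn n) (Z : Mat n) {k : ℕ} (Zs : Fin k → Mat n)
    (a : Fin k → SmoothFunction w) : Prop :=
  ∀ f : SmoothFunction w,
    ∀ n₁ ∈ conjSet w (upperUnipotent n) ∩ upperUnipotent n,
    ∀ n₂ ∈ conjSet w (upperUnipotent n) ∩ lowerUnipotent n,
      deriv (fun t : ℝ ↦ f.toFun (n₁ * NormedSpace.exp (-(t • Z)) * n₂ * (w : Mat n))) 0 =
        ∑ j, (a j).toFun (n₁ * n₂ * (w : Mat n)) *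
          deriv (fun t : ℝ ↦ f.toFun (NormedSpace.exp (-(t • Zs j)) * (n₁ * n₂ * (w : Mat n)))) 0

/-- `τ = m(Z) σ`: the distribution `τ` equals `∑ⱼ aⱼ ℓ(Zⱼ) σ`, where `m(Z) = ∑ⱼ aⱼ ℓ(Zⱼ)` with
`Zⱼ` running over a basis of `w 𝔫 w⁻¹` and `aⱼ` smooth functions on `U_w`. (Such an expression
exists, and `∑ⱼ aⱼ ℓ(Zⱼ) σ` does not depend on the choice of the basis.) -/
def IsMAction (w : GLn n) (Z : Mat n) (σ τ : 𝓓'(bigCell w, ℂ)) : Prop :=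
  ∃ (k : ℕ) (B : Module.Basis (Fin k) ℝ (conjLie w (nPlus n))) (a : Fin k → SmoothFunction w),
    IsExpansion w Z (fun j ↦ (B j : Mat n)) a ∧
      τ = ∑ j, mulDist (a j) (ell w (B j : Mat n) σ)

end

end FlagDistribution

open FlagDistribution

/-!
Write `N' = w N w⁻¹`. The open set `U_w` is identified with the group `N'` by `nu : w N B₋ → N'`,
and the Schubert cell `C_w` is cut out in it by the vanishing of the entries of `nu` below the
diagonal (`MonomialData.mem_schubertCell_iff`; an element of the normalizer of the diagonal subgroup
is a monomial matrix, so that `N'` consists of the unipotent matrices attached to a permutation).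

The normal degree is turned into a condition on test functions. Let `K_d` (`vanishingOrder w d`) be
the test functions which vanish to order `d` along `C_w`, in the sense that their normal derivatives
`ℓ(Y₁) ⋯ ℓ(Yₖ)` with `k < d` vanish on `C_w`. Then a distribution section lies in
`normalFiltration d` if and only if it vanishes on `K_{d+1}`. One direction is immediate
(`normalFiltration_le_distAnnihilator`). For the other one, a section which vanishes on `K_{d+1}` is
killed by `I ^ (d + 1)`, where `I` is the ideal of `C_w`, and there is an Euler field: a combination
`∑ z_{pq} ℓ(E_{pq})` of normal vector fields, with coefficients in `I`, which acts on `I / I²` as the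
identity (`MonomialData.exists_euler_coefficients`). It lowers the power of `I` which is needed, until
Hadamard's lemma (`MonomialData.exists_eq_sum_mulTest`) shows that a section killed by `I` has normal
degree zero. See `MonomialData.mem_normalFiltration_of_pow_smul`.

The normal degree of a section with support in `C_w` is locally finite, because a distribution is of
finite order on a compact set, and a high power of a function which vanishes on the support kills it
there (`exists_pow_mulTest_eq_zero`, `MonomialData.exists_hasNormalDegreeLE`).

It remains to see that `m(Z)` maps `K_d` to `K_{d+1}`. If `m(Z) = ∑ⱼ aⱼ ℓ(Zⱼ)`, the matrix
`A = ∑ⱼ aⱼ Zⱼ` has at `n₁ n₂ w o` the value `Ad(n₁ n₂) P(n₂⁻¹ Z n₂)`, where `P` is the projection to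
`w 𝔫 w⁻¹` along `w 𝔟₋ w⁻¹` (`MonomialData.expansionMatrix_mul`). As `Z ∈ w 𝔫₋ w⁻¹`, it vanishes on
`C_w`, and its derivative there in the direction of `Ad(n₁) Y` is `Ad(n₁) P([Z, Y])`. Hypothesis (i)
says that this is upper triangular, so the entries of `A` below the diagonal vanish to second order
along `C_w`. These are the coefficients of the normal vector fields in `m(Z)`; the coefficients of
the tangential ones vanish to first order, and both kinds of terms raise the order of vanishing by
one (`MonomialData.expansionTest_mem_vanishingOrder`). Finally `ℓ(Z) σ = m(Z) σ` by hypothesis (ii).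
-/

namespace FlagDistribution

/-! ### Test functions and distributions on open sets -/

section

open TopologicalSpace Set Filter Topology

variable {E : Type*} [NormedAddCommGroup E] [NormedSpace ℝ E] {Ω : Opens E}

theorem iteratedFDeriv_bounded_of_hasCompactSupport {f : E → ℝ} (hf : ContDiff ℝ ∞ f)
    (hs : HasCompactSupport f) (N : ℕ) :
    ∃ M : ℝ, 1 ≤ M ∧ ∀ j ≤ N, ∀ x, ‖iteratedFDeriv ℝ j f x‖ ≤ M := by
  have h : ∀ j : ℕ, ∃ C, ∀ x, ‖iteratedFDeriv ℝ j f x‖ ≤ C := fun j ↦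
    (hf.continuous_iteratedFDeriv (mod_cast le_top)).bounded_above_of_compact_support
      (hs.iteratedFDeriv j)
  choose C hC using h
  refine ⟨1 + ∑ j ∈ Finset.range (N + 1), |C j|,
    le_add_of_nonneg_right (Finset.sum_nonneg fun _ _ ↦ abs_nonneg _), fun j hj x ↦ ?_⟩
  have h1 : |C j| ≤ ∑ j ∈ Finset.range (N + 1), |C j| :=
    Finset.single_le_sum (f := fun j ↦ |C j|) (fun _ _ ↦ abs_nonneg _)
      (Finset.mem_range.mpr (by omega))
  linarith [hC j x, le_abs_self (C j)]

/-- The derivatives of order at most `N` of `κ (f / ε) ψ` grow at most like `ε⁻ᴺ`. -/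
theorem iteratedFDeriv_comp_div_mul_le {κ : ℝ → ℝ} (hκ : ContDiff ℝ ∞ κ)
    (hκs : HasCompactSupport κ) {f ψ : E → ℝ} (hf : ContDiff ℝ ∞ f) (hfs : HasCompactSupport f)
    (hψ : ContDiff ℝ ∞ ψ) (hψs : HasCompactSupport ψ) (N : ℕ) :
    ∃ C : ℝ, 0 ≤ C ∧ ∀ ε : ℝ, 0 < ε → ε ≤ 1 → ∀ j ≤ N, ∀ x,
      ‖iteratedFDeriv ℝ j (fun x ↦ κ (ε⁻¹ * f x) * ψ x) x‖ ≤ C * ε⁻¹ ^ N := by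
  obtain ⟨A, hA1, hA⟩ := iteratedFDeriv_bounded_of_hasCompactSupport hκ hκs N
  obtain ⟨B, hB1, hB⟩ := iteratedFDeriv_bounded_of_hasCompactSupport hf hfs N
  obtain ⟨D, hD1, hD⟩ := iteratedFDeriv_bounded_of_hasCompactSupport hψ hψs N
  refine ⟨∑ j ∈ Finset.range (N + 1), ∑ i ∈ Finset.range (j + 1),
    (j.choose i : ℝ) * (i.factorial * A * B ^ N) * D, by positivity, fun ε hε hε1 j hj x ↦ ?_⟩
  have hε' : 1 ≤ ε⁻¹ := (one_le_inv₀ hε).mpr hε1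
  have hg : ContDiff ℝ ∞ fun x ↦ ε⁻¹ * f x := contDiff_const.mul hf
  have hcomp : ∀ i ≤ N, ‖iteratedFDeriv ℝ i (fun x ↦ κ (ε⁻¹ * f x)) x‖ ≤
      i.factorial * A * B ^ N * ε⁻¹ ^ N := by
    intro i hi
    have h := norm_iteratedFDeriv_comp_le (g := κ) (f := fun x ↦ ε⁻¹ * f x) (n := i) (C := A)
      (D := ε⁻¹ * B) hκ hg (mod_cast le_top) x (fun k hk ↦ hA k (hk.trans hi) _) ?_
    · refine h.trans ?_
      rw [mul_pow, mul_assoc (_ * A)]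
      refine mul_le_mul_of_nonneg_left ?_ (by positivity)
      rw [mul_comm (B ^ N)]
      gcongr
    · intro k hk hki
      have h1 : iteratedFDeriv ℝ k (fun x ↦ ε⁻¹ * f x) x = ε⁻¹ • iteratedFDeriv ℝ k f x :=
        iteratedFDeriv_const_smul_apply (a := ε⁻¹) (f := f)
          (hf.of_le (mod_cast le_top)).contDiffAt
      rw [h1, norm_smul, Real.norm_of_nonneg (by positivity)]
      calc ε⁻¹ * ‖iteratedFDeriv ℝ k f x‖ ≤ ε⁻¹ * B := by gcongr; exact hB k (hki.trans hi) x
        _ ≤ (ε⁻¹ * B) ^ k := le_self_pow₀ (one_le_mul_of_one_le_of_one_le hε' hB1) (by omega)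
  have h1 : ∑ i ∈ Finset.range (j + 1), (j.choose i : ℝ) * (i.factorial * A * B ^ N) * D ≤
      ∑ j ∈ Finset.range (N + 1), ∑ i ∈ Finset.range (j + 1),
        (j.choose i : ℝ) * (i.factorial * A * B ^ N) * D :=
    Finset.single_le_sum
      (f := fun j ↦ ∑ i ∈ Finset.range (j + 1), (j.choose i : ℝ) * (i.factorial * A * B ^ N) * D)
      (fun _ _ ↦ by positivity) (Finset.mem_range.mpr (by omega))
  calc _ ≤ ∑ i ∈ Finset.range (j + 1), (j.choose i : ℝ) *
        ‖iteratedFDeriv ℝ i (fun x ↦ κ (ε⁻¹ * f x)) x‖ * ‖iteratedFDeriv ℝ (j - i) ψ x‖ :=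
        norm_iteratedFDeriv_mul_le (hκ.comp hg) hψ x (mod_cast le_top)
    _ ≤ ∑ i ∈ Finset.range (j + 1),
        (j.choose i : ℝ) * (i.factorial * A * B ^ N * ε⁻¹ ^ N) * D := by
        refine Finset.sum_le_sum fun i hi ↦ ?_
        have hi' : i ≤ N := by have := Finset.mem_range.mp hi; omega
        gcongr
        · exact hcomp i hi'
        · exact hD _ (by omega) x
    _ = (∑ i ∈ Finset.range (j + 1), (j.choose i : ℝ) * (i.factorial * A * B ^ N) * D) *
        ε⁻¹ ^ N := by
        rw [Finset.sum_mul]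
        exact Finset.sum_congr rfl fun i _ ↦ by ring
    _ ≤ _ := by gcongr

/-- Multiplication of test functions by a function which is smooth on `Ω`. -/
noncomputable def mulTest {a : E → ℝ} (ha : ContDiffOn ℝ ∞ a Ω) : 𝓓(Ω, ℝ) →L[ℝ] 𝓓(Ω, ℝ) :=
  clmApplyTest (fun g ↦ a g • ContinuousLinearMap.id ℝ ℝ) (ha.smul contDiffOn_const)

@[simp]
theorem mulTest_apply {a : E → ℝ} (ha : ContDiffOn ℝ ∞ a Ω) (φ : 𝓓(Ω, ℝ)) (x : E) :
    mulTest ha φ x = a x * φ x := rfl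

theorem tsupport_mulTest_subset {a : E → ℝ} (ha : ContDiffOn ℝ ∞ a Ω) (φ : 𝓓(Ω, ℝ)) :
    tsupport (mulTest ha φ) ⊆ tsupport φ :=
  closure_mono fun x hx h0 ↦ hx (by simp [h0])

theorem tsupport_mulTest_subset_left {a : E → ℝ} (ha : ContDiffOn ℝ ∞ a Ω) (φ : 𝓓(Ω, ℝ)) :
    tsupport (mulTest ha φ) ⊆ tsupport a :=
  closure_mono fun x hx h0 ↦ hx (by simp [h0])

/-- On a compact set, a distribution has finite order. -/
theorem distribution_finite_order (σ : 𝓓'(Ω, ℂ)) {K : Set E} (hK : IsCompact K) (hKΩ : K ⊆ Ω) :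
    ∃ (N : ℕ) (C : ℝ), 0 ≤ C ∧ ∀ φ : 𝓓(Ω, ℝ), tsupport φ ⊆ K → ∀ M : ℝ, 0 ≤ M →
      (∀ j ≤ N, ∀ x, ‖iteratedFDeriv ℝ j φ x‖ ≤ M) → ‖σ φ‖ ≤ C * M := by
  let K' : Compacts E := ⟨K, hK⟩
  let T : ContDiffMapSupportedIn E ℝ ⊤ K' →L[ℝ] ℂ := σ.comp (TestFunction.ofSupportedInCLM ℝ hKΩ)
  obtain ⟨s, C, hC, hb⟩ := Seminorm.bound_of_continuous
    (ContDiffMapSupportedIn.withSeminorms ℝ E ℝ ⊤ K')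
    ((normSeminorm ℝ ℂ).comp (T : ContDiffMapSupportedIn E ℝ ⊤ K' →ₗ[ℝ] ℂ))
    (continuous_norm.comp T.continuous)
  refine ⟨s.sup id, C, C.2, fun φ hφ M hM hbd ↦ ?_⟩
  let f : ContDiffMapSupportedIn E ℝ ⊤ K' :=
    ContDiffMapSupportedIn.of_support_subset φ.contDiff ((subset_tsupport _).trans hφ)
  have hf : TestFunction.ofSupportedInCLM ℝ hKΩ f = φ := by ext x; rfl
  have h1 : ‖σ φ‖ ≤ C * (s.sup (ContDiffMapSupportedIn.seminorm ℝ E ℝ ⊤ K')) f := by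
    have := Seminorm.le_def.mp hb f
    rw [← hf]
    exact this
  refine h1.trans (mul_le_mul_of_nonneg_left ?_ C.2)
  refine Seminorm.finset_sup_apply_le hM fun i hi ↦ ?_
  rw [ContDiffMapSupportedIn.seminorm_top_le_iff ℝ hM]
  exact fun x _ ↦ hbd i (Finset.le_sup (f := id) hi) x

/-- Integration over `[0, 1]` of a function depending smoothly on a parameter in `Ω`. The integral
is the value at `0` of a convolution with the indicator function of `(0, 1]`, once the function has
been cut off outside a neighbourhood of `[0, 1]`. -/
theorem contDiffOn_integral_zero_one {h : E → ℝ → ℝ}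
    (hh : ContDiffOn ℝ ∞ (fun p : E × ℝ ↦ h p.1 p.2) ((Ω : Set E) ×ˢ univ)) :
    ContDiffOn ℝ ∞ (fun x ↦ ∫ s in (0 : ℝ)..1, h x s) Ω := by
  let β : ContDiffBump (0 : ℝ) := ⟨2, 3, two_pos, by norm_num⟩
  have hβ : ContDiff ℝ ∞ β := β.contDiff
  let g : E → ℝ → ℝ := fun x t ↦ β t * h x (-t)
  have hg : ContDiffOn ℝ ∞ (Function.HasUncurry.uncurry g) ((Ω : Set E) ×ˢ univ) := by
    have h1 : ContDiffOn ℝ ∞ (fun p : E × ℝ ↦ h p.1 (-p.2)) ((Ω : Set E) ×ˢ univ) :=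
      hh.comp (f := fun p : E × ℝ ↦ (p.1, -p.2)) (contDiff_fst.prodMk contDiff_snd.neg).contDiffOn
        fun p hp ↦ ⟨hp.1, mem_univ _⟩
    exact (hβ.comp contDiff_snd).contDiffOn.mul h1
  have hf : MeasureTheory.LocallyIntegrable ((Ioc (0 : ℝ) 1).indicator fun _ ↦ (1 : ℝ)) := by
    refine MeasureTheory.Integrable.locallyIntegrable ?_
    rw [MeasureTheory.integrable_indicator_iff measurableSet_Ioc]
    exact MeasureTheory.integrableOn_const (by simp)
  have hconv := MeasureTheory.contDiffOn_convolution_right_with_param (n := ⊤)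
    (ContinuousLinearMap.mul ℝ ℝ) Ω.isOpen
    (isCompact_closedBall (0 : ℝ) 3) (g := g) (fun p x _ hx ↦ ?_) hf hg
  · have h2 : ContDiffOn ℝ ∞ (fun x : E ↦ MeasureTheory.convolution
        ((Ioc (0 : ℝ) 1).indicator fun _ ↦ (1 : ℝ)) (g x) (ContinuousLinearMap.mul ℝ ℝ)
        MeasureTheory.volume 0) Ω :=
      hconv.comp (f := fun x : E ↦ (x, (0 : ℝ))) (contDiff_id.prodMk contDiff_const).contDiffOn
        fun x hx ↦ ⟨hx, mem_univ _⟩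
    refine h2.congr fun x _ ↦ ?_
    rw [intervalIntegral.integral_of_le zero_le_one, MeasureTheory.convolution_def,
      ← MeasureTheory.integral_indicator measurableSet_Ioc]
    refine MeasureTheory.integral_congr_ae (Filter.Eventually.of_forall fun t ↦ ?_)
    by_cases ht : t ∈ Ioc (0 : ℝ) 1
    · have hβt : β (-t) = 1 := β.one_of_mem_closedBall (by
        simp only [mem_closedBall_zero_iff, norm_neg, Real.norm_eq_abs]
        exact abs_le.mpr ⟨by linarith [ht.1], by linarith [ht.2]⟩)
      simp [ht, g, hβt]
    · simp [ht]
  · have : β x = 0 := by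
      by_contra h0
      refine hx (Metric.ball_subset_closedBall ?_)
      have := β.support_eq ▸ (Function.mem_support.mpr h0)
      exact this
    simp [g, this]

variable [FiniteDimensional ℝ E]

/-- A compact subset of `Ω` has a cutoff function among the test functions. -/
theorem exists_testFunction_eq_one {K : Set E} (hK : IsCompact K) (hKΩ : K ⊆ Ω) :
    ∃ (c : 𝓓(Ω, ℝ)) (V : Set E), IsOpen V ∧ K ⊆ V ∧ ∀ x ∈ V, c x = 1 := by
  obtain ⟨L, hL, hKL, hLΩ⟩ := exists_compact_between hK Ω.isOpen hKΩ
  obtain ⟨f, hf1, hf0, -⟩ := exists_contMDiffMap_one_nhds_of_subset_interior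
    (n := ⊤) (modelWithCornersSelf ℝ E) hK.isClosed hKL
  obtain ⟨V, hVo, hKV, hV⟩ := eventually_nhdsSet_iff_exists.mp hf1
  have hsub : tsupport f ⊆ L :=
    closure_minimal (fun x hx ↦ by_contra fun h ↦ hx (hf0 x h)) hL.isClosed
  exact ⟨⟨f, f.contMDiff.contDiff, hL.of_isClosed_subset (isClosed_tsupport _) hsub,
    hsub.trans hLΩ⟩, V, hVo, hKV, hV⟩

/-- A distribution which vanishes near every point of the support of a test function vanishes on
that test function. -/
theorem distribution_apply_eq_zero_of_locally {V : Type*} [AddCommGroup V] [Module ℝ V]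
    [TopologicalSpace V] (σ : 𝓓'(Ω, V)) (φ : 𝓓(Ω, ℝ))
    (h : ∀ x ∈ tsupport φ, ∃ U : Set E, IsOpen U ∧ x ∈ U ∧ Distribution.IsVanishingOn σ U) :
    σ φ = 0 := by
  choose! U hUo hxU hU using h
  obtain ⟨t, ht, hcov⟩ := φ.hasCompactSupport.isCompact.elim_nhds_subcover U
    fun x hx ↦ (hUo x hx).mem_nhds (hxU x hx)
  obtain ⟨ρ, hρ⟩ := SmoothPartitionOfUnity.exists_isSubordinate (modelWithCornersSelf ℝ E)
    (isClosed_tsupport φ) (fun i : t ↦ U i) (fun i ↦ hUo i (ht i i.2))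
    (fun x hx ↦ by simpa using hcov hx)
  have hs : ∀ i, ContDiffOn ℝ ∞ (ρ i) Ω := fun i ↦ (ρ i).contMDiff.contDiff.contDiffOn
  have hsum : φ = ∑ i, mulTest (hs i) φ := by
    ext x
    rw [_root_.sum_apply]
    simp only [mulTest_apply, ← Finset.sum_mul]
    by_cases hx : x ∈ tsupport φ
    · rw [← finsum_eq_sum_of_fintype, ρ.sum_eq_one hx, one_mul]
    · rw [image_eq_zero_of_notMem_tsupport hx, mul_zero]
  rw [hsum, map_sum]
  refine Finset.sum_eq_zero fun i _ ↦ hU i (ht i i.2) _ ?_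
  exact (tsupport_mulTest_subset_left (hs i) φ).trans (hρ i)

theorem distribution_apply_eq_zero_of_disjoint {V : Type*} [AddCommGroup V] [Module ℝ V]
    [TopologicalSpace V] (σ : 𝓓'(Ω, V)) (φ : 𝓓(Ω, ℝ))
    (h : ∀ x ∈ tsupport φ, x ∉ Distribution.dsupport σ) : σ φ = 0 :=
  distribution_apply_eq_zero_of_locally σ φ fun x hx ↦
    let ⟨s, hs, hso, hxs⟩ := (Distribution.notMem_dsupport_iff x).mp (h x hx)
    ⟨s, hso, hxs, hs⟩

/-- A sufficiently high power of any function vanishing on the support of a distribution kills the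
distribution on a given compact set. If `N` is the order of the distribution there, the power `N + 1`
is enough: cut off to the set where `|a| ≤ 2 ε`, the function `a ^ (N + 1)` has derivatives of order
at most `N` of size `O(ε)`. -/
theorem exists_pow_mulTest_eq_zero (σ : 𝓓'(Ω, ℂ)) {K : Set E} (hK : IsCompact K) (hKΩ : K ⊆ Ω) :
    ∃ k : ℕ, ∀ (a : E → ℝ) (ha : ContDiffOn ℝ ∞ a Ω),
      (∀ x ∈ Distribution.dsupport σ ∩ Ω, a x = 0) →
      ∀ ψ : 𝓓(Ω, ℝ), tsupport ψ ⊆ K → σ (mulTest (ha.pow k) ψ) = 0 := by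
  obtain ⟨N, C, hC, hσ⟩ := distribution_finite_order σ hK hKΩ
  refine ⟨N + 1, fun a ha ha0 ψ hψ ↦ ?_⟩
  let β : ContDiffBump (0 : ℝ) := ⟨1, 2, one_pos, one_lt_two⟩
  have hβ : ContDiff ℝ ∞ β := β.contDiff
  obtain ⟨c, V, hVo, hKV, hc⟩ := exists_testFunction_eq_one hK hKΩ
  obtain ⟨C', hC', hbd⟩ := iteratedFDeriv_comp_div_mul_le (κ := fun t ↦ t ^ (N + 1) * β t)
    ((contDiff_id.pow _).mul hβ) β.hasCompactSupport.mul_left (mulTest ha c).contDiff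
    (mulTest ha c).hasCompactSupport ψ.contDiff ψ.hasCompactSupport N
  have key : ∀ ε : ℝ, 0 < ε → ε ≤ 1 → ‖σ (mulTest (ha.pow (N + 1)) ψ)‖ ≤ C * C' * ε := by
    intro ε hε hε1
    have hβa : ContDiffOn ℝ ∞ (fun x ↦ β (ε⁻¹ * a x)) Ω :=
      hβ.comp_contDiffOn (contDiffOn_const.mul ha)
    -- the part of `a ^ (N + 1)` away from the zero set of `a`, and the part near it
    have h1 : ContDiffOn ℝ ∞ (fun x ↦ a x ^ (N + 1) * (1 - β (ε⁻¹ * a x))) Ω :=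
      (ha.pow _).mul (contDiffOn_const.sub hβa)
    have h2 : ContDiffOn ℝ ∞ (fun x ↦ a x ^ (N + 1) * β (ε⁻¹ * a x)) Ω := (ha.pow _).mul hβa
    have hsplit : mulTest (ha.pow (N + 1)) ψ = mulTest h1 ψ + mulTest h2 ψ := by
      ext x
      change _ = mulTest h1 ψ x + mulTest h2 ψ x
      simp only [mulTest_apply]
      ring
    have hz : σ (mulTest h1 ψ) = 0 := by
      refine distribution_apply_eq_zero_of_disjoint σ _ fun x hx hxs ↦ ?_
      have hxΩ := (mulTest h1 ψ).tsupport_subset hx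
      have hax := ha0 x ⟨hxs, hxΩ⟩
      have hcont : ContinuousAt (fun x ↦ ε⁻¹ * a x) x :=
        continuousAt_const.mul (ha.continuousOn.continuousAt (Ω.isOpen.mem_nhds hxΩ))
      have hev : ∀ᶠ y in 𝓝 x, ε⁻¹ * a y ∈ Metric.closedBall (0 : ℝ) 1 := by
        refine hcont.eventually_mem ?_
        rw [hax, mul_zero]
        exact Metric.closedBall_mem_nhds _ one_pos
      refine notMem_tsupport_iff_eventuallyEq.mpr ?_ hx
      filter_upwards [hev] with y hy
      simp [β.one_of_mem_closedBall hy]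
    rw [hsplit, map_add, hz, zero_add]
    have hval : ∀ x, mulTest h2 ψ x = ε ^ (N + 1) *
        ((ε⁻¹ * mulTest ha c x) ^ (N + 1) * β (ε⁻¹ * mulTest ha c x) * ψ x) := by
      intro x
      by_cases hx : x ∈ tsupport ψ
      · rw [mulTest_apply, mulTest_apply, hc x (hKV (hψ hx)), mul_one, mul_pow, inv_pow]
        field_simp
      · simp [image_eq_zero_of_notMem_tsupport hx]
    have hM := hσ (mulTest h2 ψ) ((tsupport_mulTest_subset h2 ψ).trans hψ) (C' * ε)
      (by positivity) fun j hj x ↦ ?_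
    · linarith
    have hfun : (mulTest h2 ψ : E → ℝ) = ε ^ (N + 1) • fun x ↦
        ((ε⁻¹ * mulTest ha c x) ^ (N + 1) * β (ε⁻¹ * mulTest ha c x) * ψ x) := by
      ext x
      exact hval x
    rw [hfun, iteratedFDeriv_const_smul_apply, norm_smul, Real.norm_of_nonneg (by positivity)]
    · calc _ ≤ ε ^ (N + 1) * (C' * ε⁻¹ ^ N) := by
            gcongr
            exact hbd ε hε hε1 j hj x
        _ = C' * ε := by rw [inv_pow, pow_succ]; field_simp
    · have hf : ContDiff ℝ ∞ fun x ↦ ε⁻¹ * mulTest ha c x :=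
        contDiff_const.mul (mulTest ha c).contDiff
      exact ((((hf.pow _).mul (hβ.comp hf)).mul ψ.contDiff).of_le (mod_cast le_top)).contDiffAt
  by_contra hne
  have hpos : 0 < ‖σ (mulTest (ha.pow (N + 1)) ψ)‖ := norm_pos_iff.mpr hne
  set m := ‖σ (mulTest (ha.pow (N + 1)) ψ)‖
  have hD : 0 < 2 * (C * C' + 1) := by positivity
  have h := key (min 1 (m / (2 * (C * C' + 1)))) (lt_min one_pos (div_pos hpos hD)) (min_le_left _ _)
  have h3 : C * C' * min 1 (m / (2 * (C * C' + 1))) ≤ C * C' * (m / (2 * (C * C' + 1))) := by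
    gcongr
    exact min_le_right _ _
  have h4 : C * C' * (m / (2 * (C * C' + 1))) < m := by
    rw [mul_div_assoc', div_lt_iff₀ hD]
    nlinarith [mul_nonneg hC hC']
  linarith

end

/-! ### Unipotent groups attached to permutations, and monomial matrices -/

noncomputable section

variable {n : ℕ}

theorem sub_entry (A B : Mat n) (i j : Fin n) : (A - B) i j = A i j - B i j := rfl

/-- The matrices whose entry `(i, j)` vanishes unless `r i < r j`. For the identity permutation
this is `𝔫`; if `w` permutes the coordinate axes according to `r` it is `w 𝔫 w⁻¹`. -/
def rootSpace (r : Equiv.Perm (Fin n)) : Submodule ℝ (Mat n) where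
  carrier := {Z | ∀ i j, r j ≤ r i → Z i j = 0}
  add_mem' hY hZ i j h := by rw [add_entry, hY i j h, hZ i j h, add_zero]
  zero_mem' _ _ _ := rfl
  smul_mem' c Z hZ i j h := by rw [smul_entry, hZ i j h, mul_zero]

/-- The unipotent matrices `1 + X` with `X` in `rootSpace r`. -/
def rootGroup (r : Equiv.Perm (Fin n)) : Set (Mat n) :=
  {u | (∀ i j, r j < r i → u i j = 0) ∧ ∀ i, u i i = 1}

theorem rootGroup_refl : rootGroup (Equiv.refl (Fin n)) = upperUnipotent n := rfl

theorem mem_rootGroup_iff {r : Equiv.Perm (Fin n)} {u : Mat n} :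
    u ∈ rootGroup r ↔ u - 1 ∈ rootSpace r := by
  constructor
  · intro hu i j hij
    rw [sub_entry, one_entry]
    rcases hij.lt_or_eq with h | h
    · rw [hu.1 i j h, if_neg (by rintro rfl; exact h.ne rfl), sub_zero]
    · rw [r.injective h, hu.2, if_pos rfl, sub_self]
  · intro hu
    refine ⟨fun i j hij ↦ ?_, fun i ↦ ?_⟩
    · have := hu i j hij.le
      rwa [sub_entry, one_entry, if_neg (by rintro rfl; exact hij.ne rfl), sub_zero] at this
    · have := hu i i le_rfl
      rw [sub_entry, one_entry, if_pos rfl] at this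
      linarith

theorem one_add_mem_rootGroup {r : Equiv.Perm (Fin n)} {X : Mat n} (hX : X ∈ rootSpace r) :
    1 + X ∈ rootGroup r := by
  rw [mem_rootGroup_iff]
  simpa using hX

theorem mul_mem_rootSpace {r : Equiv.Perm (Fin n)} {X Y : Mat n} (hX : X ∈ rootSpace r)
    (hY : Y ∈ rootSpace r) : X * Y ∈ rootSpace r := by
  intro i j hij
  rw [mul_entry]
  refine Finset.sum_eq_zero fun k _ ↦ ?_
  rcases le_or_gt (r k) (r i) with h | h
  · rw [hX i k h, zero_mul]
  · rw [hY k j (hij.trans h.le), mul_zero]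

theorem rootGroup_mul_mem_rootSpace {r : Equiv.Perm (Fin n)} {u X : Mat n} (hu : u ∈ rootGroup r)
    (hX : X ∈ rootSpace r) : u * X ∈ rootSpace r := by
  have h := add_mem hX (mul_mem_rootSpace (mem_rootGroup_iff.mp hu) hX)
  rwa [sub_mul, one_mul, add_sub_cancel] at h

theorem rootSpace_mul_mem_rootGroup {r : Equiv.Perm (Fin n)} {u X : Mat n} (hu : u ∈ rootGroup r)
    (hX : X ∈ rootSpace r) : X * u ∈ rootSpace r := by
  have h := add_mem hX (mul_mem_rootSpace hX (mem_rootGroup_iff.mp hu))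
  rwa [mul_sub, mul_one, add_sub_cancel] at h

theorem mul_mem_rootGroup {r : Equiv.Perm (Fin n)} {u v : Mat n} (hu : u ∈ rootGroup r)
    (hv : v ∈ rootGroup r) : u * v ∈ rootGroup r := by
  rw [mem_rootGroup_iff] at *
  have h := add_mem (add_mem hu hv) (mul_mem_rootSpace hu hv)
  have e : u * v - 1 = u - 1 + (v - 1) + (u - 1) * (v - 1) := by noncomm_ring
  rwa [e]

theorem one_mem_rootGroup (r : Equiv.Perm (Fin n)) : (1 : Mat n) ∈ rootGroup r := by
  rw [mem_rootGroup_iff, sub_self]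
  exact zero_mem _

theorem pow_succ_mem_rootSpace {r : Equiv.Perm (Fin n)} {X : Mat n} (hX : X ∈ rootSpace r)
    (m : ℕ) : X ^ (m + 1) ∈ rootSpace r := by
  induction m with
  | zero => simpa using hX
  | succ m ih => rw [pow_succ]; exact mul_mem_rootSpace ih hX

theorem pow_card_eq_zero_of_mem_rootSpace {r : Equiv.Perm (Fin n)} {X : Mat n}
    (hX : X ∈ rootSpace r) : X ^ n = 0 := by
  have h : ∀ (m : ℕ) (i j : Fin n), (r j : ℕ) < (r i : ℕ) + m → (X ^ m) i j = 0 := by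
    intro m
    induction m with
    | zero =>
      intro i j hij
      rw [pow_zero, one_entry, if_neg]
      rintro rfl
      simp at hij
    | succ m ih =>
      intro i j hij
      rw [pow_succ', mul_entry]
      refine Finset.sum_eq_zero fun k _ ↦ ?_
      rcases le_or_gt (r k) (r i) with hk | hk
      · rw [hX i k hk, zero_mul]
      · rw [ih k j (by have := Fin.lt_def.mp hk; omega), mul_zero]
  exact mat_ext fun i j ↦ h n i j (by have := (r j).isLt; omega)

theorem exists_inv_mem_rootGroup {r : Equiv.Perm (Fin n)} {u : Mat n} (hu : u ∈ rootGroup r) :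
    ∃ v ∈ rootGroup r, u * v = 1 ∧ v * u = 1 := by
  set X := 1 - u with hX
  have hXm : X ∈ rootSpace r := by
    have := neg_mem (mem_rootGroup_iff.mp hu)
    rwa [neg_sub] at this
  have hu' : u = 1 - X := by rw [hX]; abel
  refine ⟨∑ m ∈ Finset.range (n + 1), X ^ m, ?_, ?_, ?_⟩
  · rw [mem_rootGroup_iff, Finset.sum_range_succ', pow_zero, add_sub_cancel_right]
    exact sum_mem fun m _ ↦ pow_succ_mem_rootSpace hXm m
  · rw [hu', mul_neg_geom_sum, pow_succ, pow_card_eq_zero_of_mem_rootSpace hXm, zero_mul, sub_zero]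
  · rw [hu', geom_sum_mul_neg, pow_succ, pow_card_eq_zero_of_mem_rootSpace hXm, zero_mul, sub_zero]

/-- The inverse of an element of several of the groups `rootGroup r` lies in all of them. -/
theorem mem_rootGroup_of_mul_eq_one {r : Equiv.Perm (Fin n)} {u v : Mat n} (hu : u ∈ rootGroup r)
    (h : v * u = 1) : v ∈ rootGroup r := by
  obtain ⟨v', hv', h1, -⟩ := exists_inv_mem_rootGroup hu
  rwa [left_inv_eq_right_inv h h1]

/-- The entries of a matrix at the positions which occur in `rootSpace r`. -/
def rootProj (r : Equiv.Perm (Fin n)) : Mat n →ₗ[ℝ] Mat n where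
  toFun X := fun i j ↦ if r i < r j then X i j else 0
  map_add' X Y := mat_ext fun i j ↦ by
    change (if r i < r j then (X + Y) i j else 0 : ℝ) =
      (if r i < r j then X i j else 0) + (if r i < r j then Y i j else 0)
    split_ifs <;> simp [add_entry]
  map_smul' c X := mat_ext fun i j ↦ by
    change (if r i < r j then (c • X) i j else 0 : ℝ) = c * (if r i < r j then X i j else 0)
    split_ifs <;> simp [smul_entry]

theorem rootProj_entry (r : Equiv.Perm (Fin n)) (X : Mat n) (i j : Fin n) :
    rootProj r X i j = if r i < r j then X i j else 0 := rfl

theorem rootProj_mem (r : Equiv.Perm (Fin n)) (X : Mat n) : rootProj r X ∈ rootSpace r :=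
  fun i j h ↦ by rw [rootProj_entry, if_neg h.not_gt]

/-- The factorization of an upper unipotent matrix along a permutation of the coordinates. The
coefficients of the factors are found by recursion on the distance from the diagonal. -/
theorem exists_factorization_of_mem_upperUnipotent (r : Equiv.Perm (Fin n)) {u : Mat n}
    (hu : u ∈ upperUnipotent n) :
    ∃ v ∈ rootGroup r, v ∈ upperUnipotent n ∧
      ∃ v' ∈ upperUnipotent n, (∀ i j, r i < r j → v' i j = 0) ∧ u = v * v' := by
  set Y := u - 1 with hY
  have hYm : Y ∈ rootSpace (Equiv.refl (Fin n)) := mem_rootGroup_iff.mp hu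
  let P := rootProj r
  let T : Mat n → Mat n := fun X ↦ Y - P X * (X - P X)
  have hP : ∀ X ∈ rootSpace (Equiv.refl (Fin n)), P X ∈ rootSpace (Equiv.refl (Fin n)) := by
    intro X hX i j hij
    change (if r i < r j then X i j else 0 : ℝ) = 0
    rw [hX i j hij, ite_self]
  have hT : ∀ X ∈ rootSpace (Equiv.refl (Fin n)), T X ∈ rootSpace (Equiv.refl (Fin n)) :=
    fun X hX ↦ sub_mem hYm (mul_mem_rootSpace (hP X hX) (sub_mem hX (hP X hX)))
  have hmem : ∀ m : ℕ, T^[m] 0 ∈ rootSpace (Equiv.refl (Fin n)) := by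
    intro m
    induction m with
    | zero => exact zero_mem _
    | succ m ih => rw [Function.iterate_succ_apply']; exact hT _ ih
  have hagree : ∀ (m : ℕ) (i j : Fin n), (j : ℕ) < i + m + 1 →
      (T^[m + 1] 0) i j = (T^[m] 0) i j := by
    intro m
    induction m with
    | zero =>
      intro i j hij
      rw [hmem 1 i j (Fin.le_def.mpr (by simp; omega)),
        hmem 0 i j (Fin.le_def.mpr (by simp; omega))]
    | succ m ih =>
      intro i j hij
      have hAm := hmem (m + 1)
      have hBm := hmem m
      rw [Function.iterate_succ_apply' T (m + 1)]
      conv_rhs => rw [Function.iterate_succ_apply' T m]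
      generalize T^[m + 1] 0 = A at ih hAm ⊢
      generalize T^[m] 0 = B at ih hBm ⊢
      change Y i j - (P A * (A - P A)) i j = Y i j - (P B * (B - P B)) i j
      rw [mul_entry, mul_entry]
      congr 1
      refine Finset.sum_congr rfl fun k _ ↦ ?_
      rcases le_or_gt k i with hki | hki
      · rw [hP A hAm i k hki, hP B hBm i k hki, zero_mul, zero_mul]
      rcases le_or_gt j k with hjk | hjk
      · rw [sub_mem hAm (hP A hAm) k j hjk, sub_mem hBm (hP B hBm) k j hjk, mul_zero, mul_zero]
      have hki' := Fin.lt_def.mp hki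
      have hjk' := Fin.lt_def.mp hjk
      have h1 := ih i k (by omega)
      have h2 := ih k j (by omega)
      change (if r i < r k then A i k else 0) * (A k j - (if r k < r j then A k j else 0)) =
        (if r i < r k then B i k else 0) * (B k j - (if r k < r j then B k j else 0))
      rw [h1, h2]
  -- the iteration is stationary after `n` steps, and its fixed point gives the factors
  set X := T^[n] 0 with hX
  have hfix : X = Y - P X * (X - P X) := by
    refine mat_ext fun i j ↦ ?_
    have := hagree n i j (by omega)
    rw [Function.iterate_succ_apply'] at this
    exact this.symm
  have hXm := hmem n
  refine ⟨1 + P X, one_add_mem_rootGroup (rootProj_mem r X),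
    one_add_mem_rootGroup (r := Equiv.refl _) (hP X hXm), 1 + (X - P X),
    one_add_mem_rootGroup (r := Equiv.refl _) (sub_mem hXm (hP X hXm)), fun i j hij ↦ ?_, ?_⟩
  · have hne : i ≠ j := by rintro rfl; exact hij.ne rfl
    change (1 : Mat n) i j + (X i j - if r i < r j then X i j else 0) = 0
    rw [one_entry, if_neg hne, if_pos hij, sub_self, add_zero]
  · have e : (1 + P X) * (1 + (X - P X)) = 1 + (X + P X * (X - P X)) := by noncomm_ring
    rw [e]
    nth_rewrite 1 [hfix]
    rw [sub_add_cancel, hY]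
    abel

theorem eq_one_of_mul_mem_lowerBorel {M b : Mat n} (hM : M ∈ upperUnipotent n)
    (hb : b ∈ lowerBorel n) (h : M * b ∈ lowerBorel n) : M = 1 := by
  have key : ∀ (m : ℕ) (i j : Fin n), i < j → n ≤ (j : ℕ) + m → M i j = 0 := by
    intro m
    induction m with
    | zero => intro i j _ hj; have := j.isLt; omega
    | succ m ih =>
      intro i j hij hj
      have h0 := h.1 i j hij
      rw [mul_entry, Finset.sum_eq_single j] at h0
      · exact (mul_eq_zero.mp h0).resolve_right (hb.2 j)
      · intro k _ hk
        rcases lt_or_gt_of_ne hk with hkj | hkj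
        · rw [hb.1 k j hkj, mul_zero]
        · rw [ih i k (hij.trans hkj) (by have := Fin.lt_def.mp hkj; omega), zero_mul]
      · simp
  refine mat_ext fun i j ↦ ?_
  rw [one_entry]
  split_ifs with hij
  · rw [hij, hM.2]
  · rcases lt_or_gt_of_ne hij with h1 | h1
    · exact key n i j h1 (by omega)
    · exact hM.1 i j h1

/-- The description of `w` as a monomial matrix: the only nonzero entry of row `i` is `coeff i`,
in column `perm i`. -/
structure MonomialData (w : GLn n) where
  /-- The position of the nonzero entry of each row. -/
  perm : Equiv.Perm (Fin n)
  /-- The nonzero entry of each row. -/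
  coeff : Fin n → ℝ
  coeff_ne_zero : ∀ i, coeff i ≠ 0
  entry : ∀ i j, (w : Mat n) i j = if j = perm i then coeff i else 0

/-- The normalizer of the diagonal subgroup consists of monomial matrices: conjugation by `w` maps
a diagonal matrix with distinct eigenvalues to a diagonal matrix, so `w` permutes the coordinate
axes. -/
theorem nonempty_monomialData {w : GLn n}
    (hw : w ∈ Subgroup.normalizer (diagonalSubgroup n : Set (GLn n))) :
    Nonempty (MonomialData w) := by
  let d : Fin n → ℝ := fun i ↦ (i : ℝ) + 1
  have hd0 : ∀ i, d i ≠ 0 := fun i ↦ by positivity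
  have hdinj : Function.Injective d := fun i j h ↦ by
    have h' : (i : ℝ) + 1 = (j : ℝ) + 1 := h
    exact Fin.ext (by exact_mod_cast add_right_cancel h')
  let du : (Fin n → ℝ)ˣ :=
    ⟨d, d⁻¹, funext fun i ↦ mul_inv_cancel₀ (hd0 i), funext fun i ↦ inv_mul_cancel₀ (hd0 i)⟩
  have hmem : w * Units.map (diagonalHom n) du * w⁻¹ ∈ diagonalSubgroup n :=
    (Subgroup.mem_normalizer_iff.mp hw _).mp ⟨du, rfl⟩
  obtain ⟨e, he⟩ := hmem
  have hcomm : (w : Mat n) * diagonalHom n d = diagonalHom n (e : Fin n → ℝ) * (w : Mat n) := by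
    have h1 : w * Units.map (diagonalHom n) du = Units.map (diagonalHom n) e * w := by
      rw [he]; group
    exact congrArg Units.val h1
  have hent : ∀ i j, (w : Mat n) i j * d j = (e : Fin n → ℝ) i * (w : Mat n) i j := by
    intro i j
    have h1 : ((w : Mat n) * diagonalHom n d) i j = (w : Mat n) i j * d j :=
      Matrix.mul_diagonal d (show Matrix (Fin n) (Fin n) ℝ from (w : Mat n)) i j
    have h2 : (diagonalHom n (e : Fin n → ℝ) * (w : Mat n)) i j =
        (e : Fin n → ℝ) i * (w : Mat n) i j :=
      Matrix.diagonal_mul (e : Fin n → ℝ) (show Matrix (Fin n) (Fin n) ℝ from (w : Mat n)) i j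
    rw [← h1, ← h2, hcomm]
  have hinv : ∀ i j, ∑ k, (w : Mat n) i k * ((w⁻¹ : GLn n) : Mat n) k j = if i = j then 1 else 0 := by
    intro i j
    rw [← mul_entry, Units.mul_inv, one_entry]
  have hex : ∀ i, ∃ j, (w : Mat n) i j ≠ 0 := by
    intro i
    by_contra! h
    have := hinv i i
    simp [h] at this
  choose r hr using hex
  have huniq : ∀ i j, (w : Mat n) i j ≠ 0 → j = r i := by
    intro i j hj
    have h1 := hent i j
    have h2 := hent i (r i)
    rw [mul_comm] at h1 h2
    exact hdinj ((mul_right_cancel₀ hj h1).trans (mul_right_cancel₀ (hr i) h2).symm)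
  have hentry : ∀ i j, (w : Mat n) i j = if j = r i then (w : Mat n) i (r i) else 0 := by
    intro i j
    split_ifs with h
    · rw [h]
    · by_contra h0
      exact h (huniq i j h0)
  have hinv' : ∀ i j, (w : Mat n) i (r i) * ((w⁻¹ : GLn n) : Mat n) (r i) j =
      if i = j then 1 else 0 := by
    intro i j
    rw [← hinv i j, Finset.sum_eq_single (r i)]
    · intro k _ hk
      rw [hentry i k, if_neg hk, zero_mul]
    · simp
  have hinj : Function.Injective r := by
    intro i j hij
    by_contra hne
    have h1 := hinv' i j
    have h2 := hinv' j j
    rw [if_neg hne, hij] at h1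
    rw [if_pos rfl] at h2
    have h3 : (w : Mat n) i (r j) ≠ 0 := hij ▸ hr i
    rw [(mul_eq_zero.mp h1).resolve_left h3, mul_zero] at h2
    exact zero_ne_one h2
  exact ⟨⟨Equiv.ofBijective r (Finite.injective_iff_bijective.mp hinj), fun i ↦ (w : Mat n) i (r i),
    hr, hentry⟩⟩

namespace MonomialData

variable {w : GLn n} (m : MonomialData w)

theorem mul_left_entry (X : Mat n) (i j : Fin n) :
    ((w : Mat n) * X) i j = m.coeff i * X (m.perm i) j := by
  rw [mul_entry, Finset.sum_eq_single (m.perm i)]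
  · rw [m.entry, if_pos rfl]
  · intro k _ hk
    rw [m.entry, if_neg hk, zero_mul]
  · simp

theorem mul_right_entry (Y : Mat n) (i j : Fin n) :
    (Y * (w : Mat n)) i (m.perm j) = Y i j * m.coeff j := by
  rw [mul_entry, Finset.sum_eq_single j]
  · rw [m.entry, if_pos rfl]
  · intro k _ hk
    rw [m.entry, if_neg fun h ↦ hk (m.perm.injective h).symm, mul_zero]
  · simp

theorem conj_entry (X : Mat n) (i j : Fin n) :
    ((w : Mat n) * X * ((w⁻¹ : GLn n) : Mat n)) i j =
      m.coeff i * X (m.perm i) (m.perm j) / m.coeff j := by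
  rw [eq_div_iff (m.coeff_ne_zero j), ← m.mul_right_entry, Units.inv_mul_cancel_right,
    m.mul_left_entry]

theorem conj_inv_entry (Y : Mat n) (i j : Fin n) :
    (((w⁻¹ : GLn n) : Mat n) * Y * (w : Mat n)) (m.perm i) (m.perm j) =
      Y i j * m.coeff j / m.coeff i := by
  rw [eq_div_iff (m.coeff_ne_zero i), mul_comm, ← m.mul_left_entry, mul_assoc,
    Units.mul_inv_cancel_left, m.mul_right_entry]

theorem conj_entry_eq_zero_iff (X : Mat n) (i j : Fin n) :
    ((w : Mat n) * X * ((w⁻¹ : GLn n) : Mat n)) i j = 0 ↔ X (m.perm i) (m.perm j) = 0 := by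
  rw [m.conj_entry, div_eq_zero_iff, mul_eq_zero]
  simp [m.coeff_ne_zero]

theorem mem_conjLie_iff (S : Submodule ℝ (Mat n)) (Y : Mat n) :
    Y ∈ conjLie w S ↔ ((w⁻¹ : GLn n) : Mat n) * Y * (w : Mat n) ∈ S := by
  constructor
  · rintro ⟨X, hX, rfl⟩
    simpa [mul_assoc] using hX
  · intro h
    exact ⟨_, h, by simp [mul_assoc]⟩

theorem conjLie_nPlus : conjLie w (nPlus n) = rootSpace m.perm := by
  ext Y
  rw [mem_conjLie_iff]
  constructor
  · intro h i j hij
    have := h _ _ hij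
    rw [m.conj_inv_entry] at this
    simpa [m.coeff_ne_zero] using this
  · intro h i j hij
    obtain ⟨i, rfl⟩ := m.perm.surjective i
    obtain ⟨j, rfl⟩ := m.perm.surjective j
    rw [m.conj_inv_entry, h i j hij, zero_mul, zero_div]

theorem entry_eq_zero_of_mem_conjLie_nMinus {Y : Mat n} (hY : Y ∈ conjLie w (nMinus n))
    {i j : Fin n} (hij : m.perm i ≤ m.perm j) : Y i j = 0 := by
  rw [mem_conjLie_iff] at hY
  have := hY _ _ hij
  rw [m.conj_inv_entry] at this
  simpa [m.coeff_ne_zero] using this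

theorem conjSet_upperUnipotent : conjSet w (upperUnipotent n) = rootGroup m.perm := by
  ext Y
  constructor
  · rintro ⟨u, hu, rfl⟩
    refine ⟨fun i j hij ↦ (m.conj_entry_eq_zero_iff _ i j).mpr (hu.1 _ _ hij), fun i ↦ ?_⟩
    change ((w : Mat n) * u * ((w⁻¹ : GLn n) : Mat n)) i i = 1
    rw [m.conj_entry, hu.2, mul_one, div_self (m.coeff_ne_zero i)]
  · intro hY
    refine ⟨((w⁻¹ : GLn n) : Mat n) * Y * (w : Mat n), ⟨fun i j hij ↦ ?_, fun i ↦ ?_⟩,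
      by simp [mul_assoc]⟩
    · obtain ⟨i, rfl⟩ := m.perm.surjective i
      obtain ⟨j, rfl⟩ := m.perm.surjective j
      rw [m.conj_inv_entry, hY.1 i j hij, zero_mul, zero_div]
    · obtain ⟨i, rfl⟩ := m.perm.surjective i
      rw [m.conj_inv_entry, hY.2, one_mul, div_self (m.coeff_ne_zero i)]

/-- `w⁻¹ Q w` is lower triangular if the entries of `Q` in `w 𝔫 w⁻¹` vanish. -/
theorem conj_inv_lower {Q : Mat n} (hQ : ∀ i j, m.perm i < m.perm j → Q i j = 0) (i j : Fin n)
    (hij : i < j) : (((w⁻¹ : GLn n) : Mat n) * Q * (w : Mat n)) i j = 0 := by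
  obtain ⟨i, rfl⟩ := m.perm.surjective i
  obtain ⟨j, rfl⟩ := m.perm.surjective j
  rw [m.conj_inv_entry, hQ i j hij, zero_mul, zero_div]

end MonomialData

end

/-! ### The projection of `w N B₋` to `w N w⁻¹` -/

noncomputable section

open Filter Topology

variable {n : ℕ}

theorem diagonalHom_mul_entry (d : Fin n → ℝ) (X : Mat n) (i j : Fin n) :
    (diagonalHom n d * X) i j = d i * X i j :=
  Matrix.diagonal_mul d (show Matrix (Fin n) (Fin n) ℝ from X) i j

theorem mul_diagonalHom_entry (d : Fin n → ℝ) (X : Mat n) (i j : Fin n) :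
    (X * diagonalHom n d) i j = X i j * d j :=
  Matrix.mul_diagonal d (show Matrix (Fin n) (Fin n) ℝ from X) i j

theorem exists_inv_mem_lowerBorel {b : Mat n} (hb : b ∈ lowerBorel n) :
    ∃ c ∈ lowerBorel n, b * c = 1 ∧ c * b = 1 := by
  let d : Fin n → ℝ := fun i ↦ b i i
  have hd : d * d⁻¹ = 1 := funext fun i ↦ mul_inv_cancel₀ (hb.2 i)
  have hu : diagonalHom n d⁻¹ * b ∈ rootGroup (Fin.revPerm (n := n)) := by
    refine ⟨fun i j hij ↦ ?_, fun i ↦ ?_⟩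
    · rw [diagonalHom_mul_entry, hb.1 i j (Fin.rev_lt_rev.mp hij), mul_zero]
    · rw [diagonalHom_mul_entry]
      exact inv_mul_cancel₀ (hb.2 i)
  obtain ⟨v, hv, h1, h2⟩ := exists_inv_mem_rootGroup hu
  have hbe : b = diagonalHom n d * (diagonalHom n d⁻¹ * b) := by
    rw [← mul_assoc, ← map_mul, hd, map_one, one_mul]
  refine ⟨v * diagonalHom n d⁻¹, ⟨fun i j hij ↦ ?_, fun i ↦ ?_⟩, ?_, ?_⟩
  · rw [mul_diagonalHom_entry, hv.1 i j (Fin.rev_lt_rev.mpr hij), zero_mul]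
  · rw [mul_diagonalHom_entry, hv.2, one_mul]
    exact inv_ne_zero (hb.2 i)
  · nth_rewrite 1 [hbe]
    rw [mul_assoc, ← mul_assoc (diagonalHom n d⁻¹ * b), h1, one_mul, ← map_mul, hd, map_one]
  · rw [mul_assoc, h2]

theorem mul_mem_bigCell {w : GLn n} {g b : Mat n} (hg : g ∈ bigCell w) (hb : b ∈ lowerBorel n) :
    g * b ∈ bigCell w := by
  obtain ⟨u, hu, c, hc, rfl⟩ := hg
  exact ⟨u, hu, c * b, lowerBorel_mul hc hb, by simp only [mul_assoc]⟩

theorem mul_mem_bigCell_iff {w : GLn n} {g b : Mat n} (hb : b ∈ lowerBorel n) :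
    g * b ∈ bigCell w ↔ g ∈ bigCell w := by
  refine ⟨fun h ↦ ?_, fun h ↦ mul_mem_bigCell h hb⟩
  obtain ⟨c, hc, h1, -⟩ := exists_inv_mem_lowerBorel hb
  simpa [mul_assoc, h1] using mul_mem_bigCell h hc

open scoped Classical in
/-- The component in `w N w⁻¹` of an element of `w N B₋ = (w N w⁻¹) w B₋`. It identifies `U_w` with
the group `w N w⁻¹`. (The value is `1` outside `w N B₋`.) -/
def nu (w : GLn n) (g : Mat n) : Mat n :=
  if h : ∃ u ∈ upperUnipotent n, ∃ b ∈ lowerBorel n, g = (w : Mat n) * u * b then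
    (w : Mat n) * h.choose * ((w⁻¹ : GLn n) : Mat n)
  else 1

theorem nu_of_notMem {w : GLn n} {g : Mat n} (h : g ∉ bigCell w) : nu w g = 1 := dif_neg h

theorem exists_eq_nu_mul {w : GLn n} {g : Mat n} (hg : g ∈ bigCell w) :
    ∃ b ∈ lowerBorel n, g = nu w g * (w : Mat n) * b := by
  have hg : ∃ u ∈ upperUnipotent n, ∃ b ∈ lowerBorel n, g = (w : Mat n) * u * b := hg
  obtain ⟨b, hb, h⟩ := hg.choose_spec.2
  refine ⟨b, hb, ?_⟩
  rw [nu, dif_pos hg, Units.inv_mul_cancel_right]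
  exact h

theorem eq_of_mul_mul_eq {u u' b b' : Mat n} (hu : u ∈ upperUnipotent n)
    (hu' : u' ∈ upperUnipotent n) (hb : b ∈ lowerBorel n) (hb' : b' ∈ lowerBorel n)
    (h : u * b = u' * b') : u = u' := by
  rw [← rootGroup_refl] at hu hu'
  obtain ⟨v, hv, h1, h2⟩ := exists_inv_mem_rootGroup hu'
  have h3 : v * u * b = b' := by rw [mul_assoc, h, ← mul_assoc, h2, one_mul]
  have h4 := eq_one_of_mul_mem_lowerBorel (mul_mem_rootGroup hv hu) hb (h3 ▸ hb')
  calc u = u' * (v * u) := by rw [← mul_assoc, h1, one_mul]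
    _ = u' := by rw [h4, mul_one]

theorem nu_mul_mul (w : GLn n) {u b : Mat n} (hu : u ∈ upperUnipotent n) (hb : b ∈ lowerBorel n) :
    nu w ((w : Mat n) * u * b) = (w : Mat n) * u * ((w⁻¹ : GLn n) : Mat n) := by
  have hg : ∃ u' ∈ upperUnipotent n, ∃ b' ∈ lowerBorel n,
      (w : Mat n) * u * b = (w : Mat n) * u' * b' := ⟨u, hu, b, hb, rfl⟩
  obtain ⟨b', hb', h⟩ := hg.choose_spec.2
  rw [nu, dif_pos hg]
  have h' : u * b = hg.choose * b' := by
    have := congrArg (fun x : Mat n ↦ ((w⁻¹ : GLn n) : Mat n) * x) h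
    simpa only [mul_assoc, Units.inv_mul_cancel_left] using this
  rw [← eq_of_mul_mul_eq hu hg.choose_spec.1 hb hb' h']

theorem one_mem_lowerBorel (n : ℕ) : (1 : Mat n) ∈ lowerBorel n :=
  ⟨fun i j h ↦ by rw [one_entry, if_neg h.ne], fun i ↦ by rw [one_entry, if_pos rfl]; simp⟩

theorem nu_mul_right {w : GLn n} {g b : Mat n} (hg : g ∈ bigCell w) (hb : b ∈ lowerBorel n) :
    nu w (g * b) = nu w g := by
  obtain ⟨u, hu, c, hc, rfl⟩ := hg
  rw [mul_assoc ((w : Mat n) * u), nu_mul_mul w hu (lowerBorel_mul hc hb), nu_mul_mul w hu hc]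

/-- By the inverse function theorem at `1`, the factors of `u b`, with `u` unipotent upper
triangular and `b` lower triangular, depend smoothly on the product. -/
theorem contDiffOn_nu (w : GLn n) : ContDiffOn ℝ ∞ (nu w) (bigCell w) := by
  set U : Mat n →L[ℝ] Mat n := (strictUpperPart n).toContinuousLinearMap
  set L : Mat n →L[ℝ] Mat n := (lowerPart n).toContinuousLinearMap
  have hUL : ∀ X, U X + L X = X := by
    intro X
    refine mat_ext fun i j ↦ ?_
    change (if i < j then X i j else 0) + (if i < j then 0 else X i j) = X i j
    split_ifs <;> simp
  have hU1 : U 1 = 0 := by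
    refine mat_ext fun i j ↦ ?_
    change (if i < j then (1 : Mat n) i j else 0) = (0 : ℝ)
    split_ifs with h
    · simp [one_entry, h.ne]
    · rfl
  have hL1 : L 1 = 1 := by simpa [hU1] using hUL 1
  have hUm : ∀ X, 1 + U X ∈ upperUnipotent n := fun X ↦ ⟨fun i j h ↦ by
    change (1 : Mat n) i j + (if i < j then X i j else 0) = 0
    simp [one_entry, h.ne', h.not_gt], fun i ↦ by
    change (1 : Mat n) i i + (if i < i then X i i else 0) = 1
    simp [one_entry]⟩
  let f : Mat n → Mat n := fun X ↦ (1 + U X) * L X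
  have hf : ContDiff ℝ ∞ f := (contDiff_const.add U.contDiff).mul L.contDiff
  have hd : HasFDerivAt f
      ((ContinuousLinearEquiv.refl ℝ (Mat n) : Mat n ≃L[ℝ] Mat n) : Mat n →L[ℝ] Mat n) 1 := by
    have h := ((U.hasFDerivAt (x := 1)).const_add (1 : Mat n)).mul' (L.hasFDerivAt (x := 1))
    refine h.congr_fderiv ?_
    ext1 X
    change (1 + U 1) * L X + U X * L 1 = X
    rw [hU1, hL1, add_zero, one_mul, mul_one]
    exact (add_comm (L X) (U X)).trans (hUL X)
  have h1 : f 1 = 1 := by simp [f, hU1, hL1]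
  let inv := hf.contDiffAt.localInverse hd (by simp)
  have hinv : ContDiffAt ℝ ∞ inv 1 := by
    have := hf.contDiffAt.to_localInverse (n := ∞) hd (by simp)
    rwa [h1] at this
  have hright : ∀ᶠ h in 𝓝 (1 : Mat n), f (inv h) = h := by
    have := (hf.contDiffAt.hasStrictFDerivAt' hd (by simp)).eventually_right_inverse
    rwa [h1] at this
  have hinv1 : inv 1 = 1 := by
    have := hf.contDiffAt.localInverse_apply_image (n := ∞) hd (by simp)
    rwa [h1] at this
  have hdiag : ∀ᶠ h in 𝓝 (1 : Mat n), ∀ i, inv h i i ≠ 0 := by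
    refine eventually_all.mpr fun i ↦ ?_
    have hc : Continuous fun X : Mat n ↦ X i i :=
      LinearMap.continuous_of_finiteDimensional
        ({ toFun := fun X ↦ X i i, map_add' := fun _ _ ↦ rfl, map_smul' := fun _ _ ↦ rfl } :
          Mat n →ₗ[ℝ] ℝ)
    refine (hc.continuousAt.comp hinv.continuousAt).eventually_ne ?_
    simp [hinv1, one_entry]
  rintro g ⟨u, hu, b, hb, rfl⟩
  obtain ⟨u', rfl⟩ := isUnit_of_upperUnipotent hu
  obtain ⟨b', rfl⟩ := isUnit_of_lowerBorel hb
  refine ContDiffAt.contDiffWithinAt ?_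
  let k : Mat n → Mat n := fun h ↦
    ((u'⁻¹ : (Mat n)ˣ) : Mat n) * ((w⁻¹ : (Mat n)ˣ) : Mat n) * h * ((b'⁻¹ : (Mat n)ˣ) : Mat n)
  have hk : ContDiff ℝ ∞ k := (contDiff_const.mul contDiff_id).mul contDiff_const
  have hk1 : k ((w : Mat n) * u' * b') = 1 := by simp [k, mul_assoc]
  have hkt : Tendsto k (𝓝 ((w : Mat n) * u' * b')) (𝓝 1) := by
    have := hk.continuous.continuousAt (x := (w : Mat n) * u' * b')
    rwa [ContinuousAt, hk1] at this
  have hsm : ContDiffAt ℝ ∞ (fun h ↦ (w : Mat n) * (u' * (1 + U (inv (k h)))) *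
      ((w⁻¹ : GLn n) : Mat n)) ((w : Mat n) * u' * b') := by
    have h3 : ContDiffAt ℝ ∞ (fun h ↦ inv (k h)) ((w : Mat n) * u' * b') :=
      ContDiffAt.comp _ (by rwa [hk1]) hk.contDiffAt
    exact (contDiffAt_const.mul (contDiffAt_const.mul
      (contDiffAt_const.add (U.contDiff.contDiffAt.comp _ h3)))).mul contDiffAt_const
  refine hsm.congr_of_eventuallyEq ?_
  filter_upwards [hkt hright, hkt hdiag] with h hh1 hh2
  have hh1' : (1 + U (inv (k h))) * L (inv (k h)) = k h := hh1
  have hLb : L (inv (k h)) ∈ lowerBorel n := ⟨fun i j hij ↦ by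
    change (if i < j then 0 else inv (k h) i j) = 0
    simp [hij], fun i ↦ by
    change (if i < i then 0 else inv (k h) i i) ≠ 0
    simpa using hh2 i⟩
  have he : h = (w : Mat n) * (u' * (1 + U (inv (k h)))) * (L (inv (k h)) * b') := by
    calc h = (w : Mat n) * u' * k h * b' := by simp [k, mul_assoc]
      _ = (w : Mat n) * u' * ((1 + U (inv (k h))) * L (inv (k h))) * b' := by rw [hh1']
      _ = _ := by simp only [mul_assoc]
  conv_lhs => rw [he]
  exact nu_mul_mul w (upperUnipotent_mul hu (hUm _)) (lowerBorel_mul hLb hb)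

theorem hasFDerivAt_nu {w : GLn n} {g : Mat n} (hg : g ∈ bigCell w) :
    HasFDerivAt (nu w) (fderiv ℝ (nu w) g) g :=
  (((contDiffOn_nu w).contDiffAt ((bigCell w).isOpen.mem_nhds hg)).differentiableAt
    (by simp)).hasFDerivAt

/-- The derivative of a curve `t ↦ A (1 + t X) B`. -/
theorem hasDerivAt_mul_one_add_smul_mul (A X B : Mat n) :
    HasDerivAt (fun t : ℝ ↦ A * (1 + t • X) * B) (A * X * B) 0 := by
  have h := (((hasDerivAt_id (0 : ℝ)).smul_const X).const_add 1).const_mul A |>.mul_const B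
  simpa using h

theorem eventually_one_add_smul_mem_lowerBorel {b : Mat n}
    (hb : ∀ i j, i < j → b i j = 0) : ∀ᶠ t : ℝ in 𝓝 0, 1 + t • b ∈ lowerBorel n := by
  have h : ∀ᶠ t : ℝ in 𝓝 0, ∀ i, 1 + t * b i i ≠ 0 := by
    refine eventually_all.mpr fun i ↦ ?_
    refine ContinuousAt.eventually_ne (by fun_prop) ?_
    simp
  filter_upwards [h] with t ht
  refine ⟨fun i j hij ↦ ?_, fun i ↦ ?_⟩
  · rw [add_entry, smul_entry, hb i j hij, one_entry, if_neg hij.ne, mul_zero, add_zero]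
  · rw [add_entry, smul_entry, one_entry, if_pos rfl]
    exact ht i

theorem fderiv_nu_mul_right {w : GLn n} {g b : Mat n} (hg : g ∈ bigCell w)
    (hb : ∀ i j, i < j → b i j = 0) :
    fderiv ℝ (nu w) g (g * b) = 0 := by
  have h1 : HasDerivAt (fun t : ℝ ↦ g * (1 + t • b)) (g * b) 0 := by
    simpa using hasDerivAt_mul_one_add_smul_mul g b 1
  have h3 : HasFDerivAt (nu w) (fderiv ℝ (nu w) g) (g * (1 + (0 : ℝ) • b)) := by
    simpa using hasFDerivAt_nu hg
  refine (h3.comp_hasDerivAt 0 h1).unique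
    ((hasDerivAt_const (0 : ℝ) (nu w g)).congr_of_eventuallyEq ?_)
  filter_upwards [eventually_one_add_smul_mem_lowerBorel hb] with t ht
  exact nu_mul_right hg ht

namespace MonomialData

variable {w : GLn n} (m : MonomialData w)

theorem nu_mem (g : Mat n) : nu w g ∈ rootGroup m.perm := by
  by_cases hg : g ∈ bigCell w
  · obtain ⟨u, hu, b, hb, rfl⟩ := hg
    rw [nu_mul_mul w hu hb, ← m.conjSet_upperUnipotent]
    exact ⟨u, hu, rfl⟩
  · rw [nu_of_notMem hg]
    exact one_mem_rootGroup _

theorem mul_mul_mem_bigCell {v b : Mat n} (hv : v ∈ rootGroup m.perm) (hb : b ∈ lowerBorel n) :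
    v * (w : Mat n) * b ∈ bigCell w := by
  rw [← m.conjSet_upperUnipotent] at hv
  obtain ⟨u, hu, rfl⟩ := hv
  exact ⟨u, hu, b, hb, by simp⟩

theorem mul_mem_bigCell {v : Mat n} (hv : v ∈ rootGroup m.perm) : v * (w : Mat n) ∈ bigCell w := by
  simpa using m.mul_mul_mem_bigCell hv (one_mem_lowerBorel n)

theorem nu_eq {v b : Mat n} (hv : v ∈ rootGroup m.perm) (hb : b ∈ lowerBorel n) :
    nu w (v * (w : Mat n) * b) = v := by
  rw [← m.conjSet_upperUnipotent] at hv
  obtain ⟨u, hu, rfl⟩ := hv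
  rw [Units.inv_mul_cancel_right, nu_mul_mul w hu hb]

theorem nu_eq' {v : Mat n} (hv : v ∈ rootGroup m.perm) : nu w (v * (w : Mat n)) = v := by
  simpa using m.nu_eq hv (one_mem_lowerBorel n)

theorem nu_mul_left {v g : Mat n} (hv : v ∈ rootGroup m.perm) (hg : g ∈ bigCell w) :
    nu w (v * g) = v * nu w g := by
  obtain ⟨b, hb, h⟩ := exists_eq_nu_mul hg
  conv_lhs => rw [h, ← mul_assoc, ← mul_assoc]
  exact m.nu_eq (mul_mem_rootGroup hv (m.nu_mem g)) hb

/-- The Schubert cell consists of the points of `w N B₋` whose component in `w N w⁻¹` is upper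
triangular. -/
theorem mem_schubertCell_iff (m : MonomialData w) {g : Mat n} :
    g ∈ schubertCell w ↔ g ∈ bigCell w ∧ nu w g ∈ upperUnipotent n := by
  constructor
  · rintro ⟨u, hu, b, hb, rfl⟩
    obtain ⟨v, hv, hvu, v', hv', hv'0, rfl⟩ := exists_factorization_of_mem_upperUnipotent m.perm hu
    have hb' : ((w⁻¹ : GLn n) : Mat n) * v' * (w : Mat n) * b ∈ lowerBorel n := by
      refine lowerBorel_mul ⟨m.conj_inv_lower hv'0, fun i ↦ ?_⟩ hb
      obtain ⟨i, rfl⟩ := m.perm.surjective i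
      rw [m.conj_inv_entry, hv'.2, one_mul, div_self (m.coeff_ne_zero i)]
      exact one_ne_zero
    have he : v * v' * (w : Mat n) * b =
        v * (w : Mat n) * (((w⁻¹ : GLn n) : Mat n) * v' * (w : Mat n) * b) := by
      simp [mul_assoc]
    rw [he]
    exact ⟨m.mul_mul_mem_bigCell hv hb', by rwa [m.nu_eq hv hb']⟩
  · rintro ⟨hg, hu⟩
    obtain ⟨b, hb, h⟩ := exists_eq_nu_mul hg
    exact ⟨_, hu, b, hb, h⟩

theorem fderiv_nu_mul_left {g X : Mat n} (hg : g ∈ bigCell w) (hX : X ∈ rootSpace m.perm) :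
    fderiv ℝ (nu w) g (X * g) = X * nu w g := by
  have h1 : HasDerivAt (fun t : ℝ ↦ (1 + t • X) * g) (X * g) 0 := by
    simpa using hasDerivAt_mul_one_add_smul_mul 1 X g
  have h2 : HasDerivAt (fun t : ℝ ↦ (1 + t • X) * nu w g) (X * nu w g) 0 := by
    simpa using hasDerivAt_mul_one_add_smul_mul 1 X (nu w g)
  have h3 : HasFDerivAt (nu w) (fderiv ℝ (nu w) g) ((1 + (0 : ℝ) • X) * g) := by
    simpa using hasFDerivAt_nu hg
  refine (h3.comp_hasDerivAt 0 h1).unique (h2.congr_of_eventuallyEq (Eventually.of_forall ?_))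
  exact fun t ↦ m.nu_mul_left (one_add_mem_rootGroup (Submodule.smul_mem _ t hX)) hg

/-- The derivative of `nu` along a curve through `v w`, `v ∈ w N w⁻¹`, written as a right
translation by `Q`: the part of `Q` in `w 𝔟₋ w⁻¹` is tangent to the fibre. -/
theorem fderiv_nu_mul_mul {v : Mat n} (hv : v ∈ rootGroup m.perm) (Q : Mat n) :
    fderiv ℝ (nu w) (v * (w : Mat n)) (v * Q * (w : Mat n)) = v * rootProj m.perm Q := by
  have hg := m.mul_mem_bigCell hv
  have hlow : ∀ i j, m.perm i < m.perm j → (Q - rootProj m.perm Q) i j = 0 := by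
    intro i j hij
    rw [sub_entry, rootProj_entry, if_pos hij, sub_self]
  have hsplit : v * Q * (w : Mat n) = v * rootProj m.perm Q * (w : Mat n) +
      v * (w : Mat n) * (((w⁻¹ : GLn n) : Mat n) * (Q - rootProj m.perm Q) * (w : Mat n)) := by
    have : v * (w : Mat n) * (((w⁻¹ : GLn n) : Mat n) * (Q - rootProj m.perm Q) * (w : Mat n)) =
        v * (Q - rootProj m.perm Q) * (w : Mat n) := by simp [mul_assoc]
    rw [this, mul_sub, sub_mul, add_sub_cancel]
  rw [hsplit, map_add, fderiv_nu_mul_right hg (m.conj_inv_lower hlow), add_zero]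
  obtain ⟨v', hv', h1, h2⟩ := exists_inv_mem_rootGroup hv
  have hX : v * rootProj m.perm Q * v' ∈ rootSpace m.perm :=
    rootSpace_mul_mem_rootGroup hv' (rootGroup_mul_mem_rootSpace hv (rootProj_mem _ _))
  have := m.fderiv_nu_mul_left hg hX
  rw [m.nu_eq' hv] at this
  have e : v * rootProj m.perm Q * v' * (v * (w : Mat n)) = v * rootProj m.perm Q * (w : Mat n) := by
    rw [mul_assoc _ v', ← mul_assoc v', h2, one_mul]
  rw [e, mul_assoc (v * _), h2, mul_one] at this
  exact this

end MonomialData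

end

/-! ### Distribution sections as a module over the smooth functions on `U_w` -/

noncomputable section

open Filter Topology

variable {n : ℕ}

/-- The algebra of smooth functions on `U_w`, as functions on matrices. The values outside `w N B₋`
are arbitrary. -/
def smoothAlg (w : GLn n) : Subalgebra ℝ (Mat n → ℝ) where
  carrier := {f | ContDiffOn ℝ ∞ f (bigCell w) ∧
    ∀ g ∈ bigCell w, ∀ b ∈ lowerBorel n, f (g * b) = f g}
  mul_mem' {f f'} hf hf' := ⟨hf.1.mul hf'.1, fun g hg b hb ↦ by
    rw [Pi.mul_apply, Pi.mul_apply, hf.2 g hg b hb, hf'.2 g hg b hb]⟩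
  add_mem' {f f'} hf hf' := ⟨hf.1.add hf'.1, fun g hg b hb ↦ by
    rw [Pi.add_apply, Pi.add_apply, hf.2 g hg b hb, hf'.2 g hg b hb]⟩
  algebraMap_mem' c := ⟨contDiffOn_const, fun _ _ _ _ ↦ rfl⟩

variable {w : GLn n}

instance : CoeFun (smoothAlg w) fun _ ↦ Mat n → ℝ := ⟨fun a ↦ a.1⟩

theorem smoothAlg_ext {a a' : smoothAlg w} (h : ∀ g, a g = a' g) : a = a' := Subtype.ext (funext h)

theorem smoothAlg_differentiableAt (a : smoothAlg w) {g : Mat n} (hg : g ∈ bigCell w) :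
    DifferentiableAt ℝ a g :=
  (a.2.1.contDiffAt ((bigCell w).isOpen.mem_nhds hg)).differentiableAt (by simp)

theorem smoothAlg_sum_apply {ι : Type*} (s : Finset ι) (a : ι → smoothAlg w) (g : Mat n) :
    (∑ i ∈ s, a i : smoothAlg w) g = ∑ i ∈ s, a i g := by
  have h : ((∑ i ∈ s, a i : smoothAlg w) : Mat n → ℝ) = ∑ i ∈ s, (a i : Mat n → ℝ) := by
    simp
  rw [h, Finset.sum_apply]

/-- An element of the algebra as a smooth function on `U_w`. -/
def toSmoothFunction (a : smoothAlg w) : SmoothFunction w := ⟨a, a.2.1, a.2.2⟩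

/-- A smooth function on `U_w` as an element of the algebra. -/
def ofSmoothFunction (a : SmoothFunction w) : smoothAlg w := ⟨a.toFun, a.smooth, a.invariant⟩

theorem fderiv_mul_right_of_invariant {f : Mat n → ℝ} (hf : ContDiffOn ℝ ∞ f (bigCell w))
    {b : Mat n} (hb : b ∈ lowerBorel n) (hinv : ∀ g ∈ bigCell w, f (g * b) = f g) {g : Mat n}
    (hg : g ∈ bigCell w) (v : Mat n) : fderiv ℝ f (g * b) (v * b) = fderiv ℝ f g v := by
  have h1 : HasFDerivAt f (fderiv ℝ f (g * b)) (g * b) :=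
    ((hf.contDiffAt ((bigCell w).isOpen.mem_nhds (mul_mem_bigCell hg hb))).differentiableAt
      (by simp)).hasFDerivAt
  have h2 : HasFDerivAt (fun g : Mat n ↦ g * b) ((ContinuousLinearMap.mul ℝ (Mat n)).flip b) g :=
    ((ContinuousLinearMap.mul ℝ (Mat n)).flip b).hasFDerivAt
  have h3 := (h1.comp g h2).congr_of_eventuallyEq (f₁ := f) (by
    filter_upwards [(bigCell w).isOpen.mem_nhds hg] with h hh
    exact (hinv h hh).symm)
  rw [h3.fderiv]
  rfl

/-- Infinitesimal left translation of functions on `w N B₋`, extended by zero. -/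
def leftDerivFun (w : GLn n) (Y : Mat n) (f : Mat n → ℝ) : Mat n → ℝ :=
  (bigCell w : Set (Mat n)).indicator fun g ↦ fderiv ℝ f g (-(Y * g))

theorem leftDerivFun_of_mem (Y : Mat n) (f : Mat n → ℝ) {g : Mat n} (hg : g ∈ bigCell w) :
    leftDerivFun w Y f g = fderiv ℝ f g (-(Y * g)) :=
  Set.indicator_of_mem (s := (bigCell w : Set (Mat n))) hg _

theorem leftDerivFun_of_notMem (Y : Mat n) (f : Mat n → ℝ) {g : Mat n} (hg : g ∉ bigCell w) :
    leftDerivFun w Y f g = 0 :=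
  Set.indicator_of_notMem (s := (bigCell w : Set (Mat n))) hg _

theorem leftDerivFun_mem (Y : Mat n) (a : smoothAlg w) : leftDerivFun w Y a ∈ smoothAlg w := by
  constructor
  · have h : ContDiffOn ℝ ∞ (fun g ↦ fderiv ℝ a g (-(Y * g))) (bigCell w) :=
      (a.2.1.fderiv_of_isOpen (bigCell w).isOpen (m := ∞) (by simp)).clm_apply
        (contDiff_const.mul contDiff_id).neg.contDiffOn
    exact h.congr fun g hg ↦ leftDerivFun_of_mem Y a hg
  · intro g hg b hb
    rw [leftDerivFun_of_mem Y a (mul_mem_bigCell hg hb), leftDerivFun_of_mem Y a hg, ← mul_assoc,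
      ← neg_mul]
    exact fderiv_mul_right_of_invariant a.2.1 hb (fun g hg ↦ a.2.2 g hg b hb) hg _

/-- Infinitesimal left translation by `Y`, as a derivation of the algebra of smooth functions on
`U_w`. -/
def leftDeriv (w : GLn n) (Y : Mat n) : Derivation ℝ (smoothAlg w) (smoothAlg w) :=
  Derivation.mk'
    { toFun := fun a ↦ ⟨leftDerivFun w Y a, leftDerivFun_mem Y a⟩
      map_add' := fun a a' ↦ smoothAlg_ext fun g ↦ by
        change leftDerivFun w Y ((a : Mat n → ℝ) + a') g =
          leftDerivFun w Y a g + leftDerivFun w Y a' g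
        by_cases hg : g ∈ bigCell w
        · simp only [leftDerivFun_of_mem _ _ hg]
          exact congrArg (fun L : Mat n →L[ℝ] ℝ ↦ L (-(Y * g)))
            (fderiv_add (smoothAlg_differentiableAt a hg) (smoothAlg_differentiableAt a' hg))
        · simp only [leftDerivFun_of_notMem _ _ hg, add_zero]
      map_smul' := fun c a ↦ smoothAlg_ext fun g ↦ by
        change leftDerivFun w Y (c • (a : Mat n → ℝ)) g = c * leftDerivFun w Y a g
        by_cases hg : g ∈ bigCell w
        · simp only [leftDerivFun_of_mem _ _ hg]
          exact congrArg (fun L : Mat n →L[ℝ] ℝ ↦ L (-(Y * g)))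
            (fderiv_const_smul (smoothAlg_differentiableAt a hg) c)
        · simp only [leftDerivFun_of_notMem _ _ hg, mul_zero] }
    fun a a' ↦ smoothAlg_ext fun g ↦ by
      change leftDerivFun w Y ((a : Mat n → ℝ) * a') g =
        a g * leftDerivFun w Y a' g + a' g * leftDerivFun w Y a g
      by_cases hg : g ∈ bigCell w
      · simp only [leftDerivFun_of_mem _ _ hg]
        exact congrArg (fun L : Mat n →L[ℝ] ℝ ↦ L (-(Y * g)))
          (fderiv_mul (smoothAlg_differentiableAt a hg) (smoothAlg_differentiableAt a' hg))
      · simp only [leftDerivFun_of_notMem _ _ hg, mul_zero, add_zero]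

theorem leftDeriv_apply (Y : Mat n) (a : smoothAlg w) {g : Mat n} (hg : g ∈ bigCell w) :
    leftDeriv w Y a g = fderiv ℝ a g (-(Y * g)) := leftDerivFun_of_mem Y a hg

theorem testFunction_eq_zero_of_notMem (φ : 𝓓(bigCell w, ℝ)) {g : Mat n} (hg : g ∉ bigCell w) :
    φ g = 0 :=
  image_eq_zero_of_notMem_tsupport fun h ↦ hg (φ.tsupport_subset h)

@[simp]
theorem leftTest_apply' (Y : Mat n) (φ : 𝓓(bigCell w, ℝ)) (g : Mat n) :
    leftTest w Y φ g = fderiv ℝ φ g (-(Y * g)) := by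
  simp [leftTest]

theorem leftTest_add (Y Y' : Mat n) (φ : 𝓓(bigCell w, ℝ)) :
    leftTest w (Y + Y') φ = leftTest w Y φ + leftTest w Y' φ := by
  ext g
  change _ = leftTest w Y φ g + leftTest w Y' φ g
  simp only [leftTest_apply', add_mul, neg_add, map_add]

theorem leftTest_smul (c : ℝ) (Y : Mat n) (φ : 𝓓(bigCell w, ℝ)) :
    leftTest w (c • Y) φ = c • leftTest w Y φ := by
  ext g
  change _ = c * leftTest w Y φ g
  rw [leftTest_apply', leftTest_apply', smul_mul_assoc, ← smul_neg, map_smul, smul_eq_mul]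

theorem leftTest_mulTest (Y : Mat n) (a : smoothAlg w) (φ : 𝓓(bigCell w, ℝ)) :
    leftTest w Y (mulTest a.2.1 φ) =
      mulTest (leftDeriv w Y a).2.1 φ + mulTest a.2.1 (leftTest w Y φ) := by
  ext g
  change _ = mulTest (leftDeriv w Y a).2.1 φ g + mulTest a.2.1 (leftTest w Y φ) g
  rw [mulTest_apply, mulTest_apply]
  by_cases hg : g ∈ bigCell w
  · rw [leftTest_apply', leftTest_apply', leftDeriv_apply Y a hg]
    have h : HasFDerivAt (mulTest a.2.1 φ)
        (a g • fderiv ℝ φ g + φ g • fderiv ℝ a g) g :=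
      (smoothAlg_differentiableAt a hg).hasFDerivAt.mul
        (φ.contDiff.differentiable (by simp) g).hasFDerivAt
    rw [h.fderiv]
    change a g * fderiv ℝ φ g (-(Y * g)) + φ g * fderiv ℝ a g (-(Y * g)) = _
    ring
  · rw [testFunction_eq_zero_of_notMem _ hg, testFunction_eq_zero_of_notMem _ hg,
      testFunction_eq_zero_of_notMem _ hg, mul_zero, mul_zero, add_zero]

theorem leftTest_leftTest (Y X : Mat n) (φ : 𝓓(bigCell w, ℝ)) :
    leftTest w Y (leftTest w X φ) =
      leftTest w X (leftTest w Y φ) + leftTest w (Y * X - X * Y) φ := by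
  ext g
  change _ = leftTest w X (leftTest w Y φ) g + leftTest w (Y * X - X * Y) φ g
  have hd : ∀ Z : Mat n, HasFDerivAt (leftTest w Z φ)
      ((fderiv ℝ φ g).comp (-(ContinuousLinearMap.mul ℝ (Mat n) Z)) +
        (fderiv ℝ (fderiv ℝ φ) g).flip (-(Z * g))) g := by
    intro Z
    have h1 : HasFDerivAt (fun g : Mat n ↦ -(Z * g)) (-(ContinuousLinearMap.mul ℝ (Mat n) Z)) g :=
      (ContinuousLinearMap.mul ℝ (Mat n) Z).hasFDerivAt.neg
    have h2 : HasFDerivAt (fderiv ℝ φ) (fderiv ℝ (fderiv ℝ φ) g) g :=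
      ((φ.contDiff.fderiv_right (m := ∞) (by simp)).differentiable (by simp) g).hasFDerivAt
    have h3 := h2.clm_apply h1
    refine h3.congr_of_eventuallyEq (Eventually.of_forall fun g ↦ ?_)
    exact leftTest_apply' Z φ g
  have hsymm : IsSymmSndFDerivAt ℝ φ g :=
    (φ.contDiff.contDiffAt (x := g)).isSymmSndFDerivAt
      (by
      rw [minSmoothness_of_isRCLikeNormedField]
      exact ENat.LEInfty.out)
  rw [leftTest_apply', leftTest_apply', leftTest_apply', (hd X).fderiv, (hd Y).fderiv]
  change fderiv ℝ φ g (-(X * -(Y * g))) + fderiv ℝ (fderiv ℝ φ) g (-(Y * g)) (-(X * g)) =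
    fderiv ℝ φ g (-(Y * -(X * g))) + fderiv ℝ (fderiv ℝ φ) g (-(X * g)) (-(Y * g)) + _
  rw [hsymm.eq (-(Y * g)) (-(X * g))]
  have e : -(X * -(Y * g)) = -(Y * -(X * g)) + -((Y * X - X * Y) * g) := by noncomm_ring
  rw [e, map_add]
  ring

/-- Distributions on `w N B₋` form a module over the smooth functions on `U_w`. -/
instance : Module (smoothAlg w) 𝓓'(bigCell w, ℂ) where
  smul a := mulDist (toSmoothFunction a)
  smul_add a σ τ := map_add (mulDist (toSmoothFunction a)) σ τ
  smul_zero a := map_zero (mulDist (toSmoothFunction a))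
  one_smul σ := by
    ext φ
    refine congrArg σ ?_
    ext g
    exact one_mul _
  mul_smul a a' σ := by
    ext φ
    refine congrArg σ ?_
    ext g
    change a g * a' g * φ g = a' g * (a g * φ g)
    ring
  add_smul a a' σ := by
    ext φ
    change σ _ = σ (mulTest a.2.1 φ) + σ (mulTest a'.2.1 φ)
    rw [← map_add]
    congr 1
    ext g
    exact add_mul _ _ _
  zero_smul σ := by
    ext φ
    change σ _ = 0
    rw [← map_zero σ]
    congr 1
    ext g
    exact zero_mul _

theorem smul_dist_apply (a : smoothAlg w) (σ : 𝓓'(bigCell w, ℂ)) (φ : 𝓓(bigCell w, ℝ)) :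
    (a • σ) φ = σ (mulTest a.2.1 φ) := rfl

theorem ell_smul (Y : Mat n) (a : smoothAlg w) (σ : 𝓓'(bigCell w, ℂ)) :
    ell w Y (a • σ) = leftDeriv w Y a • σ + a • ell w Y σ := by
  ext φ
  change -σ (mulTest a.2.1 (leftTest w Y φ)) = σ (mulTest (leftDeriv w Y a).2.1 φ) +
    -σ (leftTest w Y (mulTest a.2.1 φ))
  rw [leftTest_mulTest, map_add]
  ring

theorem IsSection.smul {lam : Fin n → ℂ} {δ : Fin n → ZMod 2} {σ : 𝓓'(bigCell w, ℂ)}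
    (hσ : IsSection lam δ w σ) (a : smoothAlg w) : IsSection lam δ w (a • σ) := by
  intro b hb φ ψ h
  rw [smul_dist_apply, smul_dist_apply]
  refine hσ b hb _ _ fun g ↦ ?_
  rw [mulTest_apply, mulTest_apply, h]
  by_cases hg : g ∈ bigCell w
  · rw [a.2.2 g hg b hb]
  · rw [testFunction_eq_zero_of_notMem φ hg, mul_zero, mul_zero]

theorem IsSection.ell {lam : Fin n → ℂ} {δ : Fin n → ZMod 2} {σ : 𝓓'(bigCell w, ℂ)}
    (hσ : IsSection lam δ w σ) (Y : Mat n) : IsSection lam δ w (ell w Y σ) := by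
  intro b hb φ ψ h
  rw [ell_apply, ell_apply, mul_neg]
  congr 1
  refine hσ b hb _ _ fun g ↦ ?_
  rw [leftTest_apply', leftTest_apply']
  have h2 : HasFDerivAt (fun g : Mat n ↦ g * b) ((ContinuousLinearMap.mul ℝ (Mat n)).flip b) g :=
    ((ContinuousLinearMap.mul ℝ (Mat n)).flip b).hasFDerivAt
  have h3 := ((ψ.contDiff.differentiable (by simp) (g * b)).hasFDerivAt.comp g
    h2).congr_of_eventuallyEq (f₁ := φ) (Eventually.of_forall fun g ↦ (h g).symm)
  rw [h3.fderiv, ← mul_assoc, ← neg_mul]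
  rfl

/-- The distribution sections of `L_{λ,δ}` over `U_w`. -/
def sections (lam : Fin n → ℂ) (δ : Fin n → ZMod 2) (w : GLn n) :
    Submodule ℝ 𝓓'(bigCell w, ℂ) where
  carrier := {σ | IsSection lam δ w σ}
  add_mem' {σ τ} hσ hτ b hb φ ψ h := by
    change σ ψ + τ ψ = _ * (σ φ + τ φ)
    rw [hσ b hb φ ψ h, hτ b hb φ ψ h, mul_add]
  zero_mem' b hb φ ψ h := (mul_zero _).symm
  smul_mem' c σ hσ b hb φ ψ h := by
    change c • σ ψ = _ * (c • σ φ)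
    rw [hσ b hb φ ψ h, mul_smul_comm]

/-- Right translation of a test function by an element of `B₋`. -/
theorem exists_rightTranslate {b : Mat n} (hb : b ∈ lowerBorel n) (ψ : 𝓓(bigCell w, ℝ)) :
    ∃ φ : 𝓓(bigCell w, ℝ), (∀ g, ψ (g * b) = φ g) ∧
      tsupport φ = (fun g ↦ g * b) ⁻¹' tsupport ψ := by
  obtain ⟨c, hc, h1, h2⟩ := exists_inv_mem_lowerBorel hb
  let e : Mat n ≃ₜ Mat n :=
    { toFun := fun g ↦ g * b
      invFun := fun g ↦ g * c
      left_inv := fun g ↦ by simp [mul_assoc, h1]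
      right_inv := fun g ↦ by simp [mul_assoc, h2]
      continuous_toFun := continuous_id.mul continuous_const
      continuous_invFun := continuous_id.mul continuous_const }
  have ht : tsupport (ψ ∘ e) = e ⁻¹' tsupport ψ := tsupport_comp_eq_preimage ψ e
  refine ⟨⟨ψ ∘ e, ψ.contDiff.comp (contDiff_id.mul contDiff_const),
    ψ.hasCompactSupport.comp_homeomorph e, ?_⟩, fun g ↦ rfl, ht⟩
  rw [ht]
  exact fun g hg ↦ (mul_mem_bigCell_iff hb).mp (ψ.tsupport_subset hg)

end

/-! ### The ideal of the Schubert cell and the Euler field -/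

noncomputable section

open Filter Topology

variable {n : ℕ} {w : GLn n}

/-- The coordinate `X ↦ X i j`. -/
def entryCLM (i j : Fin n) : Mat n →L[ℝ] ℝ :=
  LinearMap.toContinuousLinearMap
    { toFun := fun X ↦ X i j, map_add' := fun _ _ ↦ rfl, map_smul' := fun _ _ ↦ rfl }

@[simp]
theorem entryCLM_apply (i j : Fin n) (X : Mat n) : entryCLM i j X = X i j := rfl

/-- The elementary matrix with entry `1` in position `(k, l)`. -/
def elemMat (k l : Fin n) : Mat n := fun i j ↦ if i = k ∧ j = l then 1 else 0

theorem elemMat_entry (k l i j : Fin n) :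
    elemMat k l i j = if i = k ∧ j = l then 1 else 0 := rfl

theorem elemMat_mul_entry (k l : Fin n) (X : Mat n) (i j : Fin n) :
    (elemMat k l * X) i j = if i = k then X l j else 0 := by
  rw [mul_entry, Finset.sum_eq_single l]
  · simp [elemMat_entry]
  · intro s _ hs
    simp [elemMat_entry, hs]
  · simp

theorem eq_sum_smul_elemMat (X : Mat n) : X = ∑ k, ∑ l, X k l • elemMat k l := by
  refine mat_ext fun i j ↦ ?_
  have h : entryCLM i j (∑ k, ∑ l, X k l • elemMat k l) = X i j := by
    simp only [map_sum, map_smul, entryCLM_apply, elemMat_entry, smul_eq_mul]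
    rw [Finset.sum_eq_single i, Finset.sum_eq_single j] <;> simp +contextual [eq_comm]
  exact h.symm

theorem elemMat_mem_rootSpace {r : Equiv.Perm (Fin n)} {k l : Fin n} (h : r k < r l) :
    elemMat k l ∈ rootSpace r := by
  intro i j hij
  rw [elemMat_entry, if_neg]
  rintro ⟨rfl, rfl⟩
  exact h.not_ge hij

theorem elemMat_mem_nMinus {k l : Fin n} (h : l < k) : elemMat k l ∈ nMinus n := by
  intro i j hij
  rw [elemMat_entry, if_neg]
  rintro ⟨rfl, rfl⟩
  exact h.not_ge hij

theorem elemMat_mem_nPlus {k l : Fin n} (h : k < l) : elemMat k l ∈ nPlus n := by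
  intro i j hij
  rw [elemMat_entry, if_neg]
  rintro ⟨rfl, rfl⟩
  exact h.not_ge hij

/-- The matrix entries of `nu`, as smooth functions on `U_w`. -/
def nuEntry (w : GLn n) (i j : Fin n) : smoothAlg w :=
  ⟨fun g ↦ nu w g i j, (entryCLM i j).contDiff.comp_contDiffOn (contDiffOn_nu w),
    fun _ hg _ hb ↦ congrArg (fun X : Mat n ↦ X i j) (nu_mul_right hg hb)⟩

theorem fderiv_nuEntry (i j : Fin n) {g : Mat n} (hg : g ∈ bigCell w) (v : Mat n) :
    fderiv ℝ (nuEntry w i j) g v = (fderiv ℝ (nu w) g v) i j := by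
  have h : HasFDerivAt (nuEntry w i j) ((entryCLM i j).comp (fderiv ℝ (nu w) g)) g :=
    (entryCLM i j).hasFDerivAt.comp g (hasFDerivAt_nu hg)
  rw [h.fderiv]
  rfl

/-- The ideal of the Schubert cell, generated by the entries of `nu` below the diagonal. -/
def cellIdeal (w : GLn n) : Ideal (smoothAlg w) :=
  Ideal.span (Set.range fun p : {p : Fin n × Fin n // p.2 < p.1} ↦ nuEntry w p.1.1 p.1.2)

theorem cellIdeal_fg (w : GLn n) : (cellIdeal w).FG :=
  Submodule.fg_span (Set.finite_range _)

theorem nuEntry_mem_cellIdeal {i j : Fin n} (h : j < i) : nuEntry w i j ∈ cellIdeal w :=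
  Ideal.subset_span ⟨⟨(i, j), h⟩, rfl⟩

/-- The vector fields generated by `rootSpace r`, evaluated at entries of `nu`. -/
theorem MonomialData.leftDeriv_nuEntry (m : MonomialData w) {Y : Mat n} (hY : Y ∈ rootSpace m.perm)
    (i j : Fin n) {g : Mat n} (hg : g ∈ bigCell w) :
    leftDeriv w Y (nuEntry w i j) g = -(Y * nu w g) i j := by
  rw [leftDeriv_apply _ _ hg, map_neg, fderiv_nuEntry i j hg, m.fderiv_nu_mul_left hg hY]

theorem MonomialData.apply_eq_zero_of_mem_cellIdeal (m : MonomialData w) {a : smoothAlg w}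
    (ha : a ∈ cellIdeal w) {g : Mat n} (hg : g ∈ schubertCell w) : a g = 0 := by
  induction ha using Submodule.span_induction with
  | mem x hx =>
    obtain ⟨p, rfl⟩ := hx
    exact (m.mem_schubertCell_iff.mp hg).2.1 _ _ p.2
  | zero => rfl
  | add x y _ _ hx hy =>
    change x g + y g = 0
    rw [hx, hy, add_zero]
  | smul c x _ hx =>
    change c g * x g = 0
    rw [hx, mul_zero]

namespace MonomialData

/-- The existence of an Euler field `∑ z_{kl} ℓ(E_{kl})`, with coefficients in the ideal of the
Schubert cell and `E_{kl}` in `𝔫₋ ∩ w 𝔫 w⁻¹`, which acts as the identity on the conormal bundle of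
the cell. Since `ℓ(Y) ν = -Y ν` for `ν = nu`, this means that `z ν` and `-ν` have the same entries below
the diagonal, modulo the square of the ideal. If `ν = L + R` is the splitting into a strictly lower
and an upper triangular matrix, one takes for `-z` the strictly lower triangular part of `L R⁻¹`:
then `z R` has the same entries as `-L` below the diagonal, and the entries of `z L` are in the
square of the ideal. -/
theorem exists_euler_coefficients (m : MonomialData w) :
    ∃ z : Fin n → Fin n → smoothAlg w,
      (∀ k l, z k l ∈ cellIdeal w) ∧
      (∀ k l, ¬ (l < k ∧ m.perm k < m.perm l) → z k l = 0) ∧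
      ∀ i j, j < i → (∑ k, ∑ l, z k l * leftDeriv w (elemMat k l) (nuEntry w i j)) -
        nuEntry w i j ∈ cellIdeal w ^ 2 := by
  let V : Matrix (Fin n) (Fin n) (smoothAlg w) := Matrix.of (nuEntry w)
  let L : Matrix (Fin n) (Fin n) (smoothAlg w) := Matrix.of fun i j ↦ if j < i then V i j else 0
  let R : Matrix (Fin n) (Fin n) (smoothAlg w) := Matrix.of fun i j ↦ if j < i then 0 else V i j
  have hLR : V = L + R := by
    ext1 i j
    change V i j = (if j < i then V i j else 0) + (if j < i then 0 else V i j)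
    split_ifs <;> simp
  have hVr : V.BlockTriangular m.perm := fun i j hij ↦
    smoothAlg_ext fun g ↦ (m.nu_mem g).1 i j hij
  have hRr : R.BlockTriangular m.perm := fun i j hij ↦ by
    change (if j < i then 0 else V i j) = 0
    rw [hVr hij, ite_self]
  have hLr : L.BlockTriangular m.perm := fun i j hij ↦ by
    change (if j < i then V i j else 0) = 0
    rw [hVr hij, ite_self]
  have hRi : R.BlockTriangular id := fun i j hij ↦ if_pos hij
  have hdet : R.det = 1 := by
    rw [Matrix.det_of_isUpperTriangular hRi]
    refine Finset.prod_eq_one fun i _ ↦ ?_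
    change (if i < i then 0 else V i i) = 1
    rw [if_neg (lt_irrefl i)]
    exact smoothAlg_ext fun g ↦ (m.nu_mem g).2 i
  have hunit : IsUnit R.det := by rw [hdet]; exact isUnit_one
  have : Invertible R := Matrix.invertibleOfIsUnitDet R hunit
  let Q := L * R⁻¹
  have hQr : Q.BlockTriangular m.perm :=
    hLr.mul (Matrix.blockTriangular_inv_of_blockTriangular hRr)
  have hQR : Q * R = L := Matrix.nonsing_inv_mul_cancel_right R L hunit
  have hLI : ∀ i j, L i j ∈ cellIdeal w := by
    intro i j
    change (if j < i then V i j else 0) ∈ cellIdeal w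
    split_ifs with h
    · exact nuEntry_mem_cellIdeal h
    · exact zero_mem _
  have hQI : ∀ i j, Q i j ∈ cellIdeal w := by
    intro i j
    change (L * R⁻¹) i j ∈ _
    rw [Matrix.mul_apply]
    exact sum_mem fun k _ ↦ Ideal.mul_mem_right _ _ (hLI i k)
  let l : Matrix (Fin n) (Fin n) (smoothAlg w) := Matrix.of fun i j ↦ if j < i then Q i j else 0
  let u : Matrix (Fin n) (Fin n) (smoothAlg w) := Matrix.of fun i j ↦ if j < i then 0 else Q i j
  have hlu : Q = l + u := by
    ext1 i j
    change Q i j = (if j < i then Q i j else 0) + (if j < i then 0 else Q i j)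
    split_ifs <;> simp
  have hui : u.BlockTriangular id := fun i j hij ↦ if_pos hij
  have hlI : ∀ i j, l i j ∈ cellIdeal w := by
    intro i j
    change (if j < i then Q i j else 0) ∈ cellIdeal w
    split_ifs
    · exact hQI i j
    · exact zero_mem _
  have hlR : ∀ i j, j < i → (l * R) i j = V i j := by
    intro i j hij
    have h1 : (Q * R) i j = (l * R) i j + (u * R) i j := by rw [hlu, add_mul]; rfl
    rw [hui.mul hRi hij, add_zero, hQR] at h1
    rw [← h1]
    exact if_pos hij
  have hl0 : ∀ i j, ¬ (j < i ∧ m.perm i < m.perm j) → l i j = 0 := by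
    intro i j h
    change (if j < i then Q i j else 0) = 0
    split_ifs with hij
    · refine hQr ((le_of_not_gt fun h' ↦ h ⟨hij, h'⟩).lt_of_ne fun h' ↦ ?_)
      exact hij.ne (m.perm.injective h')
    · rfl
  have hout : ∀ i j g, g ∉ bigCell w → l i j g = 0 := by
    intro i j g hg
    change ((if j < i then Q i j else 0 : smoothAlg w) : Mat n → ℝ) g = 0
    split_ifs
    · have h1 : Q i j g = ∑ k, L i k g * (R⁻¹ k j) g := smoothAlg_sum_apply _ _ g
      rw [h1]
      refine Finset.sum_eq_zero fun k _ ↦ ?_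
      have h2 : L i k g = 0 := by
        change ((if k < i then V i k else 0 : smoothAlg w) : Mat n → ℝ) g = 0
        split_ifs with hk
        · change nu w g i k = 0
          rw [nu_of_notMem hg, one_entry, if_neg hk.ne']
        · rfl
      rw [h2, zero_mul]
    · rfl
  refine ⟨fun k j ↦ -l k j, fun k j ↦ neg_mem (hlI k j), fun k j h ↦ ?_, fun i j hij ↦ ?_⟩
  · change -l k j = 0
    rw [hl0 k j h, neg_zero]
  have hterm : ∀ k s, -l k s * leftDeriv w (elemMat k s) (nuEntry w i j) =
      if k = i then l k s * V s j else 0 := by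
    intro k s
    by_cases hks : s < k ∧ m.perm k < m.perm s
    · refine smoothAlg_ext fun g ↦ ?_
      change -(l k s g) * leftDeriv w (elemMat k s) (nuEntry w i j) g = _
      by_cases hg : g ∈ bigCell w
      · rw [m.leftDeriv_nuEntry (elemMat_mem_rootSpace hks.2) i j hg, elemMat_mul_entry]
        by_cases hik : i = k
        · subst hik
          rw [if_pos rfl, if_pos rfl, neg_mul_neg]
          rfl
        · rw [if_neg hik, if_neg (Ne.symm hik), neg_zero, mul_zero]
          rfl
      · rw [hout k s g hg, neg_zero, zero_mul]
        split_ifs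
        · change 0 = l k s g * V s j g
          rw [hout k s g hg, zero_mul]
        · rfl
    · rw [hl0 k s hks]
      simp
  have hsum : (∑ k, ∑ s, -l k s * leftDeriv w (elemMat k s) (nuEntry w i j)) = (l * V) i j := by
    simp only [hterm]
    rw [Finset.sum_eq_single i]
    · simp only [if_true]
      rfl
    · intro k _ hk
      simp [hk]
    · simp
  rw [hsum, hLR, mul_add]
  change (l * L) i j + (l * R) i j - nuEntry w i j ∈ _
  rw [hlR i j hij]
  change (l * L) i j + nuEntry w i j - nuEntry w i j ∈ _
  rw [add_sub_cancel_right, pow_two]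
  rw [Matrix.mul_apply]
  exact sum_mem fun k _ ↦ Ideal.mul_mem_mul (hlI i k) (hLI k j)

end MonomialData

/-- If a vector field with coefficients `z` in an ideal `I` acts as the identity on `I / I²`, then
it acts as multiplication by `d` on `I ^ d / I ^ (d + 1)`. -/
theorem nsmul_sub_derivation_mem_pow {A ι : Type*} [CommRing A] [Algebra ℝ A] [Fintype ι]
    (I : Ideal A) (z : ι → A) (D : ι → Derivation ℝ A A) (hz : ∀ i, z i ∈ I)
    (h : ∀ a ∈ I, (∑ i, z i * D i a) - a ∈ I ^ 2) (d : ℕ) (x : A) (hx : x ∈ I ^ d) :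
    (d : A) * x - ∑ i, z i * D i x ∈ I ^ (d + 1) := by
  have hE : ∀ x, ∑ i, z i * D i x ∈ I := fun x ↦ sum_mem fun i _ ↦ Ideal.mul_mem_right _ _ (hz i)
  have hmul : ∀ a b, ∑ i, z i * D i (a * b) = a * ∑ i, z i * D i b + b * ∑ i, z i * D i a := by
    intro a b
    rw [Finset.mul_sum, Finset.mul_sum, ← Finset.sum_add_distrib]
    refine Finset.sum_congr rfl fun i _ ↦ ?_
    rw [Derivation.leibniz, smul_eq_mul, smul_eq_mul]
    ring
  induction d generalizing x with
  | zero =>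
    rw [Nat.cast_zero, zero_mul, zero_sub, zero_add, pow_one]
    exact neg_mem (hE x)
  | succ d ih =>
    rw [pow_succ] at hx
    refine Submodule.mul_induction_on hx (fun a ha b hb ↦ ?_) fun x y hx hy ↦ ?_
    · have e : ((d + 1 : ℕ) : A) * (a * b) - ∑ i, z i * D i (a * b) =
          b * ((d : A) * a - ∑ i, z i * D i a) - a * ((∑ i, z i * D i b) - b) := by
        rw [hmul]
        push_cast
        ring
      rw [e]
      refine sub_mem ?_ ?_
      · rw [pow_succ' I (d + 1)]
        exact Ideal.mul_mem_mul hb (ih a ha)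
      · rw [show d + 1 + 1 = d + 2 from rfl, pow_add]
        exact Ideal.mul_mem_mul ha (h b hb)
    · have e : ((d + 1 : ℕ) : A) * (x + y) - ∑ i, z i * D i (x + y) =
          (((d + 1 : ℕ) : A) * x - ∑ i, z i * D i x) +
            (((d + 1 : ℕ) : A) * y - ∑ i, z i * D i y) := by
        simp only [map_add, mul_add, Finset.sum_add_distrib]
        ring
      rw [e]
      exact add_mem hx hy

end

/-! ### Test functions which vanish on the Schubert cell -/

noncomputable section

open Filter Topology

variable {n : ℕ} {w : GLn n}

/-- The strictly lower triangular part of a matrix. -/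
def strictLowerPart (n : ℕ) : Mat n →L[ℝ] Mat n :=
  LinearMap.toContinuousLinearMap
    { toFun := fun X ↦ fun i j ↦ if j < i then X i j else 0
      map_add' := fun X Y ↦ mat_ext fun i j ↦ by
        change (if j < i then (X + Y) i j else 0 : ℝ) =
          (if j < i then X i j else 0) + (if j < i then Y i j else 0)
        split_ifs <;> simp [add_entry]
      map_smul' := fun c X ↦ mat_ext fun i j ↦ by
        change (if j < i then (c • X) i j else 0 : ℝ) = c * (if j < i then X i j else 0)
        split_ifs <;> simp [smul_entry] }

theorem strictLowerPart_entry (X : Mat n) (i j : Fin n) :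
    strictLowerPart n X i j = if j < i then X i j else 0 := rfl

/-- The segment in `U_w` from a point of the Schubert cell (`s = 0`) to `g` (`s = 1`), along which
the entries of `nu` below the diagonal are scaled by `s`. -/
def cellPath (w : GLn n) (g : Mat n) (s : ℝ) : Mat n :=
  (nu w g + (s - 1) • strictLowerPart n (nu w g)) * (Ring.inverse (nu w g) * g)

theorem MonomialData.isUnit_nu (m : MonomialData w) (g : Mat n) : IsUnit (nu w g) := by
  obtain ⟨v, -, h1, h2⟩ := exists_inv_mem_rootGroup (m.nu_mem g)
  exact ⟨⟨nu w g, v, h1, h2⟩, rfl⟩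

theorem MonomialData.contDiffOn_inverse_nu_mul (m : MonomialData w) :
    ContDiffOn ℝ ∞ (fun g ↦ Ring.inverse (nu w g) * g) (bigCell w) := by
  intro g hg
  obtain ⟨u, hu⟩ := m.isUnit_nu g
  have h : ContDiffAt ℝ ∞ Ring.inverse (nu w g) := hu ▸ contDiffAt_ringInverse ℝ u
  exact (h.comp_contDiffWithinAt g (contDiffOn_nu w g hg)).mul contDiffWithinAt_id

theorem MonomialData.contDiffOn_cellPath (m : MonomialData w) :
    ContDiffOn ℝ ∞ (fun p : Mat n × ℝ ↦ cellPath w p.1 p.2)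
      ((bigCell w : Set (Mat n)) ×ˢ Set.univ) := by
  have hfst : ContDiffOn ℝ ∞ (Prod.fst : Mat n × ℝ → Mat n)
      ((bigCell w : Set (Mat n)) ×ˢ Set.univ) := contDiff_fst.contDiffOn
  have hmaps : Set.MapsTo (Prod.fst : Mat n × ℝ → Mat n)
      ((bigCell w : Set (Mat n)) ×ˢ Set.univ) (bigCell w) := fun p hp ↦ hp.1
  have h1 := (contDiffOn_nu w).comp hfst hmaps
  have h2 := m.contDiffOn_inverse_nu_mul.comp hfst hmaps
  have h3 : ContDiffOn ℝ ∞ (fun p : Mat n × ℝ ↦ p.2 - 1)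
      ((bigCell w : Set (Mat n)) ×ˢ Set.univ) := (contDiff_snd.sub contDiff_const).contDiffOn
  exact (h1.add (h3.smul ((strictLowerPart n).contDiff.comp_contDiffOn h1))).mul h2

theorem MonomialData.cellPath_one (m : MonomialData w) (g : Mat n) : cellPath w g 1 = g := by
  rw [cellPath, sub_self, zero_smul, add_zero, ← mul_assoc,
    Ring.mul_inverse_cancel _ (m.isUnit_nu g), one_mul]

theorem MonomialData.cellPath_zero_mem (m : MonomialData w) {g : Mat n} (hg : g ∈ bigCell w) :
    cellPath w g 0 ∈ schubertCell w := by
  obtain ⟨b, hb, hgb⟩ := exists_eq_nu_mul hg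
  refine ⟨nu w g + (0 - 1 : ℝ) • strictLowerPart n (nu w g), ⟨fun i j hij ↦ ?_, fun i ↦ ?_⟩,
    b, hb, ?_⟩
  · rw [add_entry, smul_entry, strictLowerPart_entry, if_pos hij]
    ring
  · rw [add_entry, smul_entry, strictLowerPart_entry, if_neg (lt_irrefl i), mul_zero, add_zero]
    exact (m.nu_mem g).2 i
  · have h : Ring.inverse (nu w g) * g = (w : Mat n) * b := by
      nth_rewrite 2 [hgb]
      rw [mul_assoc, ← mul_assoc (Ring.inverse _), Ring.inverse_mul_cancel _ (m.isUnit_nu g),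
        one_mul]
    rw [cellPath, h, mul_assoc _ (w : Mat n)]

theorem hasDerivAt_cellPath (g : Mat n) (s : ℝ) :
    HasDerivAt (cellPath w g) (strictLowerPart n (nu w g) * (Ring.inverse (nu w g) * g)) s := by
  have h := ((((hasDerivAt_id s).sub_const 1).smul_const
    (strictLowerPart n (nu w g))).const_add (nu w g)).mul_const (Ring.inverse (nu w g) * g)
  rwa [one_smul] at h

theorem strictLowerPart_eq_sum (X : Mat n) :
    strictLowerPart n X = ∑ p : {p : Fin n × Fin n // p.2 < p.1}, X p.1.1 p.1.2 •
      elemMat p.1.1 p.1.2 := by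
  refine mat_ext fun i j ↦ ?_
  have h : entryCLM i j (∑ p : {p : Fin n × Fin n // p.2 < p.1}, X p.1.1 p.1.2 •
      elemMat p.1.1 p.1.2) = strictLowerPart n X i j := by
    simp only [map_sum, map_smul, entryCLM_apply, elemMat_entry, smul_eq_mul]
    rw [strictLowerPart_entry]
    split_ifs with hij
    · rw [Finset.sum_eq_single ⟨(i, j), hij⟩]
      · simp
      · rintro ⟨⟨k, l⟩, hp⟩ - hne
        rw [if_neg, mul_zero]
        rintro ⟨rfl, rfl⟩
        exact hne rfl
      · simp
    · refine Finset.sum_eq_zero fun p _ ↦ ?_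
      rw [if_neg, mul_zero]
      rintro ⟨rfl, rfl⟩
      exact hij p.2
  exact h.symm

/-- A test function which vanishes on the Schubert cell is a combination of the entries of `nu`
below the diagonal, with test functions as coefficients (Hadamard's lemma). -/
theorem MonomialData.exists_eq_sum_mulTest (m : MonomialData w) (φ : 𝓓(bigCell w, ℝ))
    (hφ : ∀ g ∈ schubertCell w, φ g = 0) :
    ∃ ψ : {p : Fin n × Fin n // p.2 < p.1} → 𝓓(bigCell w, ℝ),
      φ = ∑ p, mulTest (nuEntry w p.1.1 p.1.2).2.1 (ψ p) := by
  let h : Fin n × Fin n → Mat n → ℝ → ℝ := fun p g s ↦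
    fderiv ℝ φ (cellPath w g s) (elemMat p.1 p.2 * (Ring.inverse (nu w g) * g))
  have hh : ∀ p, ContDiffOn ℝ ∞ (fun q : Mat n × ℝ ↦ h p q.1 q.2)
      ((bigCell w : Set (Mat n)) ×ˢ Set.univ) := by
    intro p
    have h1 : ContDiff ℝ ∞ (fderiv ℝ φ) := φ.contDiff.fderiv_right (by simp)
    have h2 := m.contDiffOn_inverse_nu_mul.comp
      (contDiff_fst.contDiffOn : ContDiffOn ℝ ∞ (Prod.fst : Mat n × ℝ → Mat n)
        ((bigCell w : Set (Mat n)) ×ˢ Set.univ)) (fun q hq ↦ hq.1)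
    exact (h1.comp_contDiffOn m.contDiffOn_cellPath).clm_apply (contDiffOn_const.mul h2)
  have hint : ∀ g ∈ bigCell w, φ g = ∑ p : {p : Fin n × Fin n // p.2 < p.1},
      nu w g p.1.1 p.1.2 * ∫ s in (0 : ℝ)..1, h p.1 g s := by
    intro g hg
    have hc : ∀ p, Continuous (h p g) := fun p ↦ by
      have : Continuous fun s : ℝ ↦ (g, s) := by fun_prop
      exact (hh p).continuousOn.comp_continuous this fun s ↦ ⟨hg, trivial⟩
    have hd : ∀ s : ℝ, HasDerivAt (fun s ↦ φ (cellPath w g s))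
        (∑ p : {p : Fin n × Fin n // p.2 < p.1}, nu w g p.1.1 p.1.2 * h p.1 g s) s := by
      intro s
      have h1 := ((φ.contDiff.differentiable (by simp)
        (cellPath w g s)).hasFDerivAt).comp_hasDerivAt s (hasDerivAt_cellPath (w := w) g s)
      have e : fderiv ℝ φ (cellPath w g s)
          (strictLowerPart n (nu w g) * (Ring.inverse (nu w g) * g)) =
          ∑ p : {p : Fin n × Fin n // p.2 < p.1}, nu w g p.1.1 p.1.2 * h p.1 g s := by
        rw [strictLowerPart_eq_sum, Finset.sum_mul, map_sum]
        refine Finset.sum_congr rfl fun p _ ↦ ?_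
        rw [smul_mul_assoc, map_smul, smul_eq_mul]
      rw [← e]
      exact h1
    have hcs : Continuous fun s ↦ ∑ p : {p : Fin n × Fin n // p.2 < p.1},
        nu w g p.1.1 p.1.2 * h p.1 g s :=
      continuous_finsetSum _ fun p _ ↦ continuous_const.mul (hc p.1)
    have h2 := intervalIntegral.integral_eq_sub_of_hasDerivAt (fun s _ ↦ hd s)
      (hcs.intervalIntegrable 0 1)
    rw [m.cellPath_one, hφ _ (m.cellPath_zero_mem hg), sub_zero] at h2
    rw [← h2, intervalIntegral.integral_finsetSum fun p _ ↦
      (continuous_const.mul (hc p.1)).intervalIntegrable 0 1]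
    simp only [intervalIntegral.integral_const_mul]
  obtain ⟨c, V, -, hV, hc⟩ := exists_testFunction_eq_one φ.hasCompactSupport φ.tsupport_subset
  refine ⟨fun p ↦ mulTest (contDiffOn_integral_zero_one (hh p.1)) c, ?_⟩
  ext g
  have hsum : (∑ p : {p : Fin n × Fin n // p.2 < p.1}, mulTest (nuEntry w p.1.1 p.1.2).2.1
      (mulTest (contDiffOn_integral_zero_one (hh p.1)) c)) g =
      ∑ p : {p : Fin n × Fin n // p.2 < p.1},
        nu w g p.1.1 p.1.2 * ((∫ s in (0 : ℝ)..1, h p.1 g s) * c g) := by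
    rw [_root_.sum_apply]
    rfl
  rw [hsum]
  by_cases hg : g ∈ bigCell w
  · simp only [← mul_assoc]
    rw [← Finset.sum_mul, ← hint g hg]
    by_cases hgφ : g ∈ tsupport φ
    · rw [hc g (hV hgφ), mul_one]
    · rw [image_eq_zero_of_notMem_tsupport hgφ, zero_mul]
  · rw [testFunction_eq_zero_of_notMem φ hg, testFunction_eq_zero_of_notMem c hg]
    simp

theorem MonomialData.mem_normalDegreeZero_of_smul_eq_zero (m : MonomialData w) {lam : Fin n → ℂ}
    {δ : Fin n → ZMod 2} {σ : 𝓓'(bigCell w, ℂ)} (hσ : σ ∈ sections lam δ w)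
    (h : ∀ x ∈ cellIdeal w, x • σ = 0) : σ ∈ normalDegreeZero lam δ w := by
  refine ⟨hσ, fun φ ψ hφψ ↦ ?_⟩
  obtain ⟨χ, hχ⟩ := m.exists_eq_sum_mulTest (φ - ψ) fun g hg ↦ sub_eq_zero.mpr (hφψ g hg)
  rw [← sub_eq_zero, ← map_sub, hχ, map_sum]
  refine Finset.sum_eq_zero fun p _ ↦ ?_
  have h1 := h _ (nuEntry_mem_cellIdeal p.2)
  exact DFunLike.congr_fun h1 (χ p)

/-! ### Lowering the order with the Euler field -/

theorem ell_mem_normalFiltration {lam : Fin n → ℂ} {δ : Fin n → ZMod 2} {d : ℕ} {Y : Mat n}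
    (hY : Y ∈ nMinus n ⊓ conjLie w (nPlus n)) {σ : 𝓓'(bigCell w, ℂ)}
    (hσ : σ ∈ normalFiltration lam δ w d) : ell w Y σ ∈ normalFiltration lam δ w (d + 1) := by
  refine Submodule.mem_sup_right ?_
  refine Submodule.mem_iSup_of_mem Y (Submodule.mem_iSup_of_mem hY ?_)
  exact ⟨σ, hσ, rfl⟩

theorem normalFiltration_le_succ {lam : Fin n → ℂ} {δ : Fin n → ZMod 2} {d : ℕ} :
    normalFiltration lam δ w d ≤ normalFiltration lam δ w (d + 1) := le_sup_left

/-- The Euler field lowers the order of a distribution section along the cell, which reduces the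
order to zero: if `I ^ (d + 1) σ = 0`, then `d σ + ∑ ℓ(E_{kl}) z_{kl} σ` and `z_{kl} σ` are killed
by `I ^ d`. -/
theorem MonomialData.mem_normalFiltration_of_pow_smul (m : MonomialData w) {lam : Fin n → ℂ}
    {δ : Fin n → ZMod 2} (d : ℕ) {σ : 𝓓'(bigCell w, ℂ)} (hσ : σ ∈ sections lam δ w)
    (hk : ∀ x ∈ cellIdeal w ^ (d + 1), x • σ = 0) : σ ∈ normalFiltration lam δ w d := by
  obtain ⟨z, hzI, hz0, hzE⟩ := m.exists_euler_coefficients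
  let z' : Fin n × Fin n → smoothAlg w := fun p ↦ z p.1 p.2
  let D : Fin n × Fin n → Derivation ℝ (smoothAlg w) (smoothAlg w) :=
    fun p ↦ leftDeriv w (elemMat p.1 p.2)
  have hz'I : ∀ p, z' p ∈ cellIdeal w := fun p ↦ hzI p.1 p.2
  have hE : ∀ a ∈ cellIdeal w, (∑ p, z' p * D p a) - a ∈ cellIdeal w ^ 2 := by
    intro a ha
    induction ha using Submodule.span_induction with
    | mem x hx =>
      obtain ⟨p, rfl⟩ := hx
      rw [Fintype.sum_prod_type]
      exact hzE _ _ p.2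
    | zero => simp
    | add x y _ _ hx hy =>
      have e : (∑ p, z' p * D p (x + y)) - (x + y) =
          ((∑ p, z' p * D p x) - x) + ((∑ p, z' p * D p y) - y) := by
        simp only [map_add, mul_add, Finset.sum_add_distrib]
        ring
      rw [e]
      exact add_mem hx hy
    | smul c x hx hx' =>
      have e : (∑ p, z' p * D p (c • x)) - c • x =
          c * ((∑ p, z' p * D p x) - x) + x * ∑ p, z' p * D p c := by
        rw [mul_sub, Finset.mul_sum, Finset.mul_sum, sub_add_eq_add_sub, ← Finset.sum_add_distrib,
          smul_eq_mul]
        congr 1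
        refine Finset.sum_congr rfl fun p _ ↦ ?_
        rw [Derivation.leibniz, smul_eq_mul, smul_eq_mul]
        ring
      rw [e]
      refine add_mem (Ideal.mul_mem_left _ _ hx') ?_
      rw [pow_two]
      exact Ideal.mul_mem_mul hx (sum_mem fun p _ ↦ Ideal.mul_mem_right _ _ (hz'I p))
  induction d generalizing σ with
  | zero =>
    exact m.mem_normalDegreeZero_of_smul_eq_zero hσ fun x hx ↦ hk x (by rwa [zero_add, pow_one])
  | succ d ih =>
    have hterm : ∀ p, z' p • σ ∈ normalFiltration lam δ w d := by
      refine fun p ↦ ih (IsSection.smul hσ _) fun x hx ↦ ?_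
      rw [← mul_smul]
      refine hk _ ?_
      rw [pow_succ]
      exact Ideal.mul_mem_mul hx (hz'I p)
    have hell : ∀ p, ell w (elemMat p.1 p.2) (z' p • σ) ∈ normalFiltration lam δ w (d + 1) := by
      intro p
      by_cases hp : p.2 < p.1 ∧ m.perm p.1 < m.perm p.2
      · refine ell_mem_normalFiltration ⟨elemMat_mem_nMinus hp.1, ?_⟩ (hterm p)
        rw [m.conjLie_nPlus]
        exact elemMat_mem_rootSpace hp.2
      · have hzero : z' p = 0 := hz0 p.1 p.2 hp
        rw [hzero, zero_smul (smoothAlg w) σ, map_zero]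
        exact zero_mem _
    set P := ((d : ℝ) + 1) • σ + ∑ p, ell w (elemMat p.1 p.2) (z' p • σ) with hP
    have hPs : P ∈ sections lam δ w :=
      add_mem (Submodule.smul_mem _ _ hσ)
        (sum_mem fun p _ ↦ (IsSection.smul hσ (z' p)).ell (elemMat p.1 p.2))
    have hcast : ((d : ℝ) + 1) • σ = ((d + 1 : ℕ) : smoothAlg w) • σ := by
      rw [Nat.cast_smul_eq_nsmul (smoothAlg w), ← Nat.cast_smul_eq_nsmul ℝ]
      push_cast
      rfl
    have hPk : ∀ x ∈ cellIdeal w ^ (d + 1), x • P = 0 := by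
      intro x hx
      have h1 : ∀ p, x • ell w (elemMat p.1 p.2) (z' p • σ) = -((z' p * D p x) • σ) := by
        intro p
        have h2 := ell_smul (elemMat p.1 p.2) x (z' p • σ)
        have h3 : x • z' p • σ = 0 := by
          rw [← mul_smul]
          refine hk _ ?_
          rw [pow_succ]
          exact Ideal.mul_mem_mul hx (hz'I p)
        rw [h3, map_zero, ← mul_smul, mul_comm] at h2
        exact (neg_eq_of_add_eq_zero_right h2.symm).symm
      rw [hP, smul_add, Finset.smul_sum, hcast, ← mul_smul]
      simp only [h1]
      rw [Finset.sum_neg_distrib, ← Finset.sum_smul, ← sub_eq_add_neg, ← sub_smul, mul_comm x]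
      exact hk _ (nsmul_sub_derivation_mem_pow _ z' D hz'I hE (d + 1) x hx)
    have hPm := normalFiltration_le_succ (ih hPs hPk)
    have hfin : ((d : ℝ) + 1) • σ ∈ normalFiltration lam δ w (d + 1) := by
      have e := eq_sub_of_add_eq hP.symm
      rw [e]
      exact sub_mem hPm (sum_mem fun p _ ↦ hell p)
    exact (Submodule.smul_mem_iff _ (by positivity)).mp hfin

end

/-! ### The order of vanishing of test functions along the Schubert cell -/

noncomputable section

open Filter Topology

variable {n : ℕ} {w : GLn n}

/-- The derivative along `N`-orbits of a function which vanishes on the Schubert cell. -/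
theorem fderiv_mul_eq_zero_of_schubertCell {f : Mat n → ℝ} {g X : Mat n}
    (hf : DifferentiableAt ℝ f g) (hf0 : ∀ x ∈ schubertCell w, f x = 0)
    (hg : g ∈ schubertCell w) (hX : X ∈ nPlus n) : fderiv ℝ f g (X * g) = 0 := by
  have h1 : HasDerivAt (fun t : ℝ ↦ (1 + t • X) * g) (X * g) 0 := by
    simpa using hasDerivAt_mul_one_add_smul_mul 1 X g
  have h2 : HasFDerivAt f (fderiv ℝ f g) ((1 + (0 : ℝ) • X) * g) := by
    simpa using hf.hasFDerivAt
  have h3 := h2.comp_hasDerivAt (0 : ℝ) h1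
  have h4 : (f ∘ fun t : ℝ ↦ (1 + t • X) * g) = fun _ ↦ 0 := by
    funext t
    refine hf0 _ ?_
    obtain ⟨u, hu, b, hb, rfl⟩ := hg
    refine ⟨(1 + t • X) * u, upperUnipotent_mul ?_ hu, b, hb, ?_⟩
    · exact one_add_mem_rootGroup (r := Equiv.refl _) ((nPlus n).smul_mem t hX)
    · simp only [mul_assoc]
  rw [h4] at h3
  exact h3.unique (hasDerivAt_const _ _)

/-- The test functions which vanish to order `d` along the Schubert cell: all their derivatives
`ℓ(Y₁) ⋯ ℓ(Yₖ)` of order `k < d` with `Yᵢ ∈ 𝔫₋ ∩ w 𝔫 w⁻¹` vanish on the cell. -/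
def vanishingOrder (w : GLn n) : ℕ → Submodule ℝ 𝓓(bigCell w, ℝ)
  | 0 => ⊤
  | d + 1 =>
    { carrier := {φ | (∀ g ∈ schubertCell w, φ g = 0) ∧
        ∀ Y ∈ nMinus n ⊓ conjLie w (nPlus n), leftTest w Y φ ∈ vanishingOrder w d}
      add_mem' := fun {φ ψ} hφ hψ ↦ ⟨fun g hg ↦ by
          change φ g + ψ g = 0
          rw [hφ.1 g hg, hψ.1 g hg, add_zero],
        fun Y hY ↦ by rw [map_add]; exact add_mem (hφ.2 Y hY) (hψ.2 Y hY)⟩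
      zero_mem' := ⟨fun _ _ ↦ rfl, fun Y _ ↦ by rw [map_zero]; exact zero_mem _⟩
      smul_mem' := fun c φ hφ ↦ ⟨fun g hg ↦ by
          change c * φ g = 0
          rw [hφ.1 g hg, mul_zero],
        fun Y hY ↦ by rw [map_smul]; exact Submodule.smul_mem _ _ (hφ.2 Y hY)⟩ }

theorem vanishingOrder_succ_le (d : ℕ) : vanishingOrder w (d + 1) ≤ vanishingOrder w d := by
  induction d with
  | zero => exact fun _ _ ↦ Submodule.mem_top
  | succ d ih => exact fun φ hφ ↦ ⟨hφ.1, fun Y hY ↦ ih (hφ.2 Y hY)⟩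

theorem mulTest_mem_vanishingOrder (d : ℕ) (a : smoothAlg w) {φ : 𝓓(bigCell w, ℝ)}
    (hφ : φ ∈ vanishingOrder w d) : mulTest a.2.1 φ ∈ vanishingOrder w d := by
  induction d generalizing a φ with
  | zero => exact Submodule.mem_top
  | succ d ih =>
    refine ⟨fun g hg ↦ by rw [mulTest_apply, hφ.1 g hg, mul_zero], fun Y hY ↦ ?_⟩
    rw [leftTest_mulTest]
    exact add_mem (ih _ (vanishingOrder_succ_le d hφ)) (ih _ (hφ.2 Y hY))

theorem mulTest_mem_vanishingOrder_succ (d : ℕ) {a : smoothAlg w}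
    (ha : ∀ g ∈ schubertCell w, a g = 0) {φ : 𝓓(bigCell w, ℝ)}
    (hφ : φ ∈ vanishingOrder w d) : mulTest a.2.1 φ ∈ vanishingOrder w (d + 1) := by
  induction d generalizing φ with
  | zero => exact ⟨fun g hg ↦ by rw [mulTest_apply, ha g hg, zero_mul], fun _ _ ↦ Submodule.mem_top⟩
  | succ d ih =>
    refine ⟨fun g hg ↦ by rw [mulTest_apply, ha g hg, zero_mul], fun Y hY ↦ ?_⟩
    rw [leftTest_mulTest]
    exact add_mem (mulTest_mem_vanishingOrder _ _ hφ) (ih (hφ.2 Y hY))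

theorem mulTest_mem_vanishingOrder_add_two (d : ℕ) {a : smoothAlg w}
    (ha : ∀ g ∈ schubertCell w, a g = 0)
    (ha' : ∀ Y ∈ nMinus n ⊓ conjLie w (nPlus n), ∀ g ∈ schubertCell w, leftDeriv w Y a g = 0)
    {φ : 𝓓(bigCell w, ℝ)} (hφ : φ ∈ vanishingOrder w d) :
    mulTest a.2.1 φ ∈ vanishingOrder w (d + 2) := by
  induction d generalizing φ with
  | zero =>
    refine ⟨fun g hg ↦ by rw [mulTest_apply, ha g hg, zero_mul], fun Y hY ↦ ?_⟩
    rw [leftTest_mulTest]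
    exact add_mem (mulTest_mem_vanishingOrder_succ _ (ha' Y hY) hφ)
      (mulTest_mem_vanishingOrder_succ _ ha Submodule.mem_top)
  | succ d ih =>
    refine ⟨fun g hg ↦ by rw [mulTest_apply, ha g hg, zero_mul], fun Y hY ↦ ?_⟩
    rw [leftTest_mulTest]
    exact add_mem (mulTest_mem_vanishingOrder_succ _ (ha' Y hY) hφ) (ih (hφ.2 Y hY))

/-- An element of `w 𝔫 w⁻¹` is the sum of its strictly lower and strictly upper triangular parts,
and both belong to `w 𝔫 w⁻¹`. -/
theorem exists_add_of_mem_rootSpace {r : Equiv.Perm (Fin n)} {Y : Mat n} (hY : Y ∈ rootSpace r) :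
    ∃ A ∈ nMinus n ⊓ rootSpace r, ∃ B ∈ nPlus n ⊓ rootSpace r, Y = A + B := by
  refine ⟨fun i j ↦ if j < i then Y i j else 0, ⟨fun i j hij ↦ if_neg hij.not_gt, fun i j hij ↦ ?_⟩,
    fun i j ↦ if i < j then Y i j else 0, ⟨fun i j hij ↦ if_neg hij.not_gt, fun i j hij ↦ ?_⟩,
    mat_ext fun i j ↦ ?_⟩
  · change (if j < i then Y i j else 0) = 0
    rw [hY i j hij, ite_self]
  · change (if i < j then Y i j else 0) = 0
    rw [hY i j hij, ite_self]
  · change Y i j = (if j < i then Y i j else 0) + (if i < j then Y i j else 0)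
    rcases lt_trichotomy i j with h | h | h
    · rw [if_neg h.not_gt, if_pos h, zero_add]
    · subst h
      rw [if_neg (lt_irrefl i), add_zero]
      exact hY i i le_rfl
    · rw [if_neg h.not_gt, if_pos h, add_zero]

/-- Derivatives in the directions of `𝔫 ∩ w 𝔫 w⁻¹`, which are tangential to the cell, preserve the
order of vanishing. -/
theorem MonomialData.leftTest_mem_vanishingOrder (m : MonomialData w) (d : ℕ) {X : Mat n}
    (hX : X ∈ nPlus n ⊓ rootSpace m.perm) {φ : 𝓓(bigCell w, ℝ)} (hφ : φ ∈ vanishingOrder w d) :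
    leftTest w X φ ∈ vanishingOrder w d := by
  induction d generalizing X φ with
  | zero => exact Submodule.mem_top
  | succ d ih =>
    refine ⟨fun g hg ↦ ?_, fun Y hY ↦ ?_⟩
    · rw [leftTest_apply', map_neg, fderiv_mul_eq_zero_of_schubertCell
        (φ.contDiff.differentiable (by simp) g) hφ.1 hg hX.1, neg_zero]
    · have hYr : Y ∈ rootSpace m.perm := m.conjLie_nPlus ▸ hY.2
      obtain ⟨A, hA, B, hB, hAB⟩ := exists_add_of_mem_rootSpace
        (sub_mem (mul_mem_rootSpace hYr hX.2) (mul_mem_rootSpace hX.2 hYr))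
      rw [← m.conjLie_nPlus] at hA
      rw [leftTest_leftTest, hAB, leftTest_add]
      exact add_mem (ih hX (hφ.2 Y hY))
        (add_mem (hφ.2 A hA) (ih hB (vanishingOrder_succ_le d hφ)))

/-- The distributions which vanish on a space of test functions. -/
def distAnnihilator (K : Submodule ℝ 𝓓(bigCell w, ℝ)) : Submodule ℝ 𝓓'(bigCell w, ℂ) where
  carrier := {σ | ∀ φ ∈ K, σ φ = 0}
  add_mem' {σ τ} hσ hτ := fun φ hφ ↦ by
    change σ φ + τ φ = 0
    rw [hσ φ hφ, hτ φ hφ, add_zero]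
  zero_mem' _ _ := rfl
  smul_mem' c σ hσ := fun φ hφ ↦ by
    change c • σ φ = 0
    rw [hσ φ hφ, smul_zero]

theorem normalFiltration_le_distAnnihilator {lam : Fin n → ℂ} {δ : Fin n → ZMod 2} (d : ℕ) :
    normalFiltration lam δ w d ≤ distAnnihilator (vanishingOrder w (d + 1)) := by
  induction d with
  | zero =>
    intro τ hτ φ hφ
    rw [hτ.2 φ 0 fun g hg ↦ hφ.1 g hg, map_zero]
  | succ d ih =>
    refine sup_le (fun τ hτ φ hφ ↦ ih hτ φ (vanishingOrder_succ_le _ hφ)) ?_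
    refine iSup₂_le fun Y hY ↦ ?_
    rintro _ ⟨τ, hτ, rfl⟩ φ hφ
    change -τ (leftTest w Y φ) = 0
    rw [ih hτ _ (hφ.2 Y hY), neg_zero]

theorem MonomialData.mulTest_mem_vanishingOrder_of_mem_pow (m : MonomialData w) (d : ℕ)
    {x : smoothAlg w} (hx : x ∈ cellIdeal w ^ d) (φ : 𝓓(bigCell w, ℝ)) :
    mulTest x.2.1 φ ∈ vanishingOrder w d := by
  induction d generalizing x φ with
  | zero => exact Submodule.mem_top
  | succ d ih =>
    rw [pow_succ] at hx
    induction hx using Submodule.mul_induction_on' with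
    | mem_mul_mem a ha b hb =>
      have h := mulTest_mem_vanishingOrder_succ d
        (fun g hg ↦ m.apply_eq_zero_of_mem_cellIdeal hb hg) (ih ha φ)
      convert h using 1
      ext g
      change a g * b g * φ g = b g * (a g * φ g)
      ring
    | add x _ y _ hx hy =>
      convert add_mem hx hy using 1
      ext g
      exact add_mul (x g) (y g) (φ g)

theorem MonomialData.pow_smul_eq_zero_of_mem_distAnnihilator (m : MonomialData w) {d : ℕ}
    {σ : 𝓓'(bigCell w, ℂ)} (hσ : σ ∈ distAnnihilator (vanishingOrder w d)) {x : smoothAlg w}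
    (hx : x ∈ cellIdeal w ^ d) : x • σ = 0 := by
  ext φ
  exact hσ _ (m.mulTest_mem_vanishingOrder_of_mem_pow d hx φ)

/-- A distribution section has normal degree at most `d` if it vanishes on the test functions which
vanish to order `d + 1` along the cell. -/
theorem MonomialData.mem_normalFiltration_of_mem_distAnnihilator (m : MonomialData w)
    {lam : Fin n → ℂ} {δ : Fin n → ZMod 2} {d : ℕ} {σ : 𝓓'(bigCell w, ℂ)}
    (hσ : σ ∈ sections lam δ w) (h : σ ∈ distAnnihilator (vanishingOrder w (d + 1))) :
    σ ∈ normalFiltration lam δ w d :=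
  m.mem_normalFiltration_of_pow_smul d hσ fun _ hx ↦ m.pow_smul_eq_zero_of_mem_distAnnihilator h hx

end

/-! ### Local finiteness of the normal degree -/

noncomputable section

open Filter Topology

variable {n : ℕ} {w : GLn n}

theorem isClosed_rootGroup (r : Equiv.Perm (Fin n)) : IsClosed (rootGroup r : Set (Mat n)) := by
  have h : (rootGroup r : Set (Mat n)) = (⋂ (i : Fin n) (j : Fin n) (_ : r j < r i),
      {u : Mat n | entryCLM i j u = 0}) ∩ ⋂ i : Fin n, {u : Mat n | entryCLM i i u = 1} := by
    ext u
    simp only [Set.mem_inter_iff, Set.mem_iInter]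
    rfl
  rw [h]
  refine IsClosed.inter ?_ ?_
  · exact isClosed_iInter fun i ↦ isClosed_iInter fun j ↦ isClosed_iInter fun _ ↦
      isClosed_eq (entryCLM i j).continuous continuous_const
  · exact isClosed_iInter fun i ↦ isClosed_eq (entryCLM i i).continuous continuous_const

/-- The pullback of a smooth function on matrices by `nu`. -/
def compNu (w : GLn n) {f : Mat n → ℝ} (hf : ContDiff ℝ ∞ f) : smoothAlg w :=
  ⟨fun g ↦ f (nu w g), hf.comp_contDiffOn (contDiffOn_nu w),
    fun _ hg _ hb ↦ congrArg f (nu_mul_right hg hb)⟩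

/-- If `σ` is a distribution section with support in the cell and `χ` is the pullback of a compactly
supported function by `nu`, then `χ σ` is killed by some power of each function which vanishes on
the cell. By equivariance, it is enough to look at the distribution `χ σ` on a compact set of
representatives of the cosets in the support of `χ`. -/
theorem MonomialData.exists_pow_smul_eq_zero (m : MonomialData w) {lam : Fin n → ℂ}
    {δ : Fin n → ZMod 2} {σ : 𝓓'(bigCell w, ℂ)} (hσ : IsSection lam δ w σ)
    (hsupp : Distribution.dsupport σ ∩ bigCell w ⊆ schubertCell w)
    {θ : Mat n → ℝ} (hθ : ContDiff ℝ ∞ θ) (hθc : HasCompactSupport θ) :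
    ∃ k, ∀ a : smoothAlg w, (∀ g ∈ schubertCell w, a g = 0) → a ^ k • compNu w hθ • σ = 0 := by
  have hK₀ : IsCompact ((fun v : Mat n ↦ v * (w : Mat n)) '' (tsupport θ ∩ rootGroup m.perm)) :=
    (IsCompact.inter_right hθc (isClosed_rootGroup m.perm)).image (continuous_mul_const _)
  obtain ⟨K, hK, hK₀K, hKΩ⟩ := exists_compact_between hK₀ (bigCell w).isOpen (by
    rintro _ ⟨v, hv, rfl⟩
    exact m.mul_mem_bigCell hv.2)
  obtain ⟨k, hk⟩ := exists_pow_mulTest_eq_zero σ hK hKΩ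
  refine ⟨k, fun a ha ↦ ?_⟩
  ext φ
  refine distribution_apply_eq_zero_of_locally (a ^ k • compNu w hθ • σ) φ fun x hx ↦ ?_
  have hxΩ : x ∈ bigCell w := φ.tsupport_subset hx
  by_cases hxθ : nu w x ∈ tsupport θ
  · obtain ⟨b, hb, hxb⟩ := exists_eq_nu_mul hxΩ
    obtain ⟨b', -, hbb'⟩ := exists_inv_mem_lowerBorel hb
    refine ⟨(fun g ↦ g * b') ⁻¹' interior K, isOpen_interior.preimage (continuous_mul_const _),
      ?_, fun ψ hψ ↦ ?_⟩
    · refine hK₀K ⟨nu w x, ⟨hxθ, m.nu_mem x⟩, ?_⟩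
      change nu w x * (w : Mat n) = x * b'
      nth_rewrite 2 [hxb]
      rw [mul_assoc _ b, hbb'.1, mul_one]
    · obtain ⟨ψ', hψ', hsψ'⟩ := exists_rightTranslate hb ψ
      have hψ'K : tsupport ψ' ⊆ K := by
        rw [hsψ']
        intro g hg
        have h1 := hψ hg
        rw [Set.mem_preimage, mul_assoc, hbb'.1, mul_one] at h1
        exact interior_subset h1
      have h2 := hσ b hb (mulTest (a.2.1.pow k) (mulTest (compNu w hθ).2.1 ψ'))
        (mulTest (compNu w hθ).2.1 (mulTest (a ^ k).2.1 ψ)) (fun g ↦ ?_)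
      · change σ (mulTest (compNu w hθ).2.1 (mulTest (a ^ k).2.1 ψ)) = 0
        rw [h2, hk a a.2.1 (fun g hg ↦ ha g (hsupp hg)) _
          ((tsupport_mulTest_subset _ _).trans hψ'K), mul_zero]
      · change compNu w hθ (g * b) * (a (g * b) ^ k * ψ (g * b)) =
          a g ^ k * (compNu w hθ g * ψ' g)
        rw [hψ']
        by_cases hg : g ∈ bigCell w
        · rw [(compNu w hθ).2.2 g hg b hb, a.2.2 g hg b hb]
          ring
        · rw [testFunction_eq_zero_of_notMem ψ' hg]
          ring
  · refine ⟨bigCell w ∩ nu w ⁻¹' (tsupport θ)ᶜ, (contDiffOn_nu w).continuousOn.isOpen_inter_preimage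
      (bigCell w).isOpen (isClosed_tsupport θ).isOpen_compl, ⟨hxΩ, hxθ⟩, fun ψ hψ ↦ ?_⟩
    have h0 : mulTest (compNu w hθ).2.1 (mulTest (a ^ k).2.1 ψ) = 0 := by
      ext g
      change θ (nu w g) * ((a ^ k : smoothAlg w) g * ψ g) = 0
      by_cases hg : g ∈ tsupport ψ
      · rw [image_eq_zero_of_notMem_tsupport (hψ hg).2, zero_mul]
      · rw [image_eq_zero_of_notMem_tsupport hg, mul_zero, mul_zero]
    change σ (mulTest (compNu w hθ).2.1 (mulTest (a ^ k).2.1 ψ)) = 0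
    rw [h0, map_zero]

theorem MonomialData.exists_mem_normalFiltration (m : MonomialData w) {lam : Fin n → ℂ}
    {δ : Fin n → ZMod 2} {τ : 𝓓'(bigCell w, ℂ)} (hτ : τ ∈ sections lam δ w)
    (h : ∀ a ∈ cellIdeal w, ∃ k : ℕ, a ^ k • τ = 0) : ∃ d, τ ∈ normalFiltration lam δ w d := by
  have hrad : cellIdeal w ≤ (Ideal.torsionOf (smoothAlg w) 𝓓'(bigCell w, ℂ) τ).radical := by
    intro a ha
    obtain ⟨k, hk⟩ := h a ha
    exact ⟨k, (Ideal.mem_torsionOf_iff τ (a ^ k)).mpr hk⟩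
  obtain ⟨d, hd⟩ := Ideal.exists_pow_le_of_le_radical_of_fg hrad (cellIdeal_fg w)
  refine ⟨d, m.mem_normalFiltration_of_pow_smul d hτ fun x hx ↦ ?_⟩
  exact (Ideal.mem_torsionOf_iff τ x).mp (hd (Ideal.pow_le_pow_right (Nat.le_succ d) hx))

theorem MonomialData.exists_hasNormalDegreeLE (m : MonomialData w) {lam : Fin n → ℂ}
    {δ : Fin n → ZMod 2} {σ : 𝓓'(bigCell w, ℂ)} (hσ : IsSection lam δ w σ)
    (hsupp : Distribution.dsupport σ ∩ bigCell w ⊆ schubertCell w) {g : Mat n}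
    (hg : g ∈ bigCell w) : ∃ d, HasNormalDegreeLE lam δ w σ g d := by
  obtain ⟨θ, W, hθ, hθc, hWo, hgW, hW⟩ : ∃ (θ : Mat n → ℝ) (W : Set (Mat n)), ContDiff ℝ ∞ θ ∧
      HasCompactSupport θ ∧ IsOpen W ∧ nu w g ∈ W ∧ ∀ v ∈ W, θ v = 1 := by
    let θ : ContDiffBump (nu w g) := ⟨1, 2, one_pos, one_lt_two⟩
    exact ⟨θ, Metric.ball (nu w g) 1, θ.contDiff, θ.hasCompactSupport, Metric.isOpen_ball,
      Metric.mem_ball_self one_pos,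
      fun v hv ↦ θ.one_of_mem_closedBall (Metric.ball_subset_closedBall hv)⟩
  obtain ⟨k, hk⟩ := m.exists_pow_smul_eq_zero hσ hsupp hθ hθc
  obtain ⟨d, hd⟩ := m.exists_mem_normalFiltration (IsSection.smul hσ (compNu w hθ))
    fun a ha ↦ ⟨k, hk a fun g hg ↦ m.apply_eq_zero_of_mem_cellIdeal ha hg⟩
  refine ⟨d, bigCell w ∩ nu w ⁻¹' W, (contDiffOn_nu w).continuousOn.isOpen_inter_preimage
    (bigCell w).isOpen hWo, ⟨hg, hgW⟩, compNu w hθ • σ, hd, fun φ hφ ↦ ?_⟩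
  rw [smul_dist_apply]
  refine congrArg σ ?_
  ext x
  rw [mulTest_apply]
  change φ x = θ (nu w x) * φ x
  by_cases hx : x ∈ tsupport φ
  · rw [hW _ (hφ hx).2, one_mul]
  · rw [image_eq_zero_of_notMem_tsupport hx, mul_zero]

end

/-! ### The vector fields `m(Z)` -/

noncomputable section

open Filter Topology

variable {n : ℕ} {w : GLn n}

/-- The derivative of a curve `t ↦ A exp(-tZ) B`. -/
theorem hasDerivAt_mul_exp_mul (A Z B : Mat n) :
    HasDerivAt (fun t : ℝ ↦ A * NormedSpace.exp (-(t • Z)) * B) (-(A * Z * B)) 0 := by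
  have h := ((hasDerivAt_exp_smul_const (𝕂 := ℝ) (-Z) (0 : ℝ)).const_mul A).mul_const B
  simpa using h

theorem deriv_smoothAlg_mul_exp_mul (f : smoothAlg w) {A Z B : Mat n} (h : A * B ∈ bigCell w) :
    deriv (fun t : ℝ ↦ f (A * NormedSpace.exp (-(t • Z)) * B)) 0 =
      -fderiv ℝ f (A * B) (A * Z * B) := by
  have h1 : HasFDerivAt f (fderiv ℝ f (A * B))
      (A * NormedSpace.exp (-((0 : ℝ) • Z)) * B) := by
    simpa using (smoothAlg_differentiableAt f h).hasFDerivAt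
  rw [← map_neg]
  exact (h1.comp_hasDerivAt (0 : ℝ) (hasDerivAt_mul_exp_mul A Z B)).deriv

theorem hasDerivAt_inverse_one_add_smul (Y : Mat n) :
    HasDerivAt (fun s : ℝ ↦ Ring.inverse (1 + s • Y)) (-Y) 0 := by
  have h1 : HasDerivAt (fun s : ℝ ↦ 1 + s • Y) Y 0 := by
    simpa using hasDerivAt_mul_one_add_smul_mul 1 Y 1
  have h2 : HasFDerivAt Ring.inverse (-ContinuousLinearMap.mulLeftRight ℝ (Mat n) 1 1)
      ((1 : Mat n) + (0 : ℝ) • Y) := by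
    simpa using hasFDerivAt_ringInverse (𝕜 := ℝ) (1 : (Mat n)ˣ)
  have h3 := h2.comp_hasDerivAt (0 : ℝ) h1
  have e : (-ContinuousLinearMap.mulLeftRight ℝ (Mat n) 1 1) Y = -Y := by simp
  rw [e] at h3
  exact h3

section Expansion

variable {k : ℕ}

/-- The matrix-valued function `∑ⱼ aⱼ Zⱼ`. -/
def expansionMatrix (Zs : Fin k → Mat n) (a : Fin k → SmoothFunction w) (g : Mat n) : Mat n :=
  ∑ j, (a j).toFun g • Zs j

/-- The entries of `∑ⱼ aⱼ Zⱼ`. -/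
def expansionEntry (Zs : Fin k → Mat n) (a : Fin k → SmoothFunction w) (p q : Fin n) :
    smoothAlg w := ∑ j, Zs j p q • ofSmoothFunction (a j)

theorem expansionEntry_apply (Zs : Fin k → Mat n) (a : Fin k → SmoothFunction w) (p q : Fin n)
    (g : Mat n) : expansionEntry Zs a p q g = expansionMatrix Zs a g p q := by
  have h : entryCLM p q (expansionMatrix Zs a g) = ∑ j, (a j).toFun g * Zs j p q := by
    simp only [expansionMatrix, map_sum, map_smul, entryCLM_apply, smul_eq_mul]
  rw [expansionEntry, smoothAlg_sum_apply]
  refine Eq.trans (Finset.sum_congr rfl fun j _ ↦ ?_) h.symm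
  exact mul_comm (Zs j p q) ((a j).toFun g)

theorem contDiffOn_expansionMatrix (Zs : Fin k → Mat n) (a : Fin k → SmoothFunction w) :
    ContDiffOn ℝ ∞ (expansionMatrix Zs a) (bigCell w) :=
  ContDiffOn.sum fun j _ ↦ (a j).smooth.smul contDiffOn_const

theorem expansionMatrix_mul_right (Zs : Fin k → Mat n) (a : Fin k → SmoothFunction w) {g b : Mat n}
    (hg : g ∈ bigCell w) (hb : b ∈ lowerBorel n) :
    expansionMatrix Zs a (g * b) = expansionMatrix Zs a g :=
  Finset.sum_congr rfl fun j _ ↦ by rw [(a j).invariant g hg b hb]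

namespace MonomialData

/-- The coefficients of `m(Z)`: at `v w o` with `v = n₁ n₂`, the matrix `∑ⱼ aⱼ Zⱼ` is
`v P(n₂⁻¹ Z n₂) v⁻¹`, where `P` is the projection to `w 𝔫 w⁻¹` with kernel `w 𝔟₋ w⁻¹`. -/
theorem expansionMatrix_mul (m : MonomialData w) {Z : Mat n} {Zs : Fin k → Mat n}
    (hZs : ∀ j, Zs j ∈ rootSpace m.perm) {a : Fin k → SmoothFunction w}
    (h : IsExpansion w Z Zs a) {n₁ n₂ n₂' : Mat n}
    (h₁ : n₁ ∈ rootGroup m.perm ∩ upperUnipotent n) (h₂ : n₂ ∈ rootGroup m.perm ∩ lowerUnipotent n)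
    (hn₂ : n₂ * n₂' = 1) :
    expansionMatrix Zs a (n₁ * n₂ * w) * (n₁ * n₂) =
      n₁ * n₂ * rootProj m.perm (n₂' * Z * n₂) := by
  have hv : n₁ * n₂ ∈ rootGroup m.perm := mul_mem_rootGroup h₁.1 h₂.1
  have hvw := m.mul_mem_bigCell hv
  refine mat_ext fun i j ↦ ?_
  -- the vector field is determined by its effect on the coordinate functions of `nu`
  have h1 := h (toSmoothFunction (nuEntry w i j)) n₁ (by rwa [m.conjSet_upperUnipotent]) n₂
    (by rwa [m.conjSet_upperUnipotent])
  have hL : deriv (fun t : ℝ ↦ nuEntry w i j (n₁ * NormedSpace.exp (-(t • Z)) * n₂ * (w : Mat n))) 0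
      = -(n₁ * n₂ * rootProj m.perm (n₂' * Z * n₂)) i j := by
    have h2 := deriv_smoothAlg_mul_exp_mul (nuEntry w i j) (A := n₁) (Z := Z) (B := n₂ * w)
      (by rwa [← mul_assoc])
    simp only [← mul_assoc] at h2
    rw [h2, fderiv_nuEntry i j hvw]
    have e : n₁ * Z * n₂ * (w : Mat n) = n₁ * n₂ * (n₂' * Z * n₂) * w := by
      simp only [← mul_assoc]
      rw [mul_assoc n₁ n₂ n₂', hn₂, mul_one]
    rw [e, m.fderiv_nu_mul_mul hv]
  have hR : ∀ s, deriv (fun t : ℝ ↦ nuEntry w i j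
      (NormedSpace.exp (-(t • Zs s)) * (n₁ * n₂ * (w : Mat n)))) 0 = -(Zs s * (n₁ * n₂)) i j := by
    intro s
    have h2 := deriv_smoothAlg_mul_exp_mul (nuEntry w i j) (A := 1) (Z := Zs s)
      (B := n₁ * n₂ * w) (by rwa [one_mul])
    simp only [one_mul] at h2
    rw [h2, fderiv_nuEntry i j hvw, m.fderiv_nu_mul_left hvw (hZs s), m.nu_eq' hv]
  have h3 : -(n₁ * n₂ * rootProj m.perm (n₂' * Z * n₂)) i j =
      ∑ s, (a s).toFun (n₁ * n₂ * w) * -(Zs s * (n₁ * n₂)) i j := by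
    rw [← hL]
    refine h1.trans (Finset.sum_congr rfl fun s _ ↦ ?_)
    rw [← hR s]
    rfl
  have h4 : entryCLM i j (expansionMatrix Zs a (n₁ * n₂ * w) * (n₁ * n₂)) =
      ∑ s, (a s).toFun (n₁ * n₂ * w) * (Zs s * (n₁ * n₂)) i j := by
    simp only [expansionMatrix, Finset.sum_mul, smul_mul_assoc, map_sum, map_smul, entryCLM_apply,
      smul_eq_mul]
  refine Eq.trans h4 ?_
  simp only [mul_neg, Finset.sum_neg_distrib] at h3
  exact (neg_injective h3).symm

theorem rootProj_eq_zero_of_mem_conjLie_nMinus (m : MonomialData w) {Z : Mat n}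
    (hZ : Z ∈ conjLie w (nMinus n)) : rootProj m.perm Z = 0 := by
  refine mat_ext fun i j ↦ ?_
  rw [rootProj_entry]
  split_ifs with h
  · exact m.entry_eq_zero_of_mem_conjLie_nMinus hZ h.le
  · rfl

theorem rootProj_mem_nPlus (m : MonomialData w) {X : Mat n}
    (hX : X ∈ aDiag n ⊔ nPlus n ⊔ conjLie w (nMinus n)) : rootProj m.perm X ∈ nPlus n := by
  obtain ⟨_, hAB, C, hC, rfl⟩ := Submodule.mem_sup.mp hX
  obtain ⟨A, hA, B, hB, rfl⟩ := Submodule.mem_sup.mp hAB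
  rw [map_add, m.rootProj_eq_zero_of_mem_conjLie_nMinus hC, add_zero]
  intro i j hij
  rw [rootProj_entry]
  split_ifs with h
  · have hne : i ≠ j := fun e ↦ h.ne (congrArg _ e)
    rw [add_entry, hA i j hne, hB i j hij, add_zero]
  · rfl

/-- If `Z ∈ w 𝔫₋ w⁻¹`, the vector field `m(Z)` vanishes on the cell. -/
theorem expansionMatrix_eq_zero (m : MonomialData w) {Z : Mat n}
    (hZ : Z ∈ conjLie w (nMinus n)) {Zs : Fin k → Mat n}
    (hZs : ∀ j, Zs j ∈ rootSpace m.perm) {a : Fin k → SmoothFunction w}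
    (h : IsExpansion w Z Zs a) {g : Mat n} (hg : g ∈ schubertCell w) :
    expansionMatrix Zs a g = 0 := by
  obtain ⟨hgU, hgN⟩ := m.mem_schubertCell_iff.mp hg
  obtain ⟨b, hb, hgb⟩ := exists_eq_nu_mul hgU
  obtain ⟨v, -, hv, -⟩ := exists_inv_mem_rootGroup (m.nu_mem g)
  have h1 := m.expansionMatrix_mul hZs h (n₁ := nu w g) (n₂ := 1) (n₂' := 1) ⟨m.nu_mem g, hgN⟩
    ⟨one_mem_rootGroup _, fun i j hij ↦ by rw [one_entry, if_neg hij.ne],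
      fun i ↦ by rw [one_entry, if_pos rfl]⟩ (mul_one 1)
  rw [one_mul, mul_one, mul_one, m.rootProj_eq_zero_of_mem_conjLie_nMinus hZ, mul_zero] at h1
  rw [hgb, expansionMatrix_mul_right Zs a (m.mul_mem_bigCell (m.nu_mem g)) hb]
  calc _ = expansionMatrix Zs a (nu w g * w) * nu w g * v := by rw [mul_assoc, hv, mul_one]
    _ = 0 := by rw [h1, zero_mul]

/-- The normal derivatives of the coefficients of `m(Z)`, at `n₁ w o` in the direction of
`n₁ Y n₁⁻¹`. -/
theorem fderiv_expansionMatrix (m : MonomialData w) {Z : Mat n}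
    (hZ : Z ∈ conjLie w (nMinus n)) {Zs : Fin k → Mat n}
    (hZs : ∀ j, Zs j ∈ rootSpace m.perm) {a : Fin k → SmoothFunction w}
    (h : IsExpansion w Z Zs a) {n₁ Y : Mat n} (h₁ : n₁ ∈ rootGroup m.perm ∩ upperUnipotent n)
    (hY : Y ∈ nMinus n ⊓ rootSpace m.perm) :
    fderiv ℝ (expansionMatrix Zs a) (n₁ * w) (n₁ * Y * w) * n₁ =
      n₁ * rootProj m.perm ⁅Z, Y⁆ := by
  have hp : n₁ * (w : Mat n) ∈ bigCell w := m.mul_mem_bigCell h₁.1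
  have hc : n₁ * (w : Mat n) ∈ schubertCell w := 
    ⟨n₁, h₁.2, 1, one_mem_lowerBorel n, (mul_one _).symm⟩
  have hA0 := m.expansionMatrix_eq_zero hZ hZs h hc
  have hZ0 := m.rootProj_eq_zero_of_mem_conjLie_nMinus hZ
  have hd : HasFDerivAt (expansionMatrix Zs a) (fderiv ℝ (expansionMatrix Zs a) (n₁ * w))
      (n₁ * (1 + (0 : ℝ) • Y) * w) := by
    rw [zero_smul, add_zero, mul_one]
    exact (((contDiffOn_expansionMatrix Zs a).contDiffAt
      ((bigCell w).isOpen.mem_nhds hp)).differentiableAt (by simp)).hasFDerivAt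
  have h2 : HasDerivAt (fun s : ℝ ↦ 1 + s • Y) Y 0 := by
    simpa using hasDerivAt_mul_one_add_smul_mul 1 Y 1
  have hL := (hd.comp_hasDerivAt (0 : ℝ) (hasDerivAt_mul_one_add_smul_mul n₁ Y (w : Mat n))).mul
    (h2.const_mul n₁)
  have hP : HasFDerivAt (rootProj m.perm) (rootProj m.perm).toContinuousLinearMap
      (Ring.inverse (1 + (0 : ℝ) • Y) * Z * (1 + (0 : ℝ) • Y)) :=
    (rootProj m.perm).toContinuousLinearMap.hasFDerivAt
  have hQ : HasDerivAt (fun s : ℝ ↦ Ring.inverse (1 + s • Y) * Z * (1 + s • Y)) ⁅Z, Y⁆ 0 := by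
    have h3 := ((hasDerivAt_inverse_one_add_smul Y).mul_const Z).mul h2
    simp only [zero_smul, add_zero, Ring.inverse_one, one_mul, mul_one] at h3
    rw [neg_mul, neg_add_eq_sub, ← Ring.lie_def] at h3
    exact h3
  have hR := (h2.const_mul n₁).mul (hP.comp_hasDerivAt (0 : ℝ) hQ)
  have heq : ∀ s : ℝ, expansionMatrix Zs a (n₁ * (1 + s • Y) * w) * (n₁ * (1 + s • Y)) =
      n₁ * (1 + s • Y) * rootProj m.perm (Ring.inverse (1 + s • Y) * Z * (1 + s • Y)) := by
    intro s
    have hs : 1 + s • Y ∈ rootGroup m.perm :=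
      one_add_mem_rootGroup ((rootSpace m.perm).smul_mem s hY.2)
    obtain ⟨v, -, hv, hv'⟩ := exists_inv_mem_rootGroup hs
    have hu : IsUnit (1 + s • Y) := ⟨⟨_, v, hv, hv'⟩, rfl⟩
    refine m.expansionMatrix_mul hZs h h₁ ⟨hs, fun i j hij ↦ ?_, hs.2⟩ (Ring.mul_inverse_cancel _ hu)
    rw [add_entry, smul_entry, hY.1 i j hij.le, one_entry, if_neg hij.ne, mul_zero, add_zero]
  have hLR := (hL.congr_of_eventuallyEq (Eventually.of_forall fun s ↦ (heq s).symm)).unique hR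
  simp only [zero_smul, add_zero, mul_one, hA0, zero_mul, Ring.inverse_one, one_mul, hZ0,
    mul_zero, zero_add, Function.comp_apply] at hLR
  exact hLR

/-- Under the hypothesis on `[Z, w 𝔫 w⁻¹ ∩ 𝔫₋]`, the coefficients of `m(Z)` below the diagonal
vanish to second order along the cell. -/
theorem leftDeriv_expansionEntry (m : MonomialData w) {Z : Mat n}
    (hZ : Z ∈ conjLie w (nMinus n))
    (hi : ∀ Y ∈ conjLie w (nPlus n) ⊓ nMinus n,
      ⁅Z, Y⁆ ∈ aDiag n ⊔ nPlus n ⊔ conjLie w (nMinus n))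
    {Zs : Fin k → Mat n} (hZs : ∀ j, Zs j ∈ rootSpace m.perm) {a : Fin k → SmoothFunction w}
    (h : IsExpansion w Z Zs a) {Y : Mat n} (hY : Y ∈ rootSpace m.perm) {p q : Fin n} (hpq : q < p)
    {g : Mat n} (hg : g ∈ schubertCell w) : leftDeriv w Y (expansionEntry Zs a p q) g = 0 := by
  obtain ⟨hgU, hgN⟩ := m.mem_schubertCell_iff.mp hg
  obtain ⟨b, hb, hgb⟩ := exists_eq_nu_mul hgU
  have hvr := m.nu_mem g
  generalize nu w g = v at hgN hgb hvr
  subst hgb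
  have hp : v * (w : Mat n) ∈ bigCell w := m.mul_mem_bigCell hvr
  have hc : v * (w : Mat n) ∈ schubertCell w :=
    ⟨v, hgN, 1, one_mem_lowerBorel n, (mul_one _).symm⟩
  rw [(leftDeriv w Y _).2.2 _ hp b hb, leftDeriv_apply _ _ hp, map_neg, neg_eq_zero]
  obtain ⟨v', hv'r, hvv', hv'v⟩ := exists_inv_mem_rootGroup hvr
  have hv'N : v' ∈ upperUnipotent n := mem_rootGroup_of_mul_eq_one (r := Equiv.refl _) hgN hv'v
  obtain ⟨A, hA, X, hX, hAX⟩ := exists_add_of_mem_rootSpace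
    (rootSpace_mul_mem_rootGroup hvr (rootGroup_mul_mem_rootSpace hv'r hY))
  have e : Y * (v * (w : Mat n)) = v * A * w + v * X * v' * (v * w) := by
    calc Y * (v * (w : Mat n)) = v * (v' * Y * v) * w := by
          simp only [← mul_assoc]
          rw [hvv', one_mul]
      _ = v * A * w + v * X * (v' * v) * w := by rw [hAX, hv'v]; noncomm_ring
      _ = _ := by simp only [mul_assoc]
  have hXN : v * X * v' ∈ nPlus n :=
    rootSpace_mul_mem_rootGroup (r := Equiv.refl _) hv'N
      (rootGroup_mul_mem_rootSpace (r := Equiv.refl _) hgN hX.1)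
  have hd : DifferentiableAt ℝ (expansionMatrix Zs a) (v * w) :=
    ((contDiffOn_expansionMatrix Zs a).contDiffAt
      ((bigCell w).isOpen.mem_nhds hp)).differentiableAt (by simp)
  have hfun : (expansionEntry Zs a p q : Mat n → ℝ) = fun g ↦ entryCLM p q (expansionMatrix Zs a g) :=
    funext fun g ↦ expansionEntry_apply Zs a p q g
  have hent : fderiv ℝ (expansionEntry Zs a p q) (v * w) =
      (entryCLM p q).comp (fderiv ℝ (expansionMatrix Zs a) (v * w)) := by
    rw [hfun]
    exact ((entryCLM p q).hasFDerivAt.comp _ hd.hasFDerivAt).fderiv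
  rw [e, map_add, fderiv_mul_eq_zero_of_schubertCell
    (smoothAlg_differentiableAt (expansionEntry Zs a p q) hp) (fun x hx ↦ ?_) hc hXN, add_zero, hent]
  · have h1 := m.fderiv_expansionMatrix hZ hZs h ⟨hvr, hgN⟩ hA
    have hN : rootProj m.perm ⁅Z, A⁆ ∈ nPlus n :=
      m.rootProj_mem_nPlus (hi A ⟨m.conjLie_nPlus ▸ hA.2, hA.1⟩)
    have h2 : fderiv ℝ (expansionMatrix Zs a) (v * w) (v * A * w) =
        v * rootProj m.perm ⁅Z, A⁆ * v' := by
      rw [← h1, mul_assoc _ v v', hvv', mul_one]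
    change (fderiv ℝ (expansionMatrix Zs a) (v * w) (v * A * w)) p q = 0
    rw [h2]
    exact (rootSpace_mul_mem_rootGroup (r := Equiv.refl _) hv'N
      (rootGroup_mul_mem_rootSpace (r := Equiv.refl _) hgN hN)) p q hpq.le
  · rw [expansionEntry_apply, m.expansionMatrix_eq_zero hZ hZs h hx]
    rfl

end MonomialData

end Expansion

end

/-! ### The action of `m(Z)` on distribution sections -/

noncomputable section

open Filter Topology

variable {n : ℕ} {w : GLn n} {k : ℕ}

theorem tsupport_leftTest_subset (Y : Mat n) (φ : 𝓓(bigCell w, ℝ)) :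
    tsupport (leftTest w Y φ) ⊆ tsupport φ := by
  have h : Function.support (leftTest w Y φ) ⊆ Function.support (fderiv ℝ φ) := by
    intro x hx h0
    refine hx ?_
    rw [leftTest_apply', h0]
    rfl
  exact (closure_mono h).trans (tsupport_fderiv_subset ℝ)

/-- The transpose of the operator `∑ⱼ aⱼ ℓ(Zⱼ)` on distributions, up to sign. -/
def expansionTest (Zs : Fin k → Mat n) (a : Fin k → SmoothFunction w) (φ : 𝓓(bigCell w, ℝ)) :
    𝓓(bigCell w, ℝ) := ∑ j, leftTest w (Zs j) (mulTest (a j).smooth φ)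

theorem sum_mulDist_ell_apply (Zs : Fin k → Mat n) (a : Fin k → SmoothFunction w)
    (σ : 𝓓'(bigCell w, ℂ)) (φ : 𝓓(bigCell w, ℝ)) :
    (∑ j, mulDist (a j) (ell w (Zs j) σ)) φ = -σ (expansionTest Zs a φ) := by
  rw [_root_.sum_apply, expansionTest, map_sum, ← Finset.sum_neg_distrib]
  rfl

theorem tsupport_expansionTest_subset (Zs : Fin k → Mat n) (a : Fin k → SmoothFunction w)
    (φ : 𝓓(bigCell w, ℝ)) : tsupport (expansionTest Zs a φ) ⊆ tsupport φ := by
  refine closure_minimal (fun x hx ↦ by_contra fun h ↦ hx ?_) (isClosed_tsupport _)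
  rw [expansionTest, _root_.sum_apply]
  refine Finset.sum_eq_zero fun j _ ↦ image_eq_zero_of_notMem_tsupport fun h' ↦ h ?_
  exact tsupport_mulTest_subset _ _ (tsupport_leftTest_subset _ _ h')

theorem expansionTest_eq_sum (Zs : Fin k → Mat n) (a : Fin k → SmoothFunction w)
    (φ : 𝓓(bigCell w, ℝ)) : expansionTest Zs a φ =
      ∑ p, ∑ q, leftTest w (elemMat p q) (mulTest (expansionEntry Zs a p q).2.1 φ) := by
  have h1 : ∀ (Y : Mat n) (ψ : 𝓓(bigCell w, ℝ)),
      leftTest w Y ψ = ∑ p, ∑ q, Y p q • leftTest w (elemMat p q) ψ := by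
    intro Y ψ
    let L : Mat n →ₗ[ℝ] 𝓓(bigCell w, ℝ) :=
      { toFun := fun Y ↦ leftTest w Y ψ
        map_add' := fun Y Y' ↦ leftTest_add Y Y' ψ
        map_smul' := fun c Y ↦ leftTest_smul c Y ψ }
    change L Y = ∑ p, ∑ q, Y p q • L (elemMat p q)
    conv_lhs => rw [eq_sum_smul_elemMat Y]
    simp only [map_sum, map_smul]
  have h2 : ∀ p q, mulTest (expansionEntry Zs a p q).2.1 φ =
      ∑ j, Zs j p q • mulTest (a j).smooth φ := by
    intro p q
    ext g
    rw [_root_.sum_apply, mulTest_apply, expansionEntry, smoothAlg_sum_apply, Finset.sum_mul]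
    exact Finset.sum_congr rfl fun j _ ↦ mul_assoc (Zs j p q) ((a j).toFun g) (φ g)
  simp only [h2, map_sum, map_smul]
  rw [expansionTest]
  simp only [fun j ↦ h1 (Zs j) (mulTest (a j).smooth φ)]
  rw [Finset.sum_comm]
  exact Finset.sum_congr rfl fun p _ ↦ Finset.sum_comm

/-- The operator `m(Z)` raises the order of vanishing of test functions. The terms `ℓ(E_{pq})` with
`p < q` are tangential and their coefficients vanish on the cell; the terms with `q < p` are normal
derivatives, and their coefficients vanish to second order. -/
theorem MonomialData.expansionTest_mem_vanishingOrder (m : MonomialData w) {Z : Mat n}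
    (hZ : Z ∈ conjLie w (nMinus n))
    (hi : ∀ Y ∈ conjLie w (nPlus n) ⊓ nMinus n,
      ⁅Z, Y⁆ ∈ aDiag n ⊔ nPlus n ⊔ conjLie w (nMinus n))
    {Zs : Fin k → Mat n} (hZs : ∀ j, Zs j ∈ rootSpace m.perm) {a : Fin k → SmoothFunction w}
    (h : IsExpansion w Z Zs a) (d : ℕ) {φ : 𝓓(bigCell w, ℝ)} (hφ : φ ∈ vanishingOrder w d) :
    expansionTest Zs a φ ∈ vanishingOrder w (d + 1) := by
  rw [expansionTest_eq_sum]
  refine sum_mem fun p _ ↦ sum_mem fun q _ ↦ ?_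
  have h0 : ∀ g ∈ schubertCell w, expansionEntry Zs a p q g = 0 := fun g hg ↦ by
    rw [expansionEntry_apply, m.expansionMatrix_eq_zero hZ hZs h hg]
    rfl
  by_cases hr : m.perm p < m.perm q
  · rcases lt_or_gt_of_ne (fun e ↦ hr.ne (congrArg _ e) : p ≠ q) with hpq | hpq
    · exact m.leftTest_mem_vanishingOrder _ ⟨elemMat_mem_nPlus hpq, elemMat_mem_rootSpace hr⟩
        (mulTest_mem_vanishingOrder_succ d h0 hφ)
    · have h1 := mulTest_mem_vanishingOrder_add_two d h0 (fun Y hY g hg ↦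
        m.leftDeriv_expansionEntry hZ hi hZs h (m.conjLie_nPlus ▸ hY.2) hpq hg) hφ
      refine h1.2 _ ⟨elemMat_mem_nMinus hpq, ?_⟩
      rw [m.conjLie_nPlus]
      exact elemMat_mem_rootSpace hr
  · have h1 : mulTest (expansionEntry Zs a p q).2.1 φ = 0 := by
      ext g
      rw [mulTest_apply, expansionEntry, smoothAlg_sum_apply]
      refine mul_eq_zero_of_left (Finset.sum_eq_zero fun j _ ↦ ?_) _
      change Zs j p q * (a j).toFun g = 0
      rw [hZs j p q (not_lt.mp hr), zero_mul]
    rw [h1, map_zero]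
    exact zero_mem _

theorem MonomialData.sum_mulDist_ell_mem_distAnnihilator (m : MonomialData w) {Z : Mat n}
    (hZ : Z ∈ conjLie w (nMinus n))
    (hi : ∀ Y ∈ conjLie w (nPlus n) ⊓ nMinus n,
      ⁅Z, Y⁆ ∈ aDiag n ⊔ nPlus n ⊔ conjLie w (nMinus n))
    {Zs : Fin k → Mat n} (hZs : ∀ j, Zs j ∈ rootSpace m.perm) {a : Fin k → SmoothFunction w}
    (h : IsExpansion w Z Zs a) {lam : Fin n → ℂ} {δ : Fin n → ZMod 2} {d : ℕ}
    {τ : 𝓓'(bigCell w, ℂ)} (hτ : τ ∈ normalFiltration lam δ w d) :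
    ∑ j, mulDist (a j) (ell w (Zs j) τ) ∈ distAnnihilator (vanishingOrder w d) := by
  intro φ hφ
  rw [sum_mulDist_ell_apply, normalFiltration_le_distAnnihilator d hτ _
    (m.expansionTest_mem_vanishingOrder hZ hi hZs h d hφ), neg_zero]

theorem normalFiltration_le_sections (lam : Fin n → ℂ) (δ : Fin n → ZMod 2) (w : GLn n) (d : ℕ) :
    normalFiltration lam δ w d ≤ sections lam δ w := by
  induction d with
  | zero => exact fun τ hτ ↦ hτ.1
  | succ d ih =>
    refine sup_le ih (iSup₂_le fun Y _ ↦ ?_)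
    rintro _ ⟨τ, hτ, rfl⟩
    exact IsSection.ell (ih hτ) Y

theorem MonomialData.sum_mulDist_ell_mem_normalFiltration (m : MonomialData w) {Z : Mat n}
    (hZ : Z ∈ conjLie w (nMinus n))
    (hi : ∀ Y ∈ conjLie w (nPlus n) ⊓ nMinus n,
      ⁅Z, Y⁆ ∈ aDiag n ⊔ nPlus n ⊔ conjLie w (nMinus n))
    {Zs : Fin k → Mat n} (hZs : ∀ j, Zs j ∈ rootSpace m.perm) {a : Fin k → SmoothFunction w}
    (h : IsExpansion w Z Zs a) {lam : Fin n → ℂ} {δ : Fin n → ZMod 2} {d : ℕ}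
    {τ : 𝓓'(bigCell w, ℂ)} (hτ : τ ∈ normalFiltration lam δ w (d + 1)) :
    ∑ j, mulDist (a j) (ell w (Zs j) τ) ∈ normalFiltration lam δ w d := by
  refine m.mem_normalFiltration_of_mem_distAnnihilator (sum_mem fun j _ ↦ ?_)
    (m.sum_mulDist_ell_mem_distAnnihilator hZ hi hZs h hτ)
  exact IsSection.smul ((normalFiltration_le_sections lam δ w _ hτ : IsSection lam δ w τ).ell (Zs j))
    (ofSmoothFunction (a j))

end

end FlagDistribution

theorem proposition3 {n : ℕ} (lam : Fin n → ℂ) (δ : Fin n → ZMod 2) (w : GLn n)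
    (hw : w ∈ Subgroup.normalizer (diagonalSubgroup n : Set (GLn n)))
    (σ : 𝓓'(bigCell w, ℂ)) (hσ : IsSection lam δ w σ)
    (hsupp : Distribution.dsupport σ ∩ bigCell w ⊆ schubertCell w)
    (Z : Mat n) (hZ : Z ∈ conjLie w (nMinus n) ⊓ nPlus n)
    (hi : ∀ Y ∈ conjLie w (nPlus n) ⊓ nMinus n,
      ⁅Z, Y⁆ ∈ aDiag n ⊔ nPlus n ⊔ conjLie w (nMinus n))
    (hii : IsMAction w Z σ (ell w Z σ)) :
    ∀ g ∈ Distribution.dsupport σ ∩ bigCell w,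
      normalDegree lam δ w (ell w Z σ) g < normalDegree lam δ w σ g := by
  classical
  rintro g ⟨hgσ, hgU⟩
  obtain ⟨m⟩ := nonempty_monomialData hw
  obtain ⟨k, B, a, hexp, hact⟩ := hii
  have hB : ∀ j, (B j : Mat n) ∈ rootSpace m.perm := fun j ↦ m.conjLie_nPlus ▸ (B j).2
  have hex := m.exists_hasNormalDegreeLE hσ hsupp hgU
  obtain ⟨V, hVo, hgV, τ, hτ, hστ⟩ := Nat.find_spec hex
  have hle : ((Nat.find hex : ℕ∞) : WithBot ℕ∞) ≤ normalDegree lam δ w σ g := by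
    rw [normalDegree, if_pos hgσ, WithBot.coe_le_coe]
    exact le_iInf₂ fun d hd ↦ Nat.cast_le.mpr (Nat.find_min' hex hd)
  refine lt_of_lt_of_le ?_ hle
  have hloc : ∀ φ : 𝓓(bigCell w, ℝ), tsupport φ ⊆ V →
      ell w Z σ φ = (∑ j, mulDist (a j) (ell w (B j : Mat n) τ)) φ := by
    intro φ hφ
    rw [hact, sum_mulDist_ell_apply (fun j ↦ (B j : Mat n)),
      sum_mulDist_ell_apply (fun j ↦ (B j : Mat n)),
      hστ _ ((tsupport_expansionTest_subset _ _ _).trans hφ)]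
  by_cases hgZ : g ∈ Distribution.dsupport (ell w Z σ)
  · rw [normalDegree, if_pos hgZ, WithBot.coe_lt_coe]
    cases hd : Nat.find hex with
    | zero =>
      rw [hd] at hτ
      refine absurd hgZ ((Distribution.notMem_dsupport_iff g).mpr ⟨V, fun φ hφ ↦ ?_, hVo, hgV⟩)
      rw [hloc φ hφ]
      exact m.sum_mulDist_ell_mem_distAnnihilator hZ.1 hi hB hexp hτ φ Submodule.mem_top
    | succ d =>
      rw [hd] at hτ
      refine (iInf₂_le d ⟨V, hVo, hgV, _,
        m.sum_mulDist_ell_mem_normalFiltration hZ.1 hi hB hexp hτ, hloc⟩).trans_lt ?_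
      exact Nat.cast_lt.mpr (Nat.lt_succ_self d)
  · rw [normalDegree, if_neg hgZ]
    exact WithBot.bot_lt_coe _
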